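/- Let $\varphi:\mathbb R^n\to\mathbb R^n$ be of class $C^1$ and let $K\subset\mathbb R^n$ be nonempty, compact and forward-invariant for $\dot x=\varphi(x)$: for every $a\in K$ the solution $x(t,a)=\varphi^t(a)$ with $x(0,a)=a$ exists and lies in $K$ for all $t\ge 0$. For $\tau\ge 0$, $a\in K$, $\delta>0$ let $N(\tau,a,\delta)$ be the minimal number of open Euclidean balls of radius $\delta$ needed to cover $\varphi^\tau(B_\delta(a)\cap K)$. The restoration entropy is $$H_{\rm res}(\varphi,K)=\lim_{\tau\to\infty}\frac1\tau\,\limsup_{\delta\to0+}\,\sup_{a\in K}\log_2 N(\tau,a,\delta),$$ where the limit exists. Call a continuous map $P$ from $K$ to the real symmetric positive definite $n\times n$ matrices admissible if for every $a\in K$ the orbital derivative $\dot P(a)=\lim_{\tau\to0+}\tau^{-1}\bigl(P(x(\tau,a))-P(a)\bigr)$ exists and the function $t\mapsto\dot P(x(t,a))$ is continuous on $[0,\infty)$. For such $P$ and $x\in K$ let $\varsigma_1^P(x),\dots,\varsigma_n^P(x)$ be the (real) roots $\lambda$, repeated according to multiplicity, of $$\det\bigl(P(x)\mathbf D\varphi(x)+\mathbf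 D\varphi(x)^\top P(x)+\dot P(x)-\lambda P(x)\bigr)=0 ,$$ where $\mathbf D\varphi(x)$ is the Jacobian matrix. Then the following hold. (i) For every admissible $P$, $$H_{\rm res}(\varphi,K)\le\frac1{2\ln2}\,\sup_{x\in K}\sum_{i=1}^n\max\{0,\varsigma_i^P(x)\},$$ where the supremum may be $+\infty$ (in which case the bound is void). (ii) If $K$ is the closure of its interior, then for every $\varepsilon>0$ there is an admissible $P$ for which the maximum below is attained and $$H_{\rm res}(\varphi,K)\ge\frac1{2\ln2}\,\max_{x\in K}\sum_{i=1}^n\max\{0,\varsigma_i^P(x)\}-\varepsilon .$$ -/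

import Mathlib

open Filter Topology Set

noncomputable section

/-- `x` solves the autonomous equation `x' = φ(x)` on the time interval `[0, ∞)`. -/
def IsSolution {n : ℕ} (φ : EuclideanSpace ℝ (Fin n) → EuclideanSpace ℝ (Fin n))
    (x : ℝ → EuclideanSpace ℝ (Fin n)) : Prop :=
  ∀ t : ℝ, 0 ≤ t → HasDerivWithinAt x (φ (x t)) (Ici 0) t

/-- `K` is forward-invariant: the solution of `x' = φ(x)` that starts at a point of `K` exists
on `[0, ∞)` and stays in `K`. (For a `C¹` field the solution is unique, and for compact `K` a
solution that does not leave `K` automatically extends to `[0, ∞)`.) -/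
def IsForwardInvariantSet {n : ℕ} (φ : EuclideanSpace ℝ (Fin n) → EuclideanSpace ℝ (Fin n))
    (K : Set (EuclideanSpace ℝ (Fin n))) : Prop :=
  ∀ a ∈ K, ∃ x : ℝ → EuclideanSpace ℝ (Fin n),
    IsSolution φ x ∧ x 0 = a ∧ ∀ t : ℝ, 0 ≤ t → x t ∈ K

open Classical in
/-- The time-`t` map of `x' = φ(x)`: `odeFlow φ t a = x(t, a)` is the value at time `t ≥ 0` of the
solution on `[0, ∞)` that starts at `a`. The value is a dummy when there is no such solution;
only points `a` of a forward-invariant set are used. -/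
def odeFlow {n : ℕ} (φ : EuclideanSpace ℝ (Fin n) → EuclideanSpace ℝ (Fin n)) (t : ℝ)
    (a : EuclideanSpace ℝ (Fin n)) : EuclideanSpace ℝ (Fin n) :=
  if h : ∃ x : ℝ → EuclideanSpace ℝ (Fin n), IsSolution φ x ∧ x 0 = a then h.choose t else a

/-- The minimal number of open balls of radius `δ` needed to cover `S` (`⊤` if no finite number
is enough). -/
def ballCoveringNumber {n : ℕ} (S : Set (EuclideanSpace ℝ (Fin n))) (δ : ℝ) : ℕ∞ :=
  ⨅ (c : Finset (EuclideanSpace ℝ (Fin n))) (_ : S ⊆ ⋃ y ∈ c, Metric.ball y δ), (c.card : ℕ∞)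

/-- `N_{φ,K}(τ, a, δ)`: the minimal number of open `δ`-balls that cover `φ^τ(B_δ(a) ∩ K)`. -/
def resCount {n : ℕ} (φ : EuclideanSpace ℝ (Fin n) → EuclideanSpace ℝ (Fin n))
    (K : Set (EuclideanSpace ℝ (Fin n))) (τ : ℝ) (a : EuclideanSpace ℝ (Fin n)) (δ : ℝ) : ℕ∞ :=
  ballCoveringNumber (odeFlow φ τ '' (Metric.ball a δ ∩ K)) δ

/-- `(1 / τ) limsup_{δ → 0+} sup_{a ∈ K} log₂ N_{φ,K}(τ, a, δ)`, in the extended reals. -/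
def resRate {n : ℕ} (φ : EuclideanSpace ℝ (Fin n) → EuclideanSpace ℝ (Fin n))
    (K : Set (EuclideanSpace ℝ (Fin n))) (τ : ℝ) : EReal :=
  limsup (fun δ : ℝ => ⨆ a ∈ K,
      ENNReal.log ((resCount φ K τ a δ : ℕ∞) : ENNReal) / ((Real.log 2 : ℝ) : EReal))
    (𝓝[>] (0 : ℝ)) / ((τ : ℝ) : EReal)

/-- The restoration entropy `H_res(φ, K)`, the limit of `resRate φ K τ` as `τ → ∞`. It is written
as an upper limit, which is always defined; that it is a limit is part of the theorem. -/
def restorationEntropy {n : ℕ} (φ : EuclideanSpace ℝ (Fin n) → EuclideanSpace ℝ (Fin n))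
    (K : Set (EuclideanSpace ℝ (Fin n))) : EReal :=
  limsup (resRate φ K) atTop

/-- The Jacobian matrix of `φ` at `x`. -/
def jacobianMatrix {n : ℕ} (φ : EuclideanSpace ℝ (Fin n) → EuclideanSpace ℝ (Fin n))
    (x : EuclideanSpace ℝ (Fin n)) : Matrix (Fin n) (Fin n) ℝ :=
  Matrix.of fun i j => (fderiv ℝ φ x (EuclideanSpace.single j 1)) i

/-- The symmetric part `(B + Bᵀ) / 2`. -/
def symPart {n : ℕ} (B : Matrix (Fin n) (Fin n) ℝ) : Matrix (Fin n) (Fin n) ℝ :=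
  (1 / 2 : ℝ) • (B + B.transpose)

/-- `P` is a continuous map from `K` to the symmetric positive definite matrices which has at every
`a ∈ K` the orbital derivative `Pdot a = lim_{τ → 0+} (P(x(τ, a)) - P(a)) / τ`, and this derivative
is orbitally continuous: `t ↦ Pdot (x(t, a))` is continuous on `[0, ∞)`. On `K` the map `Pdot` is
determined by `P`; values of `P` and `Pdot` outside `K` play no role. -/
structure IsMetricWithOrbitalDeriv {n : ℕ}
    (φ : EuclideanSpace ℝ (Fin n) → EuclideanSpace ℝ (Fin n))
    (K : Set (EuclideanSpace ℝ (Fin n)))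
    (P Pdot : EuclideanSpace ℝ (Fin n) → Matrix (Fin n) (Fin n) ℝ) : Prop where
  posDef : ∀ a ∈ K, (P a).PosDef
  continuousOn : ContinuousOn P K
  hasOrbitalDeriv : ∀ a ∈ K,
    Tendsto (fun τ : ℝ => τ⁻¹ • (P (odeFlow φ τ a) - P a)) (𝓝[>] (0 : ℝ)) (𝓝 (Pdot a))
  orbitallyContinuous : ∀ a ∈ K, ContinuousOn (fun t : ℝ => Pdot (odeFlow φ t a)) (Ici 0)

/-- The polynomial `det (S - λ P)` in the variable `λ`. -/
def pencilPoly {n : ℕ} (S P : Matrix (Fin n) (Fin n) ℝ) : Polynomial ℝ :=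
  (S.map Polynomial.C - (Polynomial.X : Polynomial ℝ) • P.map Polynomial.C).det

/-- The roots `ς_i^P(x)` of `det (2 [P(x) Dφ(x)]^sym + Pdot(x) - λ P(x)) = 0`, repeated in
accordance with their multiplicity. -/
def metricRoots {n : ℕ} (φ : EuclideanSpace ℝ (Fin n) → EuclideanSpace ℝ (Fin n))
    (P Pdot : EuclideanSpace ℝ (Fin n) → Matrix (Fin n) (Fin n) ℝ)
    (x : EuclideanSpace ℝ (Fin n)) : Multiset ℝ :=
  (pencilPoly ((2 : ℝ) • symPart (P x * jacobianMatrix φ x) + Pdot x) (P x)).roots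

/-- `∑ i, max {0, ς_i^P(x)}`. -/
def posRootSum {n : ℕ} (φ : EuclideanSpace ℝ (Fin n) → EuclideanSpace ℝ (Fin n))
    (P Pdot : EuclideanSpace ℝ (Fin n) → Matrix (Fin n) (Fin n) ℝ)
    (x : EuclideanSpace ℝ (Fin n)) : ℝ :=
  ((metricRoots φ P Pdot x).map fun s => max 0 s).sum

end

/-!
The argument compares three quantities: the covering numbers of the images of small balls, the
number `expansion L = det (1 + Lᵀ L)` for the fundamental matrix `L = Φ(t, a)` of the variational
equation along the trajectory of `a`, and the roots of the pencil of a metric.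

On a small ball the time-`t` map is close to its linearization, uniformly on `K`, and the number
of `δ`-balls that cover `Φ(t, a) B_δ` is, up to a factor that depends only on the dimension,
`√(expansion (Φ(t, a)))`: both are comparable to the volume of `Φ(t, a) B + B`. The upper estimate
holds at every point of `K`, the lower one at interior points, which are dense in `K` in the second
part. The rates are subadditive up to a constant because a ball that meets `K` can be covered by
`3 ^ n` balls of the same radius with centers in `K`; so the limit exists by Fekete's lemma
(`exists_rate_limit`). It is at most half the exponential growth rate of `expansion` on `K`, in base
two (`limit_le_of_expansion_le`), and equal to it if `K` is the closure of its interior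
(`exists_expansion_growth`).

For the upper bound let `N(t) = P(a) + Φ(t, a)ᵀ P(x(t, a)) Φ(t, a)`, whose determinant is at least
a constant times `expansion (Φ(t, a))`. With the symmetric matrix `S = P Dφ + Dφᵀ P + Ṗ` of the
pencil, the right derivative of `log det N` is at most `tr (N⁻¹ Φᵀ S Φ)`. If `Z` is the positive
part of `S` relative to `P`, this is at most `tr (P⁻¹ Z)`, the sum of the positive parts of the
roots (`log_det_add_pullback_le`).

For the second part let `log expansion (Φ(t, a)) ≤ M t + C` with `M` close to twice the entropy
(times `log 2`). Fix a small `κ` and a smaller time step `h`, let `θ = 1 - κ h`, and start from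
`P₀ = 1` with the iteration `Pₖ₊₁ = (Φ(h)ᵀ Pₖ Φ(h)) ^ θ`. A power of a positive definite matrix is
a weighted geometric mean with `1`. Geometric means are compatible with congruences, monotone in
both arguments by the Löwner–Heinz inequality, and satisfy
`det (1 + A #_θ B) ≤ det (1 + A) ^ (1 - θ) * det (1 + B) ^ θ`, because `det (1 + Hᵀ diag(d) H)` is a
polynomial in `d` with nonnegative coefficients. Hence `log det (1 + Φ(h)ᵀ Pₖ Φ(h)) ≤ M / κ + C` for
all `k`, and the factor by which `Pₖ₊₁` can exceed `Pₖ` tends to `1`. Let `Q = Φ(h)ᵀ Pₖ Φ(h)` and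
`P = Pₖ₊₁ = Q ^ (1 - κ h)` for a large `k`; then `Φ(h)ᵀ P Φ(h) ≤ e ^ (κ h²) Q` and
`log det (1 + Q) ≤ M / κ + C`. The mean of `Φ(s)ᵀ P Φ(s)` over `0 ≤ s ≤ h` has an orbital
derivative, the matrix of its pencil is `(Φ(h)ᵀ P Φ(h) - P) / h`, and the positive parts of the
roots add up to at most about `κ log det (1 + Q) ≤ M + κ C` (`pencilSum_le_of_isGeomMean`,
`exists_metric_posRootSum_le`). The maximum is attained because the sum of the positive parts is
an upper semicontinuous function of the point.
-/

open Matrix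

/-! ### Quadratic forms and simultaneous diagonalization -/

namespace RestorationEntropy

variable {ι : Type*} [Fintype ι]

/-- The Loewner order on real square matrices, expressed through the quadratic forms. It is applied
to symmetric matrices, which are determined by their quadratic forms. -/
def QuadLe (A B : Matrix ι ι ℝ) : Prop := ∀ v : ι → ℝ, v ⬝ᵥ A *ᵥ v ≤ v ⬝ᵥ B *ᵥ v

theorem quadLe_refl (A : Matrix ι ι ℝ) : QuadLe A A := fun _ => le_rfl

theorem QuadLe.trans {A B C : Matrix ι ι ℝ} (h : QuadLe A B) (h' : QuadLe B C) : QuadLe A C :=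
  fun v => (h v).trans (h' v)

theorem quad_congr (A H : Matrix ι ι ℝ) (v : ι → ℝ) :
    v ⬝ᵥ (Hᵀ * A * H) *ᵥ v = (H *ᵥ v) ⬝ᵥ A *ᵥ (H *ᵥ v) := by
  rw [← mulVec_mulVec, ← mulVec_mulVec, dotProduct_mulVec, vecMul_transpose]

theorem quad_smul (c : ℝ) (A : Matrix ι ι ℝ) (v : ι → ℝ) :
    v ⬝ᵥ (c • A) *ᵥ v = c * (v ⬝ᵥ A *ᵥ v) := by
  rw [smul_mulVec, dotProduct_smul, smul_eq_mul]

theorem quad_add (A B : Matrix ι ι ℝ) (v : ι → ℝ) :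
    v ⬝ᵥ (A + B) *ᵥ v = v ⬝ᵥ A *ᵥ v + v ⬝ᵥ B *ᵥ v := by
  rw [add_mulVec, dotProduct_add]

theorem quad_sub (A B : Matrix ι ι ℝ) (v : ι → ℝ) :
    v ⬝ᵥ (A - B) *ᵥ v = v ⬝ᵥ A *ᵥ v - v ⬝ᵥ B *ᵥ v := by
  rw [sub_mulVec, dotProduct_sub]

theorem QuadLe.congr_left {A B : Matrix ι ι ℝ} (h : QuadLe A B) (H : Matrix ι ι ℝ) :
    QuadLe (Hᵀ * A * H) (Hᵀ * B * H) := fun v => by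
  rw [quad_congr, quad_congr]; exact h _

theorem QuadLe.smul {A B : Matrix ι ι ℝ} (h : QuadLe A B) {c : ℝ} (hc : 0 ≤ c) :
    QuadLe (c • A) (c • B) := fun v => by
  rw [quad_smul, quad_smul]; exact mul_le_mul_of_nonneg_left (h v) hc

theorem posDef_iff_quad {A : Matrix ι ι ℝ} :
    A.PosDef ↔ A.IsSymm ∧ ∀ v : ι → ℝ, v ≠ 0 → 0 < v ⬝ᵥ A *ᵥ v := by
  rw [posDef_iff_dotProduct_mulVec]
  simp [IsHermitian, IsSymm, conjTranspose_eq_transpose_of_trivial]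

theorem posSemidef_iff_quad {A : Matrix ι ι ℝ} :
    A.PosSemidef ↔ A.IsSymm ∧ ∀ v : ι → ℝ, 0 ≤ v ⬝ᵥ A *ᵥ v := by
  rw [posSemidef_iff_dotProduct_mulVec]
  simp [IsHermitian, IsSymm, conjTranspose_eq_transpose_of_trivial]

theorem isSymm_congr {A : Matrix ι ι ℝ} (hA : A.IsSymm) (H : Matrix ι ι ℝ) :
    (Hᵀ * A * H).IsSymm := by
  rw [IsSymm, transpose_mul, transpose_mul, transpose_transpose, hA.eq, Matrix.mul_assoc]

theorem posSemidef_congr {A : Matrix ι ι ℝ} (hA : A.PosSemidef) (H : Matrix ι ι ℝ) :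
    (Hᵀ * A * H).PosSemidef := by
  obtain ⟨h1, h2⟩ := posSemidef_iff_quad.1 hA
  refine posSemidef_iff_quad.2 ⟨isSymm_congr h1 H, fun v => ?_⟩
  rw [quad_congr]
  exact h2 _

theorem QuadLe.posDef {A B : Matrix ι ι ℝ} (hA : A.PosDef) (h : QuadLe A B) (hB : B.IsSymm) :
    B.PosDef :=
  posDef_iff_quad.2 ⟨hB, fun v hv => ((posDef_iff_quad.1 hA).2 v hv).trans_le (h v)⟩

variable [DecidableEq ι]

theorem quad_diagonal (d v : ι → ℝ) : v ⬝ᵥ (diagonal d) *ᵥ v = ∑ i, d i * v i ^ 2 := by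
  simp only [dotProduct, mulVec_diagonal]
  exact Finset.sum_congr rfl fun i _ => by ring

theorem quad_one (v : ι → ℝ) : v ⬝ᵥ (1 : Matrix ι ι ℝ) *ᵥ v = v ⬝ᵥ v := by
  rw [one_mulVec]

theorem quad_transpose_mul_self (H : Matrix ι ι ℝ) (v : ι → ℝ) :
    v ⬝ᵥ (Hᵀ * H) *ᵥ v = (H *ᵥ v) ⬝ᵥ (H *ᵥ v) := by
  have := quad_congr 1 H v
  rwa [Matrix.mul_one, one_mulVec] at this

theorem quad_single (A : Matrix ι ι ℝ) (i : ι) :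
    (Pi.single i 1 : ι → ℝ) ⬝ᵥ A *ᵥ (Pi.single i 1) = A i i := by
  simp

theorem posDef_congr {A H : Matrix ι ι ℝ} (hA : A.PosDef) (hH : IsUnit H.det) :
    (Hᵀ * A * H).PosDef := by
  obtain ⟨h1, h2⟩ := posDef_iff_quad.1 hA
  refine posDef_iff_quad.2 ⟨isSymm_congr h1 H, fun v hv => ?_⟩
  rw [quad_congr]
  refine h2 _ fun h0 => hv ?_
  exact (mulVec_injective_iff_isUnit.2 ((isUnit_iff_isUnit_det _).2 hH)) (by rw [h0, mulVec_zero])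

theorem posDef_congr_diagonal {H : Matrix ι ι ℝ} (hH : IsUnit H.det) {d : ι → ℝ}
    (hd : ∀ i, 0 < d i) : (Hᵀ * diagonal d * H).PosDef :=
  posDef_congr (PosDef.diagonal hd) hH

theorem posDef_transpose_mul_self {H : Matrix ι ι ℝ} (hH : IsUnit H.det) : (Hᵀ * H).PosDef := by
  simpa using posDef_congr (PosDef.one (n := ι) (R := ℝ)) hH

theorem exists_orthogonal_diag {S : Matrix ι ι ℝ} (hS : S.IsSymm) :
    ∃ (V : Matrix ι ι ℝ) (d : ι → ℝ), V * Vᵀ = 1 ∧ Vᵀ * V = 1 ∧ S = Vᵀ * diagonal d * V := by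
  have hH : S.IsHermitian := by
    rw [IsHermitian, conjTranspose_eq_transpose_of_trivial]; exact hS
  refine ⟨(hH.eigenvectorUnitary : Matrix ι ι ℝ)ᵀ, hH.eigenvalues, ?_, ?_, ?_⟩
  · have := Unitary.coe_star_mul_self hH.eigenvectorUnitary
    rwa [star_eq_conjTranspose, conjTranspose_eq_transpose_of_trivial] at this
  · have := Unitary.coe_mul_star_self hH.eigenvectorUnitary
    rwa [Unitary.coe_star, star_eq_conjTranspose, conjTranspose_eq_transpose_of_trivial] at this
  · conv_lhs => rw [hH.spectral_theorem]
    rw [Unitary.conjStarAlgAut_apply, star_eq_conjTranspose,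
      conjTranspose_eq_transpose_of_trivial, transpose_transpose]
    rfl

theorem isUnit_det_of_mul_eq_one {A B : Matrix ι ι ℝ} (h : A * B = 1) : IsUnit A.det :=
  IsUnit.of_mul_eq_one B.det (by rw [← det_mul, h, det_one])

theorem exists_factor {P : Matrix ι ι ℝ} (hP : P.PosDef) :
    ∃ B : Matrix ι ι ℝ, IsUnit B.det ∧ P = Bᵀ * B := by
  obtain ⟨h1, h2⟩ := posDef_iff_quad.1 hP
  obtain ⟨V, d, hV, hV', rfl⟩ := exists_orthogonal_diag h1
  have hd : ∀ i, 0 < d i := fun i => by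
    have := h2 (Vᵀ *ᵥ Pi.single i 1) (fun h0 => by
      have h3 : V *ᵥ (Vᵀ *ᵥ (Pi.single i 1 : ι → ℝ)) = 0 := by rw [h0, mulVec_zero]
      rw [mulVec_mulVec, hV, one_mulVec] at h3
      simpa using congrFun h3 i)
    rwa [quad_congr, mulVec_mulVec, hV, one_mulVec, quad_single, diagonal_apply_eq] at this
  refine ⟨diagonal (fun i => √(d i)) * V, ?_, ?_⟩
  · rw [det_mul, det_diagonal]
    refine IsUnit.mul ?_ (isUnit_det_of_mul_eq_one hV)
    exact (Finset.prod_ne_zero_iff.2 fun i _ => (Real.sqrt_pos.2 (hd i)).ne').isUnit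
  · have e : diagonal d = diagonal (fun i => √(d i)) * diagonal (fun i => √(d i)) := by
      simp only [diagonal_mul_diagonal, Real.mul_self_sqrt (hd _).le]
    rw [transpose_mul, diagonal_transpose, e]
    simp only [Matrix.mul_assoc]

/-- Two quadratic forms, one of them positive definite, are simultaneously diagonalized by a
congruence. -/
theorem exists_simultaneous_diag {P S : Matrix ι ι ℝ} (hP : P.PosDef) (hS : S.IsSymm) :
    ∃ (H : Matrix ι ι ℝ) (d : ι → ℝ), IsUnit H.det ∧ P = Hᵀ * H ∧ S = Hᵀ * diagonal d * H := by
  obtain ⟨B, hB, rfl⟩ := exists_factor hP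
  obtain ⟨V, d, hV, hV', h⟩ := exists_orthogonal_diag (isSymm_congr hS B⁻¹)
  have hB1 : B⁻¹ * B = 1 := nonsing_inv_mul _ hB
  refine ⟨V * B, d, ?_, ?_, ?_⟩
  · rw [det_mul]; exact (isUnit_det_of_mul_eq_one hV).mul hB
  · rw [transpose_mul, Matrix.mul_assoc, ← Matrix.mul_assoc Vᵀ, hV', Matrix.one_mul]
  · calc S = (B⁻¹ * B)ᵀ * S * (B⁻¹ * B) := by rw [hB1]; simp
      _ = Bᵀ * (B⁻¹ᵀ * S * B⁻¹) * B := by rw [transpose_mul]; simp only [Matrix.mul_assoc]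
      _ = _ := by rw [h, transpose_mul]; simp only [Matrix.mul_assoc]

theorem quad_at_inv_single {H : Matrix ι ι ℝ} (hH : IsUnit H.det) (A : Matrix ι ι ℝ) (i : ι) :
    (H⁻¹ *ᵥ Pi.single i 1) ⬝ᵥ (Hᵀ * A * H) *ᵥ (H⁻¹ *ᵥ Pi.single i 1) = A i i := by
  rw [quad_congr, mulVec_mulVec, mul_nonsing_inv _ hH, one_mulVec, quad_single]

theorem diag_pos_of_posDef_congr {H : Matrix ι ι ℝ} (hH : IsUnit H.det) {d : ι → ℝ}
    (h : (Hᵀ * diagonal d * H).PosDef) (i : ι) : 0 < d i := by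
  have h2 := (posDef_iff_quad.1 h).2 (H⁻¹ *ᵥ Pi.single i 1) (fun h0 => by
      have h3 : H *ᵥ (H⁻¹ *ᵥ (Pi.single i 1 : ι → ℝ)) = 0 := by rw [h0, mulVec_zero]
      rw [mulVec_mulVec, mul_nonsing_inv _ hH, one_mulVec] at h3
      simpa using congrFun h3 i)
  rwa [quad_at_inv_single hH, diagonal_apply_eq] at h2

theorem trace_inv_mul_congr {H : Matrix ι ι ℝ} (hH : IsUnit H.det) (Z : Matrix ι ι ℝ) :
    ((Hᵀ * H)⁻¹ * (Hᵀ * Z * H)).trace = Z.trace := by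
  have hT : IsUnit Hᵀ.det := by rwa [det_transpose]
  rw [Matrix.mul_inv_rev, Matrix.mul_assoc Hᵀ, ← Matrix.mul_assoc, Matrix.mul_assoc H⁻¹,
    nonsing_inv_mul _ hT, Matrix.mul_one, ← Matrix.mul_assoc, trace_mul_comm, ← Matrix.mul_assoc,
    mul_nonsing_inv _ hH, Matrix.one_mul]

/-! ### Determinant inequalities -/

theorem det_le_det_of_quadLe {A B : Matrix ι ι ℝ} (hA : A.PosDef) (hB : B.IsSymm)
    (h : QuadLe A B) : A.det ≤ B.det := by
  obtain ⟨H, d, hH, rfl, rfl⟩ := exists_simultaneous_diag hA hB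
  have hd : ∀ i, 1 ≤ d i := fun i => by
    have := h (H⁻¹ *ᵥ Pi.single i 1)
    have h1 := quad_at_inv_single hH 1 i
    rw [Matrix.mul_one] at h1
    rwa [quad_at_inv_single hH, diagonal_apply_eq, h1, one_apply_eq] at this
  rw [det_mul, det_mul, det_mul, det_diagonal, det_transpose]
  have : 1 ≤ ∏ i, d i := Finset.prod_induction _ (fun x => 1 ≤ x)
    (fun _ _ ha hb => one_le_mul_of_one_le_of_one_le ha hb) le_rfl fun i _ => hd i
  nlinarith [mul_self_nonneg H.det]

/-- The tangent plane inequality for the concave function `log det`. -/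
theorem log_det_le_add_trace {A B : Matrix ι ι ℝ} (hA : A.PosDef) (hB : B.PosDef) :
    Real.log B.det ≤ Real.log A.det + (A⁻¹ * (B - A)).trace := by
  obtain ⟨H, d, hH, rfl, rfl⟩ := exists_simultaneous_diag hA (posDef_iff_quad.1 hB).1
  have hd := diag_pos_of_posDef_congr hH hB
  have hu := (posDef_transpose_mul_self hH).det_pos
  have e : Hᵀ * diagonal d * H - Hᵀ * H = Hᵀ * (diagonal d - 1) * H := by
    rw [Matrix.mul_sub, Matrix.sub_mul, Matrix.mul_one]
  rw [e, trace_inv_mul_congr hH, trace_sub, trace_diagonal, trace_one]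
  have e2 : (Hᵀ * diagonal d * H).det = (Hᵀ * H).det * ∏ i, d i := by
    rw [det_mul, det_mul, det_mul, det_diagonal]; ring
  rw [e2, Real.log_mul hu.ne' (Finset.prod_pos fun i _ => hd i).ne',
    Real.log_prod (fun i _ => (hd i).ne')]
  have : ∑ i, Real.log (d i) ≤ ∑ i, (d i - 1) :=
    Finset.sum_le_sum fun i _ => Real.log_le_sub_one_of_pos (hd i)
  rw [Finset.sum_sub_distrib] at this
  simp at this ⊢
  linarith

/-- The determinant of `D M + 1`, `D` diagonal, as a polynomial in the diagonal entries; the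
coefficients are the principal minors of `M`. -/
theorem det_diagonal_mul_add_one (d : ι → ℝ) (M : Matrix ι ι ℝ) :
    (diagonal d * M + 1).det = ∑ s : Finset ι, (∏ i ∈ s, d i) *
      (Matrix.of fun i j => if i ∈ s then M i j else (1 : Matrix ι ι ℝ) i j).det := by
  have h := (detRowAlternating (n := ι) (R := ℝ)).map_add_univ
    (fun i j => (diagonal d * M) i j) (fun i j => (1 : Matrix ι ι ℝ) i j)
  refine h.trans (Finset.sum_congr rfl fun s _ => ?_)
  have e : s.piecewise (fun i j => (diagonal d * M) i j) (fun i j => (1 : Matrix ι ι ℝ) i j)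
      = s.piecewise (fun i => d i • (fun j => if i ∈ s then M i j else (1 : Matrix ι ι ℝ) i j))
        (fun i j => if i ∈ s then M i j else (1 : Matrix ι ι ℝ) i j) := by
    funext i
    by_cases hi : i ∈ s
    · rw [Finset.piecewise_eq_of_mem _ _ _ hi, Finset.piecewise_eq_of_mem _ _ _ hi]
      funext j
      simp [diagonal_mul, hi]
    · rw [Finset.piecewise_eq_of_notMem _ _ _ hi, Finset.piecewise_eq_of_notMem _ _ _ hi]
      simp [hi]
  rw [e]
  exact (detRowAlternating (n := ι) (R := ℝ)).toMultilinearMap.map_piecewise_smul d _ s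

theorem det_nonneg_of_eq_submatrix {κ κ' : Type*} {_ : Fintype κ} {_ : DecidableEq κ}
    {M : Matrix κ' κ' ℝ} (hM : M.PosSemidef) (f : κ → κ') {A : Matrix κ κ ℝ}
    (hA : A = M.submatrix f f) : 0 ≤ A.det :=
  hA ▸ (hM.submatrix f).det_nonneg

theorem det_piecewise_nonneg {M : Matrix ι ι ℝ} (hM : M.PosSemidef) (s : Finset ι) :
    0 ≤ (Matrix.of fun i j => if i ∈ s then M i j else (1 : Matrix ι ι ℝ) i j).det := by
  rw [twoBlockTriangular_det _ (· ∈ s)]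
  · refine mul_nonneg ?_ ?_
    · refine det_nonneg_of_eq_submatrix hM Subtype.val ?_
      ext i j
      simp [toSquareBlockProp]
    · refine (zero_le_one (α := ℝ)).trans_eq ?_
      rw [← det_one (n := {i // i ∉ s}) (R := ℝ)]
      congr 1
      ext i j
      have := i.2
      simp [toSquareBlockProp, one_apply, Subtype.ext_iff, this]
  · intro i hi j hj
    simp only [of_apply, if_neg hi]
    exact one_apply_ne fun h => hi (h.symm ▸ hj)

/-- Geodesic convexity of `log det (1 + ·)` on the positive definite matrices: along
`t ↦ Hᵀ dᵗ H` the determinant is a sum of exponentials in `t` with nonnegative coefficients, to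
which Hölder's inequality applies. -/
theorem det_one_add_rpow_le (H : Matrix ι ι ℝ) {d : ι → ℝ} (hd : ∀ i, 0 < d i) {θ : ℝ}
    (h0 : 0 < θ) (h1 : θ < 1) :
    (1 + Hᵀ * diagonal (fun i => d i ^ θ) * H).det ≤
      (1 + Hᵀ * H).det ^ (1 - θ) * (1 + Hᵀ * diagonal d * H).det ^ θ := by
  have key : ∀ e : ι → ℝ, (1 + Hᵀ * diagonal e * H).det
      = ∑ s : Finset ι, (∏ i ∈ s, e i) *
        (Matrix.of fun i j => if i ∈ s then (H * Hᵀ) i j else (1 : Matrix ι ι ℝ) i j).det :=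
    fun e => by
    rw [Matrix.mul_assoc, det_one_add_mul_comm, add_comm, Matrix.mul_assoc,
      det_diagonal_mul_add_one]
  have hM : (H * Hᵀ).PosSemidef := by
    have := posSemidef_self_mul_conjTranspose H
    rwa [conjTranspose_eq_transpose_of_trivial] at this
  have key1 := key (fun _ => 1)
  rw [diagonal_one, Matrix.mul_one] at key1
  rw [key1, key, key]
  set c : Finset ι → ℝ := fun s =>
    (Matrix.of fun i j => if i ∈ s then (H * Hᵀ) i j else (1 : Matrix ι ι ℝ) i j).det
  have hc : ∀ s, 0 ≤ c s := fun s => det_piecewise_nonneg hM s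
  have hp : ∀ s : Finset ι, 0 ≤ ∏ i ∈ s, d i := fun s => Finset.prod_nonneg fun i _ => (hd i).le
  have h1' : 0 < 1 - θ := by linarith
  have hpq : (1 / (1 - θ)).HolderConjugate (1 / θ) := by
    rw [Real.holderConjugate_iff]
    exact ⟨by rw [lt_div_iff₀ h1']; linarith, by simp⟩
  have hol := Real.inner_le_Lp_mul_Lq_of_nonneg Finset.univ (f := fun s => c s ^ (1 - θ))
    (g := fun s => ((∏ i ∈ s, d i) * c s) ^ θ) hpq
    (fun s _ => Real.rpow_nonneg (hc s) _)
    (fun s _ => Real.rpow_nonneg (mul_nonneg (hp s) (hc s)) _)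
  simp only [one_div_one_div] at hol
  refine le_trans (le_of_eq ?_) (hol.trans (le_of_eq ?_))
  · refine Finset.sum_congr rfl fun s _ => ?_
    rw [Real.mul_rpow (hp s) (hc s), Real.finsetProd_rpow _ _ (fun i _ => (hd i).le),
      mul_left_comm, ← Real.rpow_add_of_nonneg (hc s) h1'.le h0.le, sub_add_cancel, Real.rpow_one]
  · congr 2
    · refine Finset.sum_congr rfl fun s _ => ?_
      rw [← Real.rpow_mul (hc s), mul_one_div_cancel h1'.ne', Real.rpow_one,
        Finset.prod_const_one, one_mul]
    · refine Finset.sum_congr rfl fun s _ => ?_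
      rw [← Real.rpow_mul (mul_nonneg (hp s) (hc s)), mul_one_div_cancel h0.ne', Real.rpow_one]

/-! ### The roots of the pencil `det (S - λ P)` -/

/-- The sum of the positive parts of the roots of `det (S - λ P)`. -/
noncomputable def pencilSum {n : ℕ} (S P : Matrix (Fin n) (Fin n) ℝ) : ℝ :=
  ((pencilPoly S P).roots.map fun s => max 0 s).sum

theorem pencilSum_congr_diagonal {n : ℕ} {H : Matrix (Fin n) (Fin n) ℝ} (hH : IsUnit H.det)
    (d : Fin n → ℝ) :
    pencilSum (Hᵀ * diagonal d * H) (Hᵀ * H) = ∑ i, max 0 (d i) := by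
  have e : pencilPoly (Hᵀ * diagonal d * H) (Hᵀ * H)
      = Polynomial.C ((H.det * H.det) * (-1) ^ n) *
        (Multiset.map (fun a => Polynomial.X - Polynomial.C a)
          (Multiset.map d Finset.univ.val)).prod := by
    have e1 : (Hᵀ * diagonal d * H).map Polynomial.C
          - (Polynomial.X : Polynomial ℝ) • (Hᵀ * H).map Polynomial.C
        = (H.map Polynomial.C)ᵀ * (diagonal fun i => Polynomial.C (d i) - Polynomial.X)
          * H.map Polynomial.C := by
      have : (diagonal fun i => Polynomial.C (d i) - (Polynomial.X : Polynomial ℝ))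
          = (diagonal d).map Polynomial.C - (Polynomial.X : Polynomial ℝ) • 1 := by
        ext i j : 2
        by_cases h : i = j
        · subst h; simp
        · simp [h]
      rw [this, Matrix.mul_sub, Matrix.sub_mul, Matrix.mul_smul, Matrix.smul_mul, Matrix.mul_one,
        Matrix.map_mul, Matrix.map_mul, Matrix.map_mul, transpose_map]
    have e2 : H.map Polynomial.C = (Polynomial.C : ℝ →+* Polynomial ℝ).mapMatrix H := rfl
    rw [pencilPoly, e1, det_mul, det_mul, det_transpose, det_diagonal, e2, ← RingHom.map_det,
      Multiset.map_map]
    have e3 : ∏ i, (Polynomial.C (d i) - (Polynomial.X : Polynomial ℝ))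
        = Polynomial.C ((-1) ^ n) * ∏ i, (Polynomial.X - Polynomial.C (d i)) := by
      have : ∀ i, Polynomial.C (d i) - (Polynomial.X : Polynomial ℝ)
          = (-1) * (Polynomial.X - Polynomial.C (d i)) := fun i => by ring
      simp only [this, Finset.prod_mul_distrib]
      simp
    rw [e3, Finset.prod_eq_multiset_prod]
    simp only [Polynomial.C_mul, Function.comp_def]
    ring
  rw [pencilSum, e, Polynomial.roots_C_mul _ (mul_ne_zero (mul_ne_zero hH.ne_zero hH.ne_zero)
    (pow_ne_zero _ (by norm_num))), Polynomial.roots_multiset_prod_X_sub_C, Multiset.map_map,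
    Finset.sum_eq_multiset_sum]
  rfl

/-- The sum of the positive parts of the roots is the trace of a positive semidefinite majorant of
`S` relative to `P`. -/
theorem exists_posSemidef_trace_eq_pencilSum {n : ℕ} {S P : Matrix (Fin n) (Fin n) ℝ}
    (hP : P.PosDef) (hS : S.IsSymm) :
    ∃ Z : Matrix (Fin n) (Fin n) ℝ, Z.PosSemidef ∧ QuadLe S Z ∧
      (P⁻¹ * Z).trace = pencilSum S P := by
  obtain ⟨H, d, hH, rfl, rfl⟩ := exists_simultaneous_diag hP hS
  refine ⟨Hᵀ * diagonal (fun i => max 0 (d i)) * H, ?_, ?_, ?_⟩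
  · exact posSemidef_congr (PosSemidef.diagonal fun i => le_max_left _ _) H
  · refine QuadLe.congr_left (fun v => ?_) H
    rw [quad_diagonal, quad_diagonal]
    exact Finset.sum_le_sum fun i _ => mul_le_mul_of_nonneg_right (le_max_right _ _) (sq_nonneg _)
  · rw [trace_inv_mul_congr hH, trace_diagonal, pencilSum_congr_diagonal hH]

/-- Among the positive semidefinite majorants of `S`, the sum of the positive parts of the roots is
the smallest trace relative to `P`. -/
theorem pencilSum_le_trace {n : ℕ} {S P Z : Matrix (Fin n) (Fin n) ℝ}
    (hP : P.PosDef) (hS : S.IsSymm) (hZ : Z.PosSemidef) (h : QuadLe S Z) :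
    pencilSum S P ≤ (P⁻¹ * Z).trace := by
  obtain ⟨H, d, hH, rfl, rfl⟩ := exists_simultaneous_diag hP hS
  have hH1 : H⁻¹ * H = 1 := nonsing_inv_mul _ hH
  have e : Z = Hᵀ * (H⁻¹ᵀ * Z * H⁻¹) * H := by
    calc Z = (H⁻¹ * H)ᵀ * Z * (H⁻¹ * H) := by rw [hH1]; simp
      _ = _ := by rw [transpose_mul]; simp only [Matrix.mul_assoc]
  rw [e] at h hZ
  rw [e, trace_inv_mul_congr hH, pencilSum_congr_diagonal hH, trace]
  refine Finset.sum_le_sum fun i _ => max_le ?_ ?_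
  · have := (posSemidef_iff_quad.1 hZ).2 (H⁻¹ *ᵥ Pi.single i 1)
    rwa [quad_at_inv_single hH] at this
  · have := h (H⁻¹ *ᵥ Pi.single i 1)
    rwa [quad_at_inv_single hH, quad_at_inv_single hH, diagonal_apply_eq] at this

/-- The matrix `Y (R + Yᵀ Y)⁻¹ Yᵀ` is at most `1`; hence passing from `P = Hᵀ H` to
`R + (H Φ)ᵀ (H Φ)` does not increase the relative trace of a positive semidefinite matrix. -/
theorem trace_inv_add_congr_le {R P Z Φ : Matrix ι ι ℝ} (hR : R.PosDef) (hP : P.PosDef)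
    (hZ : Z.PosSemidef) :
    ((R + Φᵀ * P * Φ)⁻¹ * (Φᵀ * Z * Φ)).trace ≤ (P⁻¹ * Z).trace := by
  obtain ⟨hZs, hZq⟩ := posSemidef_iff_quad.1 hZ
  obtain ⟨H, d, hH, rfl, rfl⟩ := exists_simultaneous_diag hP hZs
  have hd : ∀ i, 0 ≤ d i := fun i => by
    have := hZq (H⁻¹ *ᵥ Pi.single i 1)
    rwa [quad_at_inv_single hH, diagonal_apply_eq] at this
  rw [trace_inv_mul_congr hH, trace_diagonal]
  set Y := H * Φ
  have eY : Φᵀ * (Hᵀ * H) * Φ = Yᵀ * Y := by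
    simp only [Y, transpose_mul, Matrix.mul_assoc]
  set N := R + Yᵀ * Y with hN
  have hNpd : N.PosDef := by
    refine hR.add_posSemidef (posSemidef_iff_quad.2 ⟨?_, fun v => ?_⟩)
    · rw [IsSymm, transpose_mul, transpose_transpose]
    · rw [quad_transpose_mul_self]; exact dotProduct_self_star_nonneg _
  have e2 : (N⁻¹ * (Φᵀ * (Hᵀ * diagonal d * H) * Φ)).trace
      = (diagonal d * (Y * N⁻¹ * Yᵀ)).trace := by
    have : N⁻¹ * (Φᵀ * (Hᵀ * diagonal d * H) * Φ) = (N⁻¹ * Yᵀ) * (diagonal d * Y) := by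
      simp only [Y, transpose_mul, Matrix.mul_assoc]
    rw [this, trace_mul_comm]
    simp only [Matrix.mul_assoc]
  rw [eY, e2, trace]
  refine Finset.sum_le_sum fun i _ => ?_
  rw [diag_apply, diagonal_mul]
  refine mul_le_of_le_one_right (hd i) ?_
  -- with `w = N⁻¹ Yᵀ eᵢ`, the diagonal entry `s` satisfies `s = w ⬝ N w ≥ |Y w|² ≥ s²`
  set w : ι → ℝ := (N⁻¹ * Yᵀ) *ᵥ Pi.single i 1 with hw
  have hs : (Y * N⁻¹ * Yᵀ) i i = (Y *ᵥ w) i := by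
    rw [hw, mulVec_mulVec, ← Matrix.mul_assoc]; simp
  have hNw : N *ᵥ w = Yᵀ *ᵥ Pi.single i 1 := by
    rw [hw, mulVec_mulVec, ← Matrix.mul_assoc, mul_nonsing_inv _ hNpd.det_pos.ne'.isUnit,
      Matrix.one_mul]
  have h1 : w ⬝ᵥ N *ᵥ w = (Y *ᵥ w) i := by
    rw [hNw, dotProduct_mulVec, vecMul_transpose]; simp
  have h2 : (Y *ᵥ w) ⬝ᵥ (Y *ᵥ w) ≤ w ⬝ᵥ N *ᵥ w := by
    rw [hN, quad_add, quad_transpose_mul_self]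
    have := (posSemidef_iff_quad.1 hR.posSemidef).2 w
    linarith
  have h3 : (Y *ᵥ w) i ^ 2 ≤ (Y *ᵥ w) ⬝ᵥ (Y *ᵥ w) := by
    rw [dotProduct, sq]
    exact Finset.single_le_sum (f := fun j => (Y *ᵥ w) j * (Y *ᵥ w) j)
      (fun j _ => mul_self_nonneg _) (Finset.mem_univ i)
  rw [hs]
  nlinarith

end RestorationEntropy

/-! ### Monotonicity of real powers and weighted geometric means -/

namespace RestorationEntropy

section GeomMean

variable {ι : Type*} [Fintype ι]

/-- The sum of the absolute values of the entries, a bound for the quadratic form. -/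
def absSum (E : Matrix ι ι ℝ) : ℝ := ∑ i, ∑ j, |E i j|

theorem absSum_nonneg (E : Matrix ι ι ℝ) : 0 ≤ absSum E :=
  Finset.sum_nonneg fun _ _ => Finset.sum_nonneg fun _ _ => abs_nonneg _

theorem continuous_absSum : Continuous (absSum : Matrix ι ι ℝ → ℝ) := by
  unfold absSum
  refine continuous_finsetSum _ fun i _ => continuous_finsetSum _ fun j _ => ?_
  exact (continuous_apply_apply i j).abs

theorem abs_quad_le (E : Matrix ι ι ℝ) (v : ι → ℝ) :
    |v ⬝ᵥ E *ᵥ v| ≤ absSum E * (v ⬝ᵥ v) := by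
  have hv : ∀ i, v i ^ 2 ≤ v ⬝ᵥ v := fun i => by
    rw [dotProduct, sq]
    exact Finset.single_le_sum (f := fun j => v j * v j) (fun j _ => mul_self_nonneg _)
      (Finset.mem_univ i)
  have e : v ⬝ᵥ E *ᵥ v = ∑ i, ∑ j, v i * (E i j * v j) := by
    simp only [dotProduct, mulVec, Finset.mul_sum]
  rw [e, absSum, Finset.sum_mul]
  refine (Finset.abs_sum_le_sum_abs _ _).trans (Finset.sum_le_sum fun i _ => ?_)
  rw [Finset.sum_mul]
  refine (Finset.abs_sum_le_sum_abs _ _).trans (Finset.sum_le_sum fun j _ => ?_)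
  have h1 : |v i * (E i j * v j)| = |E i j| * (|v i| * |v j|) := by
    rw [abs_mul, abs_mul]; ring
  rw [h1]
  refine mul_le_mul_of_nonneg_left ?_ (abs_nonneg _)
  have h2 := hv i
  have h3 := hv j
  rw [← sq_abs] at h2 h3
  nlinarith [sq_nonneg (|v i| - |v j|)]

variable [DecidableEq ι]

theorem sum_sq_mulVec_of_orthogonal {O : Matrix ι ι ℝ} (hO : Oᵀ * O = 1) (v : ι → ℝ) :
    ∑ i, (O *ᵥ v) i ^ 2 = ∑ i, v i ^ 2 := by
  have h := quad_transpose_mul_self O v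
  rw [hO, quad_one] at h
  simpa [dotProduct, sq] using h.symm

/-- Inversion reverses the Loewner order, for diagonal matrices in two orthonormal bases. -/
theorem sum_inv_mul_sq_le {O : Matrix ι ι ℝ} (hO : Oᵀ * O = 1) {c c' : ι → ℝ}
    (hc : ∀ i, 0 < c i) (hc' : ∀ i, 0 < c' i)
    (h : ∀ w : ι → ℝ, ∑ i, c i * w i ^ 2 ≤ ∑ i, c' i * (O *ᵥ w) i ^ 2) (v : ι → ℝ) :
    ∑ i, (c' i)⁻¹ * (O *ᵥ v) i ^ 2 ≤ ∑ i, (c i)⁻¹ * v i ^ 2 := by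
  have hO' : O * Oᵀ = 1 := mul_eq_one_comm.1 hO
  set w : ι → ℝ := fun i => (c' i)⁻¹ * (O *ᵥ v) i with hw
  set u := Oᵀ *ᵥ w with hu
  have hOu : O *ᵥ u = w := by rw [hu, mulVec_mulVec, hO', one_mulVec]
  have h1 : ∑ i, (c' i)⁻¹ * (O *ᵥ v) i ^ 2 = ∑ i, v i * u i := by
    have : (O *ᵥ v) ⬝ᵥ w = v ⬝ᵥ u := by
      rw [hu, dotProduct_mulVec v, vecMul_transpose]
    rw [dotProduct, dotProduct] at this
    rw [← this]
    exact Finset.sum_congr rfl fun i _ => by rw [hw]; ring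
  have h2 : ∑ i, c' i * (O *ᵥ u) i ^ 2 = ∑ i, (c' i)⁻¹ * (O *ᵥ v) i ^ 2 := by
    rw [hOu]
    refine Finset.sum_congr rfl fun i _ => ?_
    have := (hc' i).ne'
    simp only [hw]
    field_simp
  have h3 : ∑ i, 2 * (v i * u i) ≤ ∑ i, ((c i)⁻¹ * v i ^ 2 + c i * u i ^ 2) := by
    refine Finset.sum_le_sum fun i _ => ?_
    have h4 : (c i)⁻¹ * v i ^ 2 + c i * u i ^ 2 - 2 * (v i * u i)
        = (c i)⁻¹ * (v i - c i * u i) ^ 2 := by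
      have := (hc i).ne'
      field_simp
      ring
    have := mul_nonneg (inv_pos.2 (hc i)).le (sq_nonneg (v i - c i * u i))
    linarith
  rw [← Finset.mul_sum, Finset.sum_add_distrib] at h3
  have := h u
  linarith

/-- The Löwner–Heinz inequality for diagonal matrices in two orthonormal bases: the function
`x ↦ x ^ θ` with `0 < θ < 1` preserves the Loewner order. The power is an integral of the functions
`x ↦ t⁻¹ - (t + x)⁻¹` against a positive measure, and for these the claim is the antitonicity of the
inverse. -/
theorem sum_rpow_mul_sq_le {O : Matrix ι ι ℝ} (hO : Oᵀ * O = 1) {d d' : ι → ℝ}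
    (hd : ∀ i, 0 < d i) (hd' : ∀ i, 0 < d' i) {θ : ℝ} (h0 : 0 < θ) (h1 : θ < 1)
    (h : ∀ w : ι → ℝ, ∑ i, d i * w i ^ 2 ≤ ∑ i, d' i * (O *ᵥ w) i ^ 2) (v : ι → ℝ) :
    ∑ i, d i ^ θ * v i ^ 2 ≤ ∑ i, d' i ^ θ * (O *ᵥ v) i ^ 2 := by
  obtain ⟨μ, hμ⟩ := Real.exists_measure_rpow_eq_integral_rpowIntegrand₀₁ (p := θ) ⟨h0, h1⟩
  have key : ∀ (e w : ι → ℝ), (∀ i, 0 < e i) →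
      MeasureTheory.IntegrableOn (fun t => ∑ i, Real.rpowIntegrand₀₁ θ t (e i) * w i ^ 2)
        (Ioi 0) μ ∧
      ∑ i, e i ^ θ * w i ^ 2 = ∫ t in Ioi 0, ∑ i, Real.rpowIntegrand₀₁ θ t (e i) * w i ^ 2 ∂μ := by
    intro e w he
    have hi : ∀ i ∈ Finset.univ, MeasureTheory.IntegrableOn
        (fun t => Real.rpowIntegrand₀₁ θ t (e i) * w i ^ 2) (Ioi 0) μ :=
      fun i _ => (hμ (e i) (he i).le).1.mul_const _
    refine ⟨MeasureTheory.integrable_finsetSum _ hi, ?_⟩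
    rw [MeasureTheory.integral_finsetSum _ hi]
    refine Finset.sum_congr rfl fun i _ => ?_
    rw [MeasureTheory.integral_mul_const, ← (hμ (e i) (he i).le).2]
  rw [(key d v hd).2, (key d' (O *ᵥ v) hd').2]
  refine MeasureTheory.setIntegral_mono_on (key d v hd).1 (key d' (O *ᵥ v) hd').1
    measurableSet_Ioi fun t ht => ?_
  have ht : 0 < t := ht
  simp only [Real.rpowIntegrand₀₁, mul_assoc, ← Finset.mul_sum]
  refine mul_le_mul_of_nonneg_left ?_ (Real.rpow_nonneg ht.le _)
  simp only [sub_mul, Finset.sum_sub_distrib, ← Finset.mul_sum]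
  rw [sum_sq_mulVec_of_orthogonal hO]
  refine sub_le_sub_left (sum_inv_mul_sq_le hO (fun i => add_pos ht (hd i))
    (fun i => add_pos ht (hd' i)) (fun w => ?_) v) _
  simp only [add_mul, Finset.sum_add_distrib, ← Finset.mul_sum]
  rw [sum_sq_mulVec_of_orthogonal hO]
  have := h w
  linarith

/-- `IsGeomMean θ A B C`: the matrix `C` is the weighted geometric mean `A #_θ B` of the positive
definite matrices `A` and `B`, the point that divides the geodesic from `A` to `B` in the ratio
`θ : 1 - θ`. It is described by a simultaneous diagonalization of `A` and `B`, in which `A` is the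
identity. -/
def IsGeomMean (θ : ℝ) (A B C : Matrix ι ι ℝ) : Prop :=
  ∃ (H : Matrix ι ι ℝ) (d : ι → ℝ), IsUnit H.det ∧ (∀ i, 0 < d i) ∧ A = Hᵀ * H ∧
    B = Hᵀ * diagonal d * H ∧ C = Hᵀ * diagonal (fun i => d i ^ θ) * H

theorem exists_isGeomMean (θ : ℝ) {A B : Matrix ι ι ℝ} (hA : A.PosDef) (hB : B.PosDef) :
    ∃ C, IsGeomMean θ A B C := by
  obtain ⟨H, d, hH, h1, h2⟩ := exists_simultaneous_diag hA (posDef_iff_quad.1 hB).1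
  exact ⟨_, H, d, hH, diag_pos_of_posDef_congr hH (h2 ▸ hB), h1, h2, rfl⟩

namespace IsGeomMean

variable {θ : ℝ} {A B C A' B' C' : Matrix ι ι ℝ}

theorem posDef_left (h : IsGeomMean θ A B C) : A.PosDef := by
  obtain ⟨H, d, hH, hd, rfl, rfl, rfl⟩ := h
  exact posDef_transpose_mul_self hH

theorem posDef_right (h : IsGeomMean θ A B C) : B.PosDef := by
  obtain ⟨H, d, hH, hd, rfl, rfl, rfl⟩ := h
  exact posDef_congr_diagonal hH hd

theorem posDef (h : IsGeomMean θ A B C) : C.PosDef := by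
  obtain ⟨H, d, hH, hd, rfl, rfl, rfl⟩ := h
  exact posDef_congr_diagonal hH fun i => Real.rpow_pos_of_pos (hd i) _

theorem congr (h : IsGeomMean θ A B C) {G : Matrix ι ι ℝ} (hG : IsUnit G.det) :
    IsGeomMean θ (Gᵀ * A * G) (Gᵀ * B * G) (Gᵀ * C * G) := by
  obtain ⟨H, d, hH, hd, rfl, rfl, rfl⟩ := h
  refine ⟨H * G, d, ?_, hd, ?_, ?_, ?_⟩
  · rw [det_mul]; exact hH.mul hG
  all_goals simp only [transpose_mul, Matrix.mul_assoc]

theorem symm (h : IsGeomMean θ A B C) : IsGeomMean (1 - θ) B A C := by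
  obtain ⟨H, d, hH, hd, rfl, rfl, rfl⟩ := h
  have e : ∀ f : ι → ℝ, (diagonal (fun i => √(d i)) * H)ᵀ * diagonal f
      * (diagonal (fun i => √(d i)) * H) = Hᵀ * diagonal (fun i => d i * f i) * H := fun f => by
    have : (diagonal fun i => d i * f i)
        = diagonal (fun i => √(d i)) * diagonal f * diagonal (fun i => √(d i)) := by
      rw [diagonal_mul_diagonal, diagonal_mul_diagonal]
      congr 1
      funext i
      rw [mul_right_comm, Real.mul_self_sqrt (hd i).le]
    rw [this, transpose_mul, diagonal_transpose]
    simp only [Matrix.mul_assoc]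
  refine ⟨diagonal (fun i => √(d i)) * H, fun i => (d i)⁻¹, ?_, fun i => inv_pos.2 (hd i), ?_, ?_,
    ?_⟩
  · rw [det_mul, det_diagonal]
    exact (Finset.prod_ne_zero_iff.2 fun i _ => (Real.sqrt_pos.2 (hd i)).ne').isUnit.mul hH
  · have := e (fun _ => 1)
    simp only [diagonal_one, mul_one] at this
    exact this.symm
  · rw [e]
    simp only [mul_inv_cancel₀ (hd _).ne', diagonal_one, Matrix.mul_one]
  · rw [e]
    congr 3
    funext i
    rw [Real.inv_rpow (hd i).le, ← Real.rpow_neg (hd i).le, neg_sub, mul_comm,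
      ← Real.rpow_add_one (hd i).ne', sub_add_cancel]

theorem smul_right (h : IsGeomMean θ A B C) {c : ℝ} (hc : 0 < c) :
    IsGeomMean θ A (c • B) (c ^ θ • C) := by
  obtain ⟨H, d, hH, hd, rfl, rfl, rfl⟩ := h
  have e : ∀ (a : ℝ) (f : ι → ℝ), a • (Hᵀ * diagonal f * H)
      = Hᵀ * diagonal (fun i => a * f i) * H := fun a f => by
    have : diagonal (fun i => a * f i) = a • diagonal f := diagonal_smul a f
    rw [this, Matrix.mul_smul, Matrix.smul_mul]
  refine ⟨H, fun i => c * d i, hH, fun i => mul_pos hc (hd i), rfl, e _ _, ?_⟩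
  rw [e]
  simp only [Real.mul_rpow hc.le (hd _).le]

theorem quadLe_right (h0 : 0 < θ) (h1 : θ < 1) (h : IsGeomMean θ A B C)
    (h' : IsGeomMean θ A B' C') (hB : QuadLe B B') : QuadLe C C' := by
  obtain ⟨H, d, hH, hd, rfl, rfl, rfl⟩ := h
  obtain ⟨G, e, hG, he, hA, rfl, rfl⟩ := h'
  have hH1 : H⁻¹ * H = 1 := nonsing_inv_mul _ hH
  have hH2 : H * H⁻¹ = 1 := mul_nonsing_inv _ hH
  have hO : (G * H⁻¹)ᵀ * (G * H⁻¹) = 1 := by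
    calc (G * H⁻¹)ᵀ * (G * H⁻¹) = (H⁻¹)ᵀ * (Gᵀ * G) * H⁻¹ := by
          rw [transpose_mul]; simp only [Matrix.mul_assoc]
      _ = (H * H⁻¹)ᵀ * (H * H⁻¹) := by
          rw [← hA, transpose_mul]; simp only [Matrix.mul_assoc]
      _ = 1 := by rw [hH2]; simp
  have hOH : ∀ v, (G * H⁻¹) *ᵥ (H *ᵥ v) = G *ᵥ v := fun v => by
    rw [mulVec_mulVec, Matrix.mul_assoc, hH1, Matrix.mul_one]
  intro v
  rw [quad_congr, quad_congr, quad_diagonal, quad_diagonal, ← hOH]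
  refine sum_rpow_mul_sq_le hO hd he h0 h1 (fun w => ?_) _
  have := hB (H⁻¹ *ᵥ w)
  rw [quad_congr, quad_congr, quad_diagonal, quad_diagonal, mulVec_mulVec, hH2, one_mulVec,
    mulVec_mulVec] at this
  exact this

/-- Weighted geometric means are monotone and homogeneous in both arguments. -/
theorem quadLe (h0 : 0 < θ) (h1 : θ < 1) (h : IsGeomMean θ A B C)
    (h' : IsGeomMean θ A' B' C') {a b : ℝ} (ha : 0 < a) (hb : 0 < b) (hA : QuadLe (a • A) A')
    (hB : QuadLe (b • B) B') : QuadLe ((a ^ (1 - θ) * b ^ θ) • C) C' := by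
  obtain ⟨D, hD⟩ := exists_isGeomMean θ h.posDef_left h'.posDef_right
  have h2 : QuadLe (b ^ θ • C) D := quadLe_right h0 h1 (h.smul_right hb) hD hB
  have h3 : QuadLe (a ^ (1 - θ) • D) C' :=
    quadLe_right (by linarith) (by linarith) (hD.symm.smul_right ha) h'.symm hA
  rw [mul_smul]
  exact (h2.smul (Real.rpow_nonneg ha.le _)).trans h3

theorem det_one_add_le (h0 : 0 < θ) (h1 : θ < 1) (h : IsGeomMean θ A B C) :
    (1 + C).det ≤ (1 + A).det ^ (1 - θ) * (1 + B).det ^ θ := by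
  obtain ⟨H, d, hH, hd, rfl, rfl, rfl⟩ := h
  exact det_one_add_rpow_le H hd h0 h1

end IsGeomMean

open Classical in
/-- The power `Q ^ θ` of a positive definite matrix, the geometric mean of `1` and `Q`. The value
is a dummy when `Q` is not positive definite. -/
noncomputable def matPow (θ : ℝ) (Q : Matrix ι ι ℝ) : Matrix ι ι ℝ :=
  if h : ∃ C, IsGeomMean θ 1 Q C then h.choose else 1

theorem isGeomMean_matPow (θ : ℝ) {Q : Matrix ι ι ℝ} (hQ : Q.PosDef) :
    IsGeomMean θ 1 Q (matPow θ Q) := by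
  have h := exists_isGeomMean θ PosDef.one hQ
  rw [matPow, dif_pos h]
  exact h.choose_spec

/-! ### Continuity of matrix-valued functions through quadratic forms -/

theorem entry_eq_quad {A : Matrix ι ι ℝ} (hA : A.IsSymm) (i j : ι) :
    A i j = ((Pi.single i 1 + Pi.single j 1) ⬝ᵥ A *ᵥ (Pi.single i 1 + Pi.single j 1)
      - (Pi.single i 1 : ι → ℝ) ⬝ᵥ A *ᵥ (Pi.single i 1)
      - (Pi.single j 1 : ι → ℝ) ⬝ᵥ A *ᵥ (Pi.single j 1)) / 2 := by
  have := hA.apply i j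
  simp [mulVec_add, add_dotProduct, dotProduct_add]
  linarith

theorem tendsto_of_quad {X : Type*} {l : Filter X} {f : X → Matrix ι ι ℝ} {A : Matrix ι ι ℝ}
    (hf : ∀ᶠ x in l, (f x).IsSymm) (hA : A.IsSymm)
    (h : ∀ v : ι → ℝ, Tendsto (fun x => v ⬝ᵥ f x *ᵥ v) l (𝓝 (v ⬝ᵥ A *ᵥ v))) :
    Tendsto f l (𝓝 A) := by
  refine tendsto_pi_nhds.2 fun i => tendsto_pi_nhds.2 fun j => ?_
  rw [entry_eq_quad hA]
  refine Tendsto.congr' ?_ ((((h (Pi.single i 1 + Pi.single j 1)).sub (h (Pi.single i 1))).sub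
    (h (Pi.single j 1))).div_const 2)
  filter_upwards [hf] with x hx
  rw [entry_eq_quad hx i j]

/-- A convergent family of symmetric matrices with a positive definite limit `Q` lies between
`(1 - s) Q` and `(1 + s) Q` with `s → 0`. -/
theorem exists_relative_bound {Q : Matrix ι ι ℝ} (hQ : Q.PosDef) :
    ∃ s : Matrix ι ι ℝ → ℝ, Continuous s ∧ s Q = 0 ∧
      ∀ A, 0 ≤ s A ∧ QuadLe ((1 - s A) • Q) A ∧ QuadLe A ((1 + s A) • Q) := by
  obtain ⟨H, hH, rfl⟩ := exists_factor hQ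
  have hH1 : H⁻¹ * H = 1 := nonsing_inv_mul _ hH
  refine ⟨fun A => absSum (H⁻¹ᵀ * (A - Hᵀ * H) * H⁻¹), ?_, ?_, fun A => ?_⟩
  · refine continuous_absSum.comp ?_
    exact (continuous_const.matrix_mul (continuous_id.sub continuous_const)).matrix_mul
      continuous_const
  · simp [absSum]
  · have key : ∀ v, |v ⬝ᵥ A *ᵥ v - v ⬝ᵥ (Hᵀ * H) *ᵥ v|
        ≤ absSum (H⁻¹ᵀ * (A - Hᵀ * H) * H⁻¹) * (v ⬝ᵥ (Hᵀ * H) *ᵥ v) := fun v => by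
      have e : A - Hᵀ * H = Hᵀ * (H⁻¹ᵀ * (A - Hᵀ * H) * H⁻¹) * H := by
        calc A - Hᵀ * H = (H⁻¹ * H)ᵀ * (A - Hᵀ * H) * (H⁻¹ * H) := by rw [hH1]; simp
          _ = _ := by rw [transpose_mul]; simp only [Matrix.mul_assoc]
      rw [← quad_sub, e, quad_congr, ← e, quad_transpose_mul_self]
      exact abs_quad_le _ _
    refine ⟨absSum_nonneg _, fun v => ?_, fun v => ?_⟩
    · rw [quad_smul]
      have := (abs_le.1 (key v)).1
      linarith
    · rw [quad_smul]
      have := (abs_le.1 (key v)).2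
      linarith

/-- Real powers are continuous on the positive definite matrices, because they are monotone and
homogeneous. -/
theorem continuousAt_matPow {θ : ℝ} (h0 : 0 < θ) (h1 : θ < 1) {Q : Matrix ι ι ℝ}
    (hQ : Q.PosDef) : ContinuousWithinAt (matPow θ) {A | A.PosDef} Q := by
  obtain ⟨s, hs, hs0, hsA⟩ := exists_relative_bound hQ
  have hlt : ∀ᶠ A in 𝓝[{A | A.PosDef}] Q, s A < 1 :=
    (hs.continuousWithinAt).tendsto.eventually_lt_const (by rw [hs0]; exact one_pos)
  have hmem : ∀ᶠ A in 𝓝[{A | A.PosDef}] Q, A.PosDef := eventually_mem_nhdsWithin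
  have gm := isGeomMean_matPow θ hQ
  refine tendsto_of_quad ?_ (posDef_iff_quad.1 gm.posDef).1 fun v => ?_
  · filter_upwards [hmem] with A hA
    exact (posDef_iff_quad.1 (isGeomMean_matPow θ hA).posDef).1
  · set q := v ⬝ᵥ matPow θ Q *ᵥ v
    have hc : ∀ f : ℝ → ℝ, Continuous f → f 0 = 1 →
        Tendsto (fun A => (f (s A)) ^ θ * q) (𝓝[{A | A.PosDef}] Q) (𝓝 q) := fun f hf hf0 => by
      have h := (((hf.comp hs).continuousWithinAt (s := {A | A.PosDef}) (x := Q)).tendsto.rpow_const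
        (Or.inr h0.le : (f ∘ s) Q ≠ 0 ∨ 0 ≤ θ)).mul_const q
      simpa [hs0, hf0] using h
    refine tendsto_of_tendsto_of_tendsto_of_le_of_le'
      (hc (fun x => 1 - x) (by fun_prop) (by simp)) (hc (fun x => 1 + x) (by fun_prop) (by simp))
      ?_ ?_
    · filter_upwards [hmem, hlt] with A hA h
      have := IsGeomMean.quadLe h0 h1 gm (isGeomMean_matPow θ hA) one_pos (sub_pos.2 h)
        (by rw [one_smul]; exact quadLe_refl _) (hsA A).2.1 v
      rwa [quad_smul, Real.one_rpow, one_mul] at this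
    · filter_upwards [hmem, hlt] with A hA h
      have hp : 0 < 1 + s A := by linarith [(hsA A).1]
      have := IsGeomMean.quadLe h0 h1 (isGeomMean_matPow θ hA) (gm.smul_right hp) one_pos one_pos
        (by rw [one_smul]; exact quadLe_refl _) (by rw [one_smul]; exact (hsA A).2.2) v
      rwa [quad_smul, quad_smul, Real.one_rpow, Real.one_rpow, one_mul, one_mul] at this

end GeomMean

end RestorationEntropy

/-! ### Matrices of linear maps of the Euclidean space -/

namespace RestorationEntropy

section Covering

open scoped Pointwise

variable {n : ℕ}

/-- The Euclidean space `ℝⁿ`. -/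
abbrev Euc (n : ℕ) : Type := EuclideanSpace ℝ (Fin n)

/-- The matrix of a linear map of `ℝⁿ` in the standard basis. -/
noncomputable def toMat (L : Euc n →L[ℝ] Euc n) : Matrix (Fin n) (Fin n) ℝ :=
  (toEuclideanCLM (n := Fin n) (𝕜 := ℝ)).symm L

theorem toMat_mul (L M : Euc n →L[ℝ] Euc n) : toMat (L * M) = toMat L * toMat M :=
  map_mul (toEuclideanCLM (n := Fin n) (𝕜 := ℝ)).symm L M

theorem toMat_one : toMat (1 : Euc n →L[ℝ] Euc n) = 1 :=
  map_one (toEuclideanCLM (n := Fin n) (𝕜 := ℝ)).symm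

theorem toMat_mulVec (L : Euc n →L[ℝ] Euc n) (v : Fin n → ℝ) :
    toMat L *ᵥ v = (L (WithLp.toLp 2 v)).ofLp := by
  have h := toEuclideanCLM_toLp (𝕜 := ℝ) (toMat L) v
  rw [toMat, StarAlgEquiv.apply_symm_apply] at h
  rw [h]; rfl

theorem toMat_mulVec_ofLp (L : Euc n →L[ℝ] Euc n) (v : Euc n) :
    toMat L *ᵥ v.ofLp = (L v).ofLp := toMat_mulVec L v.ofLp

theorem continuous_toMat : Continuous (toMat : (Euc n →L[ℝ] Euc n) → Matrix (Fin n) (Fin n) ℝ) :=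
  LinearMap.continuous_of_finiteDimensional
    ((toEuclideanCLM (n := Fin n) (𝕜 := ℝ)).symm.toAlgEquiv.toLinearEquiv.toLinearMap)

theorem jacobianMatrix_eq (φ : Euc n → Euc n) (x : Euc n) :
    jacobianMatrix φ x = toMat (fderiv ℝ φ x) := by
  ext i j
  have h := congrFun (toMat_mulVec (fderiv ℝ φ x) (Pi.single j 1)) i
  rw [mulVec_single_one] at h
  exact h.symm

theorem norm_sq_eq_dotProduct (v : Euc n) : ‖v‖ ^ 2 = v.ofLp ⬝ᵥ v.ofLp := by
  rw [EuclideanSpace.norm_sq_eq, dotProduct]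
  exact Finset.sum_congr rfl fun i _ => by rw [Real.norm_eq_abs, sq_abs, sq]

/-! ### Separated sets, volumes of balls, and covering numbers -/

/-- The number `det (1 + Mᵀ M)` for the matrix `M` of a linear map. Its square root is, up to a
factor that depends on the dimension only, the product of the singular values greater than one. -/
noncomputable def expansion (L : Euc n →L[ℝ] Euc n) : ℝ := (1 + (toMat L)ᵀ * toMat L).det

theorem posDef_one_add_transpose_mul_self (M : Matrix (Fin n) (Fin n) ℝ) :
    (1 + Mᵀ * M).PosDef := by
  refine PosDef.one.add_posSemidef (posSemidef_iff_quad.2 ⟨?_, fun v => ?_⟩)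
  · rw [IsSymm, transpose_mul, transpose_transpose]
  · rw [quad_transpose_mul_self]; exact dotProduct_self_star_nonneg _

theorem one_le_expansion (L : Euc n →L[ℝ] Euc n) : 1 ≤ expansion L := by
  have h := det_le_det_of_quadLe (PosDef.one (n := Fin n) (R := ℝ))
    (posDef_iff_quad.1 (posDef_one_add_transpose_mul_self (toMat L))).1 (fun v => by
      rw [quad_add, quad_transpose_mul_self]
      have : 0 ≤ (toMat L *ᵥ v) ⬝ᵥ (toMat L *ᵥ v) := dotProduct_self_star_nonneg _
      linarith)
  rwa [det_one] at h

theorem continuous_expansion : Continuous (expansion : (Euc n →L[ℝ] Euc n) → ℝ) := by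
  unfold expansion
  exact (continuous_const.add
    ((continuous_toMat.matrix_transpose).matrix_mul continuous_toMat)).matrix_det

theorem volume_ball (x : Euc n) {r : ℝ} (hr : 0 < r) :
    MeasureTheory.volume (Metric.ball x r)
      = ENNReal.ofReal (r ^ n) * MeasureTheory.volume (Metric.ball (0 : Euc n) 1) := by
  have := MeasureTheory.Measure.addHaar_ball_of_pos (MeasureTheory.volume (α := Euc n)) x hr
  rwa [finrank_euclideanSpace_fin] at this

/-- The points of `c` have mutual distances at least `r`. -/
def IsSep (r : ℝ) (c : Finset (Euc n)) : Prop := ∀ x ∈ c, ∀ y ∈ c, x ≠ y → r ≤ dist x y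

theorem exists_maximal_sep (S : Set (Euc n)) {r : ℝ} (hr : 0 < r) (N : ℕ)
    (h : ∀ c : Finset (Euc n), ↑c ⊆ S → IsSep r c → c.card ≤ N) :
    ∃ c : Finset (Euc n), ↑c ⊆ S ∧ IsSep r c ∧ S ⊆ ⋃ y ∈ c, Metric.ball y r := by
  classical
  set T : Set ℕ := {m | ∃ c : Finset (Euc n), ↑c ⊆ S ∧ IsSep r c ∧ c.card = m}
  have hT : T.Nonempty := ⟨0, ∅, by simp, by simp [IsSep], rfl⟩
  have hb : BddAbove T := ⟨N, by rintro m ⟨c, h1, h2, rfl⟩; exact h c h1 h2⟩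
  obtain ⟨c, h1, h2, h3⟩ := Nat.sSup_mem hT hb
  refine ⟨c, h1, h2, fun x hx => ?_⟩
  by_contra hcon
  simp only [mem_iUnion, Metric.mem_ball, not_exists, not_lt, exists_prop, not_and] at hcon
  have hxc : x ∉ c := fun hxc => by
    have := hcon x hxc
    rw [dist_self] at this
    linarith
  have hmem : (insert x c).card ∈ T := by
    refine ⟨insert x c, ?_, ?_, rfl⟩
    · rw [Finset.coe_insert]
      exact insert_subset hx h1
    · intro a ha b hb hab
      rcases Finset.mem_insert.1 ha with ha' | ha'
      · rcases Finset.mem_insert.1 hb with hb' | hb'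
        · exact absurd (ha'.trans hb'.symm) hab
        · rw [ha']; exact hcon b hb'
      · rcases Finset.mem_insert.1 hb with hb' | hb'
        · rw [hb', dist_comm]; exact hcon a ha'
        · exact h2 a ha' b hb' hab
  have := le_csSup hb hmem
  rw [Finset.card_insert_of_notMem hxc, ← h3] at this
  omega

theorem card_mul_volume_le {c : Finset (Euc n)} {r : ℝ} (h : IsSep r c) {U : Set (Euc n)}
    (hU : ∀ x ∈ c, Metric.ball x (r / 2) ⊆ U) :
    (c.card : ENNReal) * MeasureTheory.volume (Metric.ball (0 : Euc n) (r / 2))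
      ≤ MeasureTheory.volume U := by
  have hd : (c : Set (Euc n)).PairwiseDisjoint fun x => Metric.ball x (r / 2) := by
    intro x hx y hy hxy
    exact Metric.ball_disjoint_ball (by have := h x hx y hy hxy; linarith)
  calc (c.card : ENNReal) * MeasureTheory.volume (Metric.ball (0 : Euc n) (r / 2))
      = ∑ x ∈ c, MeasureTheory.volume (Metric.ball x (r / 2)) := by
        rw [Finset.sum_congr rfl fun x _ =>
          MeasureTheory.Measure.addHaar_ball_center MeasureTheory.volume x (r / 2),
          Finset.sum_const, nsmul_eq_mul]
    _ = MeasureTheory.volume (⋃ x ∈ c, Metric.ball x (r / 2)) :=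
        (MeasureTheory.measure_biUnion_finset hd fun x _ => Metric.isOpen_ball.measurableSet).symm
    _ ≤ MeasureTheory.volume U := MeasureTheory.measure_mono (iUnion₂_subset hU)

/-- Volume comparison: a volume bound for a neighbourhood bounds the number of separated points. -/
theorem card_le_of_volume_le {c : Finset (Euc n)} {r : ℝ} (hr : 0 < r) (h : IsSep r c)
    {U : Set (Euc n)} (hU : ∀ x ∈ c, Metric.ball x (r / 2) ⊆ U) {b : ℝ} (hb : 0 ≤ b)
    (hV : MeasureTheory.volume U
      ≤ ENNReal.ofReal b * MeasureTheory.volume (Metric.ball (0 : Euc n) 1)) :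
    (c.card : ℝ) * (r / 2) ^ n ≤ b := by
  have h1 := (card_mul_volume_le h hU).trans hV
  rw [volume_ball _ (half_pos hr), ← mul_assoc] at h1
  have h2 := (ENNReal.mul_le_mul_iff_left (Metric.measure_ball_pos _ _ one_pos).ne'
    MeasureTheory.measure_ball_lt_top.ne).1 h1
  rw [← ENNReal.ofReal_natCast, ← ENNReal.ofReal_mul (Nat.cast_nonneg _)] at h2
  exact (ENNReal.ofReal_le_ofReal_iff hb).1 h2

/-- A subset of a ball of radius `δ` is covered by at most `3 ^ n` balls of the same radius centered
in it. -/
theorem exists_centered_cover (K : Set (Euc n)) (y : Euc n) {δ : ℝ} (hδ : 0 < δ) :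
    ∃ c : Finset (Euc n), ↑c ⊆ Metric.ball y δ ∩ K ∧ c.card ≤ 3 ^ n ∧
      Metric.ball y δ ∩ K ⊆ ⋃ z ∈ c, Metric.ball z δ := by
  have h : ∀ c : Finset (Euc n), ↑c ⊆ Metric.ball y δ ∩ K → IsSep δ c → c.card ≤ 3 ^ n := by
    intro c hc hs
    have h1 := card_le_of_volume_le (U := Metric.ball y (3 * (δ / 2))) (b := (3 * (δ / 2)) ^ n)
      hδ hs (fun x hx => Metric.ball_subset_ball' (by
        have := Metric.mem_ball.1 (hc hx).1
        linarith)) (by positivity) (volume_ball _ (by positivity)).le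
    rw [mul_pow] at h1
    have := le_of_mul_le_mul_right h1 (by positivity)
    exact_mod_cast this
  obtain ⟨c, h1, h2, h3⟩ := exists_maximal_sep _ hδ _ h
  exact ⟨c, h1, h c h1 h2, h3⟩

/-! ### The volume of the neighbourhood of an ellipsoid -/

/-- The sum of the ellipsoid `L B` and the unit ball `B`. -/
def ellipsoidBody (L : Euc n →L[ℝ] Euc n) : Set (Euc n) :=
  {z | ∃ x y : Euc n, ‖x‖ < 1 ∧ ‖y‖ < 1 ∧ z = L x + y}

/-- If `R Rᵀ = 1 + L Lᵀ`, the body `L B + B` lies between the ellipsoids `R B` and `2 R B`. -/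
theorem exists_ellipsoid_between (L : Euc n →L[ℝ] Euc n) :
    ∃ R : Euc n →L[ℝ] Euc n, |R.det| = √(expansion L) ∧
      R '' Metric.ball 0 1 ⊆ ellipsoidBody L ∧ ellipsoidBody L ⊆ R '' Metric.ball 0 2 := by
  set M := toMat L with hM
  obtain ⟨B, hB, hBB⟩ := exists_factor (posDef_one_add_transpose_mul_self Mᵀ)
  rw [transpose_transpose] at hBB
  set R : Euc n →L[ℝ] Euc n := toEuclideanCLM (n := Fin n) (𝕜 := ℝ) Bᵀ with hR
  have hRm : toMat R = Bᵀ := by rw [toMat, hR, StarAlgEquiv.symm_apply_apply]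
  have hB1 : B * B⁻¹ = 1 := mul_nonsing_inv _ hB
  -- `|Mᵀ w|² + |w|² = |B w|²`
  have hnorm : ∀ w : Fin n → ℝ, (Mᵀ *ᵥ w) ⬝ᵥ (Mᵀ *ᵥ w) + w ⬝ᵥ w = (B *ᵥ w) ⬝ᵥ (B *ᵥ w) := by
    intro w
    rw [← quad_transpose_mul_self, ← quad_transpose_mul_self, ← hBB, quad_add, quad_one,
      transpose_transpose, add_comm]
  have hsol : ∀ w : Fin n → ℝ, M *ᵥ (Mᵀ *ᵥ w) + w = Bᵀ *ᵥ (B *ᵥ w) := by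
    intro w
    rw [mulVec_mulVec, mulVec_mulVec, ← hBB, add_mulVec, one_mulVec, add_comm]
  refine ⟨R, ?_, ?_, ?_⟩
  · have h1 : R.det = B.det := by
      rw [← det_transpose, ContinuousLinearMap.det,
        ← LinearMap.det_toMatrix (EuclideanSpace.basisFun (Fin n) ℝ).toBasis]
      congr 1
    have h2 : expansion L = B.det * B.det := by
      rw [expansion, det_one_add_mul_comm, ← hM, hBB, det_mul, det_transpose]
    rw [h1, h2, Real.sqrt_mul_self_eq_abs]
  · rintro _ ⟨u, hu, rfl⟩
    rw [mem_ball_zero_iff] at hu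
    set w := B⁻¹ *ᵥ u.ofLp with hw
    have hBw : B *ᵥ w = u.ofLp := by rw [hw, mulVec_mulVec, hB1, one_mulVec]
    have h1 := hnorm w
    rw [hBw, ← norm_sq_eq_dotProduct u] at h1
    have hx := norm_sq_eq_dotProduct (WithLp.toLp 2 (Mᵀ *ᵥ w))
    have hy := norm_sq_eq_dotProduct (WithLp.toLp 2 w)
    simp only at hx hy
    have hu2 : ‖u‖ ^ 2 < 1 := by nlinarith [norm_nonneg u]
    refine ⟨WithLp.toLp 2 (Mᵀ *ᵥ w), WithLp.toLp 2 w, ?_, ?_, ?_⟩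
    · nlinarith [sq_nonneg ‖WithLp.toLp 2 w‖, norm_nonneg (WithLp.toLp 2 (Mᵀ *ᵥ w))]
    · nlinarith [sq_nonneg ‖WithLp.toLp 2 (Mᵀ *ᵥ w)‖, norm_nonneg (WithLp.toLp 2 w)]
    · apply (WithLp.equiv 2 (Fin n → ℝ)).injective
      change (R u).ofLp = (L (WithLp.toLp 2 (Mᵀ *ᵥ w))).ofLp + w
      rw [← toMat_mulVec, ← toMat_mulVec_ofLp, ← hM, hsol, hRm, hBw]
  · rintro _ ⟨x, y, hx, hy, rfl⟩
    set z := L x + y with hz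
    have hz' : z.ofLp = M *ᵥ x.ofLp + y.ofLp := by
      rw [hM, toMat_mulVec_ofLp]; rfl
    set u := (Bᵀ)⁻¹ *ᵥ z.ofLp with hu
    set w := B⁻¹ *ᵥ u with hw
    have hBw : B *ᵥ w = u := by rw [hw, mulVec_mulVec, hB1, one_mulVec]
    have hBu : Bᵀ *ᵥ u = z.ofLp := by
      rw [hu, mulVec_mulVec, mul_nonsing_inv _ (by rwa [det_transpose]), one_mulVec]
    refine ⟨WithLp.toLp 2 u, ?_, ?_⟩
    · rw [mem_ball_zero_iff]
      have h1 := hnorm w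
      rw [hBw] at h1
      have h2 : u ⬝ᵥ u = x.ofLp ⬝ᵥ (Mᵀ *ᵥ w) + y.ofLp ⬝ᵥ w := by
        calc u ⬝ᵥ u = z.ofLp ⬝ᵥ w := by
              conv_lhs => rw [← hBw]
              rw [← hBu, hBw, ← vecMul_transpose, transpose_transpose, ← dotProduct_mulVec, hBw]
          _ = _ := by
              rw [hz', add_dotProduct, ← vecMul_transpose, ← dotProduct_mulVec]
      have h3 : ∀ a b : Fin n → ℝ, 2 * (a ⬝ᵥ b) ≤ a ⬝ᵥ a + b ⬝ᵥ b := fun a b => by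
        simp only [dotProduct, Finset.mul_sum, ← Finset.sum_add_distrib]
        exact Finset.sum_le_sum fun i _ => by nlinarith [sq_nonneg (a i - b i)]
      have h4 := h3 x.ofLp (Mᵀ *ᵥ w)
      have h5 := h3 y.ofLp w
      rw [← norm_sq_eq_dotProduct] at h4 h5
      have h6 := norm_sq_eq_dotProduct (WithLp.toLp 2 u)
      simp only at h6
      have hx2 : ‖x‖ ^ 2 < 1 := by nlinarith [norm_nonneg x]
      have hy2 : ‖y‖ ^ 2 < 1 := by nlinarith [norm_nonneg y]
      nlinarith [norm_nonneg (WithLp.toLp 2 u)]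
    · apply (WithLp.equiv 2 (Fin n → ℝ)).injective
      change (R (WithLp.toLp 2 u)).ofLp = z.ofLp
      rw [← toMat_mulVec, hRm, hBu]

theorem volume_ellipsoidBody_le (L : Euc n →L[ℝ] Euc n) :
    MeasureTheory.volume (ellipsoidBody L) ≤ ENNReal.ofReal (2 ^ n * √(expansion L))
      * MeasureTheory.volume (Metric.ball (0 : Euc n) 1) := by
  obtain ⟨R, h1, -, h3⟩ := exists_ellipsoid_between L
  refine (MeasureTheory.measure_mono h3).trans_eq ?_
  rw [MeasureTheory.Measure.addHaar_image_continuousLinearMap, h1, volume_ball _ two_pos,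
    mul_comm (2 ^ n : ℝ), ENNReal.ofReal_mul (Real.sqrt_nonneg _), mul_assoc]

theorem le_volume_ellipsoidBody (L : Euc n →L[ℝ] Euc n) :
    ENNReal.ofReal (√(expansion L)) * MeasureTheory.volume (Metric.ball (0 : Euc n) 1)
      ≤ MeasureTheory.volume (ellipsoidBody L) := by
  obtain ⟨R, h1, h2, -⟩ := exists_ellipsoid_between L
  refine le_trans (le_of_eq ?_) (MeasureTheory.measure_mono h2)
  rw [MeasureTheory.Measure.addHaar_image_continuousLinearMap, h1]

/-- A set contained in the `δ`-neighbourhood of the image of a `δ`-ball under `L` is covered by at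
most `8 ^ n * √(expansion L)` balls of radius `δ`. -/
theorem exists_cover_card_le (L : Euc n →L[ℝ] Euc n) (p : Euc n) {δ : ℝ} (hδ : 0 < δ)
    {S : Set (Euc n)} (hS : ∀ z ∈ S, ∃ x y : Euc n, ‖x‖ < δ ∧ ‖y‖ < δ ∧ z = p + (L x + y)) :
    ∃ c : Finset (Euc n), S ⊆ ⋃ y ∈ c, Metric.ball y δ ∧
      (c.card : ℝ) ≤ 8 ^ n * √(expansion L) := by
  -- the `δ / 2`-balls around separated points of `S` lie in a translate of `2 δ (L B + B)`
  set U : Set (Euc n) := (fun z => p + z) '' ((2 * δ) • ellipsoidBody L) with hU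
  have hV : MeasureTheory.volume U ≤ ENNReal.ofReal ((2 * δ) ^ n * (2 ^ n * √(expansion L)))
      * MeasureTheory.volume (Metric.ball (0 : Euc n) 1) := by
    rw [hU, image_add_left, MeasureTheory.measure_preimage_add,
      MeasureTheory.Measure.addHaar_smul_of_nonneg _ (by positivity), finrank_euclideanSpace_fin,
      ENNReal.ofReal_mul (by positivity), mul_assoc]
    exact mul_le_mul_right (volume_ellipsoidBody_le L) _
  have h : ∀ c : Finset (Euc n), ↑c ⊆ S → IsSep δ c → (c.card : ℝ) ≤ 8 ^ n * √(expansion L) := by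
    intro c hc hs
    have h1 := card_le_of_volume_le hδ hs (U := U) (fun z hz q hq => ?_) (by positivity) hV
    · have e : (2 * δ) ^ n * (2 ^ n * √(expansion L))
          = (8 ^ n * √(expansion L)) * (δ / 2) ^ n := by
        have : (8 : ℝ) ^ n * (δ / 2) ^ n = (2 * δ) ^ n * 2 ^ n := by
          rw [← mul_pow, ← mul_pow]; congr 1; ring
        rw [mul_right_comm, this, mul_assoc]
      rw [e] at h1
      exact le_of_mul_le_mul_right h1 (by positivity)
    · obtain ⟨x, y, hx, hy, rfl⟩ := hS z (hc hz)
      rw [Metric.mem_ball, dist_eq_norm] at hq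
      refine ⟨L x + y + (q - (p + (L x + y))), ?_, by
        change p + (L x + y + (q - (p + (L x + y)))) = q; abel⟩
      refine ⟨(2 * δ)⁻¹ • (L x + y + (q - (p + (L x + y)))),
        ⟨(2 * δ)⁻¹ • x, (2 * δ)⁻¹ • (y + (q - (p + (L x + y)))), ?_, ?_, ?_⟩, ?_⟩
      · rw [norm_smul, Real.norm_of_nonneg (by positivity), inv_mul_lt_one₀ (by positivity)]
        linarith
      · rw [norm_smul, Real.norm_of_nonneg (by positivity), inv_mul_lt_one₀ (by positivity)]
        have := norm_add_le y (q - (p + (L x + y)))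
        linarith
      · rw [map_smul, ← smul_add, add_assoc]
      · exact smul_inv_smul₀ (by positivity) _
  obtain ⟨c, h1, h2, h3⟩ := exists_maximal_sep S hδ ⌊8 ^ n * √(expansion L)⌋₊
    fun c hc hs => Nat.le_floor (h c hc hs)
  exact ⟨c, h3, h c h1 h2⟩

/-- The image of the unit ball under `L` contains at least `4⁻ⁿ * √(expansion L)` points with mutual
distances at least `3`. -/
theorem exists_sep_card_ge (L : Euc n →L[ℝ] Euc n) :
    ∃ c : Finset (Euc n), ↑c ⊆ L '' Metric.ball 0 1 ∧ IsSep 3 c ∧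
      √(expansion L) ≤ 4 ^ n * c.card := by
  have hN : ∀ c : Finset (Euc n), ↑c ⊆ L '' Metric.ball 0 1 → IsSep 3 c →
      c.card ≤ ⌊(‖L‖ + 2) ^ n⌋₊ := by
    intro c hc hs
    refine Nat.le_floor ?_
    have h1 := card_le_of_volume_le (U := Metric.ball 0 (‖L‖ + 2)) (b := (‖L‖ + 2) ^ n)
      three_pos hs (fun x hx => Metric.ball_subset_ball' ?_) (by positivity)
      (volume_ball _ (by positivity)).le
    · have : (1 : ℝ) ≤ (3 / 2) ^ n := one_le_pow₀ (by norm_num)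
      nlinarith [Nat.cast_nonneg (α := ℝ) c.card]
    · obtain ⟨v, hv, rfl⟩ := hc hx
      rw [mem_ball_zero_iff] at hv
      rw [dist_zero_right]
      have := L.le_opNorm v
      nlinarith [norm_nonneg L, norm_nonneg v]
  obtain ⟨c, h1, h2, h3⟩ := exists_maximal_sep _ three_pos _ hN
  refine ⟨c, h1, h2, ?_⟩
  -- the balls of radius `4` around a maximal separated set cover `L B + B`
  have hsub : ellipsoidBody L ⊆ ⋃ z ∈ c, Metric.ball z 4 := by
    rintro _ ⟨x, y, hx, hy, rfl⟩
    have := h3 ⟨x, by rwa [mem_ball_zero_iff], rfl⟩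
    simp only [mem_iUnion, Metric.mem_ball, exists_prop] at this ⊢
    obtain ⟨z, hz, hd⟩ := this
    refine ⟨z, hz, ?_⟩
    rw [dist_eq_norm] at hd ⊢
    have := norm_add_le (L x - z) y
    rw [sub_add_eq_add_sub] at this
    linarith
  have hv := (le_volume_ellipsoidBody L).trans ((MeasureTheory.measure_mono hsub).trans
    (MeasureTheory.measure_biUnion_finset_le c _))
  rw [Finset.sum_congr rfl fun x _ => volume_ball x (four_pos), Finset.sum_const, nsmul_eq_mul,
    ← mul_assoc] at hv
  have h4 := (ENNReal.mul_le_mul_iff_left (Metric.measure_ball_pos _ _ one_pos).ne'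
    MeasureTheory.measure_ball_lt_top.ne).1 hv
  rw [← ENNReal.ofReal_natCast, ← ENNReal.ofReal_mul (Nat.cast_nonneg _)] at h4
  have := (ENNReal.ofReal_le_ofReal_iff (by positivity)).1 h4
  linarith

end Covering

end RestorationEntropy

/-! ### Linear differential equations with parameters -/

namespace RestorationEntropy

theorem norm_integral_exp_smul_le {F : Type*} [NormedAddCommGroup F] [NormedSpace ℝ F]
    {b C t : ℝ} (hb : 0 < b) (hC : 0 ≤ C) (ht : 0 ≤ t) {g : ℝ → F} (hg : ∀ s, ‖g s‖ ≤ C) :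
    ‖∫ s in (0 : ℝ)..t, Real.exp (-b * (t - s)) • g s‖ ≤ C / b := by
  have hcont : Continuous fun s : ℝ => C * Real.exp (-b * (t - s)) := by fun_prop
  have h1 : ‖∫ s in (0 : ℝ)..t, Real.exp (-b * (t - s)) • g s‖
      ≤ ∫ s in (0 : ℝ)..t, C * Real.exp (-b * (t - s)) := by
    refine intervalIntegral.norm_integral_le_of_norm_le ht (Eventually.of_forall fun s _ => ?_)
      (hcont.intervalIntegrable _ _)
    rw [norm_smul, Real.norm_of_nonneg (Real.exp_pos _).le, mul_comm]
    exact mul_le_mul_of_nonneg_right (hg s) (Real.exp_pos _).le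
  have h2 : ∫ s in (0 : ℝ)..t, C * Real.exp (-b * (t - s))
      = C / b * Real.exp (-b * (t - t)) - C / b * Real.exp (-b * (t - 0)) := by
    refine intervalIntegral.integral_eq_sub_of_hasDerivAt
      (f := fun s => C / b * Real.exp (-b * (t - s))) (fun s _ => ?_)
      (hcont.intervalIntegrable _ _)
    have h3 : HasDerivAt (fun s : ℝ => -b * (t - s)) b s := by
      simpa using ((hasDerivAt_id s).const_sub t).const_mul (-b)
    convert! (h3.exp.const_mul (C / b)) using 1
    field_simp
  rw [h2] at h1
  simp only [sub_self, mul_zero, Real.exp_zero, mul_one] at h1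
  have : 0 ≤ C / b * Real.exp (-b * (t - 0)) := by positivity
  linarith

/-- Existence of the fundamental solution of a linear differential equation with bounded coefficient
on `[0, ∞)`, jointly continuous in time and a parameter. After multiplication by `exp (-b t)` with
large `b` it is the fixed point of a contraction on bounded continuous functions. -/
theorem exists_fundamental_solution {X F : Type*} [TopologicalSpace X] [NormedRing F]
    [NormedAlgebra ℝ F] [CompleteSpace F] {A : ℝ × X → F} (hA : Continuous A) {L : ℝ}
    (hL0 : 0 ≤ L) (hL : ∀ p, ‖A p‖ ≤ L) :
    ∃ Φ : ℝ × X → F, Continuous Φ ∧ ∀ x, Φ (0, x) = 1 ∧ ∀ t, 0 ≤ t →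
      HasDerivWithinAt (fun s => Φ (s, x)) (A (t, x) * Φ (t, x)) (Ici 0) t := by
  set b : ℝ := 2 * L + 1 with hb
  have hb0 : 0 < b := by positivity
  -- the integral operator on functions of time and parameter
  set I : (ℝ × X → F) → ℝ × X → F := fun ψ p =>
    ∫ s in (0 : ℝ)..(max p.1 0), Real.exp (-b * (max p.1 0 - s)) • (A (s, p.2) * ψ (s, p.2))
    with hI
  have hIc : ∀ ψ : BoundedContinuousFunction (ℝ × X) F, Continuous (I ψ) := by
    intro ψ
    refine intervalIntegral.continuous_parametric_intervalIntegral_of_continuous ?_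
      (continuous_fst.max continuous_const)
    have := ψ.continuous
    simp only [Function.uncurry_def]
    fun_prop
  have hψ : ∀ (ψ : BoundedContinuousFunction (ℝ × X) F) (p : ℝ × X),
      ‖A p * ψ p‖ ≤ L * ‖ψ‖ := fun ψ p =>
    (norm_mul_le _ _).trans (mul_le_mul (hL p) (ψ.norm_coe_le_norm p) (norm_nonneg _) hL0)
  have hIb : ∀ (ψ : BoundedContinuousFunction (ℝ × X) F) (p : ℝ × X),
      ‖I ψ p‖ ≤ L * ‖ψ‖ / b := fun ψ p =>
    norm_integral_exp_smul_le hb0 (by positivity) (le_max_right _ _) fun s => hψ ψ _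
  have hIsub : ∀ (ψ χ : BoundedContinuousFunction (ℝ × X) F) (p : ℝ × X),
      I ψ p - I χ p = I (ψ - χ : BoundedContinuousFunction (ℝ × X) F) p := by
    intro ψ χ p
    have hint : ∀ ψ : BoundedContinuousFunction (ℝ × X) F, IntervalIntegrable
        (fun s => Real.exp (-b * (max p.1 0 - s)) • (A (s, p.2) * ψ (s, p.2)))
        MeasureTheory.volume 0 (max p.1 0) := fun ψ => by
      have := ψ.continuous
      exact Continuous.intervalIntegrable (by fun_prop) _ _
    simp only [hI]
    rw [← intervalIntegral.integral_sub (hint ψ) (hint χ)]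
    simp only [← smul_sub, ← mul_sub, BoundedContinuousFunction.coe_sub, Pi.sub_apply]
  set T : BoundedContinuousFunction (ℝ × X) F → BoundedContinuousFunction (ℝ × X) F := fun ψ =>
    BoundedContinuousFunction.ofNormedAddCommGroup
      (fun p => Real.exp (-b * max p.1 0) • (1 : F) + I ψ p)
      (by have := hIc ψ; fun_prop) (‖(1 : F)‖ + L * ‖ψ‖ / b) (fun p => by
        refine (norm_add_le _ _).trans (add_le_add ?_ (hIb ψ p))
        rw [norm_smul, Real.norm_of_nonneg (Real.exp_pos _).le]
        refine mul_le_of_le_one_left (norm_nonneg _) (Real.exp_le_one_iff.2 ?_)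
        have : 0 ≤ max p.1 0 := le_max_right _ _
        nlinarith) with hT
  have hcontr : ContractingWith (1 / 2) T := by
    refine ⟨by norm_num, LipschitzWith.of_dist_le_mul fun ψ χ => ?_⟩
    refine (BoundedContinuousFunction.dist_le (by positivity)).2 fun p => ?_
    have e : T ψ p - T χ p = I (ψ - χ : BoundedContinuousFunction (ℝ × X) F) p := by
      rw [← hIsub]
      exact add_sub_add_left_eq_sub _ _ _
    rw [dist_eq_norm, e, dist_eq_norm]
    refine (hIb _ p).trans ?_
    rw [div_le_iff₀ hb0, hb]
    have := norm_nonneg (ψ - χ)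
    have e2 : ((1 / 2 : NNReal) : ℝ) = 1 / 2 := by norm_num
    rw [e2]
    nlinarith
  set ψ := ContractingWith.fixedPoint T hcontr with hψdef
  have hfix : ∀ p, ψ p = Real.exp (-b * max p.1 0) • (1 : F) + I ψ p := fun p => by
    have := hcontr.fixedPoint_isFixedPt
    conv_lhs => rw [hψdef, ← this]
    rfl
  have hψc := ψ.continuous
  have hΦc : Continuous fun p : ℝ × X => Real.exp (b * p.1) • ψ p := by fun_prop
  have hint : ∀ x t, 0 ≤ t → Real.exp (b * t) • ψ (t, x)
      = 1 + ∫ s in (0 : ℝ)..t, A (s, x) * (Real.exp (b * s) • ψ (s, x)) := by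
    intro x t ht
    rw [hfix]
    simp only [hI, max_eq_left ht]
    rw [smul_add, smul_smul, ← Real.exp_add, ← intervalIntegral.integral_smul]
    congr 1
    · rw [show b * t + -b * t = 0 by ring, Real.exp_zero, one_smul]
    · refine intervalIntegral.integral_congr fun s _ => ?_
      rw [smul_smul, ← Real.exp_add, mul_smul_comm]
      congr 2
      ring
  refine ⟨fun p => Real.exp (b * p.1) • ψ p, hΦc, fun x => ⟨?_, fun t ht => ?_⟩⟩
  · simpa using hint x 0 le_rfl
  · have hc : Continuous fun s => A (s, x) * (Real.exp (b * s) • ψ (s, x)) := by fun_prop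
    have hd : HasDerivAt (fun t => 1 + ∫ s in (0 : ℝ)..t, A (s, x) * (Real.exp (b * s) • ψ (s, x)))
        (A (t, x) * (Real.exp (b * t) • ψ (t, x))) t :=
      (intervalIntegral.integral_hasDerivAt_right (hc.intervalIntegrable _ _)
        (hc.stronglyMeasurableAtFilter _ _) hc.continuousAt).const_add 1
    exact hd.hasDerivWithinAt.congr (fun s hs => hint x s hs) (hint x t ht)

/-! ### The flow on a compact forward-invariant set -/

section Flow

variable {n : ℕ} {φ : Euc n → Euc n} {K : Set (Euc n)}

/-- The standing assumptions: a field of class `C¹` and a compact forward-invariant set. -/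
structure IsCompactInvariant (φ : Euc n → Euc n) (K : Set (Euc n)) : Prop where
  contDiff : ContDiff ℝ 1 φ
  isCompact : IsCompact K
  invariant : IsForwardInvariantSet φ K

theorem exists_lipschitzOnWith_closedBall (hφ : ContDiff ℝ 1 φ) (R : ℝ) :
    ∃ L : NNReal, LipschitzOnWith L φ (Metric.closedBall 0 R) ∧
      ∀ x ∈ Metric.closedBall (0 : Euc n) R, ‖fderiv ℝ φ x‖ ≤ L := by
  obtain ⟨C, hC⟩ := (isCompact_closedBall (0 : Euc n) R).exists_bound_of_continuousOn
    (hφ.continuous_fderiv one_ne_zero).continuousOn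
  have hC' : ∀ x ∈ Metric.closedBall (0 : Euc n) R, ‖fderiv ℝ φ x‖ ≤ C.toNNReal := fun x hx =>
    (hC x hx).trans (Real.le_coe_toNNReal C)
  exact ⟨C.toNNReal, Convex.lipschitzOnWith_of_nnnorm_fderiv_le
    (fun x _ => (hφ.differentiable one_ne_zero) x) hC' (convex_closedBall 0 R), hC'⟩

theorem _root_.IsSolution.continuousOn {x : ℝ → Euc n} (hx : IsSolution φ x) :
    ContinuousOn x (Ici 0) :=
  fun t ht => (hx t ht).continuousWithinAt

theorem _root_.IsSolution.hasDerivWithinAt {x : ℝ → Euc n} (hx : IsSolution φ x) {t : ℝ}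
    (ht : 0 ≤ t) : HasDerivWithinAt x (φ (x t)) (Ici t) t :=
  (hx t ht).mono (Ici_subset_Ici.2 ht)

theorem _root_.IsSolution.eq (hφ : ContDiff ℝ 1 φ) {x y : ℝ → Euc n} (hx : IsSolution φ x)
    (hy : IsSolution φ y) (h : x 0 = y 0) {t : ℝ} (ht : 0 ≤ t) : x t = y t := by
  have hxc : ContinuousOn x (Icc 0 t) := hx.continuousOn.mono Icc_subset_Ici_self
  have hyc : ContinuousOn y (Icc 0 t) := hy.continuousOn.mono Icc_subset_Ici_self
  obtain ⟨R, hR⟩ := (isCompact_Icc (a := (0 : ℝ)) (b := t)).exists_bound_of_continuousOn hxc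
  obtain ⟨R', hR'⟩ := (isCompact_Icc (a := (0 : ℝ)) (b := t)).exists_bound_of_continuousOn hyc
  obtain ⟨L, hL, -⟩ := exists_lipschitzOnWith_closedBall hφ (max R R')
  refine ODE_solution_unique_of_mem_Icc_right (v := fun _ => φ)
    (s := fun _ => Metric.closedBall 0 (max R R')) (fun _ _ => hL) hxc
    (fun s hs => hx.hasDerivWithinAt hs.1) (fun s hs => ?_) hyc
    (fun s hs => hy.hasDerivWithinAt hs.1) (fun s hs => ?_) h (right_mem_Icc.2 ht)
  · rw [mem_closedBall_zero_iff]
    exact (hR s (Ico_subset_Icc_self hs)).trans (le_max_left _ _)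
  · rw [mem_closedBall_zero_iff]
    exact (hR' s (Ico_subset_Icc_self hs)).trans (le_max_right _ _)

namespace IsCompactInvariant

theorem odeFlow_spec (h : IsCompactInvariant φ K) {a : Euc n} (ha : a ∈ K) :
    IsSolution φ (fun t => odeFlow φ t a) ∧ odeFlow φ 0 a = a ∧
      ∀ t, 0 ≤ t → odeFlow φ t a ∈ K := by
  obtain ⟨x, hx, hx0, hxK⟩ := h.invariant a ha
  have hex : ∃ x : ℝ → Euc n, IsSolution φ x ∧ x 0 = a := ⟨x, hx, hx0⟩
  have e : (fun t => odeFlow φ t a) = hex.choose := by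
    funext t
    rw [odeFlow, dif_pos hex]
  obtain ⟨h1, h2⟩ := hex.choose_spec
  rw [← e] at h1 h2
  refine ⟨h1, h2, fun t ht => ?_⟩
  rw [h1.eq h.contDiff hx (h2.trans hx0.symm) ht]
  exact hxK t ht

theorem isSolution (h : IsCompactInvariant φ K) {a : Euc n} (ha : a ∈ K) :
    IsSolution φ (fun t => odeFlow φ t a) := (h.odeFlow_spec ha).1

theorem odeFlow_zero (h : IsCompactInvariant φ K) {a : Euc n} (ha : a ∈ K) :
    odeFlow φ 0 a = a := (h.odeFlow_spec ha).2.1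

theorem odeFlow_mem (h : IsCompactInvariant φ K) {a : Euc n} (ha : a ∈ K) {t : ℝ} (ht : 0 ≤ t) :
    odeFlow φ t a ∈ K := (h.odeFlow_spec ha).2.2 t ht

theorem odeFlow_add (h : IsCompactInvariant φ K) {a : Euc n} (ha : a ∈ K) {t s : ℝ} (ht : 0 ≤ t)
    (hs : 0 ≤ s) : odeFlow φ (t + s) a = odeFlow φ t (odeFlow φ s a) := by
  have hsa := h.odeFlow_mem ha hs
  refine IsSolution.eq h.contDiff (x := fun t => odeFlow φ (t + s) a) (fun r hr => ?_)
    (h.isSolution hsa) (by simp only [zero_add]; rw [h.odeFlow_zero hsa]) ht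
  have h1 := h.isSolution ha (r + s) (add_nonneg hr hs)
  have h2 : HasDerivWithinAt (fun r : ℝ => r + s) 1 (Ici 0) r :=
    ((hasDerivAt_id r).add_const s).hasDerivWithinAt
  have := h1.scomp r h2 (fun q hq => add_nonneg hq hs)
  rwa [one_smul] at this

/-- A common bound on `K` for the derivative of `φ` and the Lipschitz constant of `φ`. -/
theorem exists_lipschitz (h : IsCompactInvariant φ K) :
    ∃ L : NNReal, LipschitzOnWith L φ K ∧ ∀ x ∈ K, ‖fderiv ℝ φ x‖ ≤ L := by
  obtain ⟨R, hR⟩ := h.isCompact.isBounded.subset_closedBall 0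
  obtain ⟨L, h1, h2⟩ := exists_lipschitzOnWith_closedBall h.contDiff R
  exact ⟨L, h1.mono hR, fun x hx => h2 x (hR hx)⟩

theorem dist_odeFlow_le (h : IsCompactInvariant φ K) {L : NNReal} (hL : LipschitzOnWith L φ K)
    {a b : Euc n} (ha : a ∈ K) (hb : b ∈ K) {t : ℝ} (ht : 0 ≤ t) :
    dist (odeFlow φ t a) (odeFlow φ t b) ≤ dist a b * Real.exp (L * t) := by
  have := dist_le_of_trajectories_ODE_of_mem (v := fun _ => φ) (s := fun _ => K) (a := 0) (b := t)
    (δ := dist a b) (fun _ _ => hL) ((h.isSolution ha).continuousOn.mono Icc_subset_Ici_self)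
    (fun s hs => (h.isSolution ha).hasDerivWithinAt hs.1) (fun s hs => h.odeFlow_mem ha hs.1)
    ((h.isSolution hb).continuousOn.mono Icc_subset_Ici_self)
    (fun s hs => (h.isSolution hb).hasDerivWithinAt hs.1) (fun s hs => h.odeFlow_mem hb hs.1)
    (by rw [h.odeFlow_zero ha, h.odeFlow_zero hb]) t (right_mem_Icc.2 ht)
  rwa [sub_zero] at this

theorem continuous_odeFlow (h : IsCompactInvariant φ K) :
    Continuous fun p : ℝ × K => odeFlow φ (max p.1 0) p.2 := by
  obtain ⟨L, hL, -⟩ := h.exists_lipschitz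
  refine continuous_iff_continuousAt.2 fun p₀ => ?_
  rw [ContinuousAt, tendsto_iff_dist_tendsto_zero]
  have h1 : Continuous fun p : ℝ × K => odeFlow φ (max p.1 0) p₀.2 :=
    (h.isSolution p₀.2.2).continuousOn.comp_continuous (by fun_prop) fun p =>
      mem_Ici.2 (le_max_right _ _)
  have h2 : Tendsto (fun p : ℝ × K => dist (p.2 : Euc n) p₀.2 * Real.exp (L * max p.1 0)
      + dist (odeFlow φ (max p.1 0) p₀.2) (odeFlow φ (max p₀.1 0) p₀.2)) (𝓝 p₀) (𝓝 0) := by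
    have : Continuous fun p : ℝ × K => dist (p.2 : Euc n) p₀.2 * Real.exp (L * max p.1 0)
        + dist (odeFlow φ (max p.1 0) p₀.2) (odeFlow φ (max p₀.1 0) p₀.2) := by fun_prop
    simpa using this.tendsto p₀
  refine squeeze_zero (fun _ => dist_nonneg) (fun p => ?_) h2
  exact (dist_triangle _ _ _).trans
    (add_le_add_left (h.dist_odeFlow_le hL p.2.2 p₀.2.2 (le_max_right _ _)) _)

theorem continuousOn_odeFlow (h : IsCompactInvariant φ K) :
    ContinuousOn (fun p : ℝ × Euc n => odeFlow φ p.1 p.2) (Ici 0 ×ˢ K) := by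
  rw [continuousOn_iff_continuous_domRestrict]
  have : Continuous fun q : (Ici (0 : ℝ) ×ˢ K : Set (ℝ × Euc n)) =>
      ((q.1.1, ⟨q.1.2, q.2.2⟩) : ℝ × K) := by fun_prop
  refine (h.continuous_odeFlow.comp this).congr fun q => ?_
  have : max q.1.1 0 = q.1.1 := max_eq_left q.2.1
  simp [this]

theorem continuousOn_odeFlow_time (h : IsCompactInvariant φ K) {a : Euc n} (ha : a ∈ K) :
    ContinuousOn (fun t => odeFlow φ t a) (Ici 0) := (h.isSolution ha).continuousOn

end IsCompactInvariant

/-! ### The variational equation -/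

/-- `Φ t a` is the value at time `t` of the fundamental solution of the variational equation
`z' = Dφ(x(t, a)) z` along the trajectory that starts at `a ∈ K`. -/
structure IsVariationalFlow (φ : Euc n → Euc n) (K : Set (Euc n))
    (Φ : ℝ → Euc n → Euc n →L[ℝ] Euc n) : Prop where
  continuousOn : ContinuousOn (fun p : ℝ × Euc n => Φ p.1 p.2) (Ici 0 ×ˢ K)
  zero : ∀ a ∈ K, Φ 0 a = 1
  hasDeriv : ∀ a ∈ K, ∀ t, 0 ≤ t →
    HasDerivWithinAt (fun s => Φ s a) (fderiv ℝ φ (odeFlow φ t a) * Φ t a) (Ici 0) t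

theorem IsCompactInvariant.exists_isVariationalFlow (h : IsCompactInvariant φ K) :
    ∃ Φ, IsVariationalFlow φ K Φ := by
  classical
  obtain ⟨L, -, hL⟩ := h.exists_lipschitz
  obtain ⟨Φ, h1, h2⟩ := exists_fundamental_solution
    (A := fun p : ℝ × K => fderiv ℝ φ (odeFlow φ (max p.1 0) p.2))
    ((h.contDiff.continuous_fderiv one_ne_zero).comp h.continuous_odeFlow) L.2
    (fun p => hL _ (h.odeFlow_mem p.2.2 (le_max_right _ _)))
  refine ⟨fun t a => if ha : a ∈ K then Φ (t, ⟨a, ha⟩) else 1, ?_, fun a ha => ?_,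
    fun a ha t ht => ?_⟩
  · rw [continuousOn_iff_continuous_domRestrict]
    have : Continuous fun q : (Ici (0 : ℝ) ×ˢ K : Set (ℝ × Euc n)) =>
        ((q.1.1, ⟨q.1.2, q.2.2⟩) : ℝ × K) := by fun_prop
    refine (h1.comp this).congr fun q => ?_
    have := q.2.2
    simp [this]
  · simp only [dif_pos ha]
    exact (h2 _).1
  · simp only [dif_pos ha]
    have := (h2 ⟨a, ha⟩).2 t ht
    simpa only [max_eq_left ht] using this

namespace IsVariationalFlow

variable {Φ : ℝ → Euc n → Euc n →L[ℝ] Euc n}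

theorem continuousOn_time (hΦ : IsVariationalFlow φ K Φ) {a : Euc n} (ha : a ∈ K) :
    ContinuousOn (fun t => Φ t a) (Ici 0) :=
  fun t ht => (hΦ.hasDeriv a ha t ht).continuousWithinAt

theorem continuousOn_space (hΦ : IsVariationalFlow φ K Φ) {t : ℝ} (ht : 0 ≤ t) :
    ContinuousOn (fun a => Φ t a) K :=
  hΦ.continuousOn.comp (f := fun a => (t, a)) (by fun_prop) fun _ ha => ⟨ht, ha⟩

theorem hasDeriv_apply (hΦ : IsVariationalFlow φ K Φ) {a : Euc n} (ha : a ∈ K) {t : ℝ}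
    (ht : 0 ≤ t) (v : Euc n) :
    HasDerivWithinAt (fun s => Φ s a v) (fderiv ℝ φ (odeFlow φ t a) (Φ t a v)) (Ici 0) t :=
  (hΦ.hasDeriv a ha t ht).clm_apply (hasDerivWithinAt_const t (Ici 0) v) |>.congr_deriv (by simp)

theorem norm_apply_le (hΦ : IsVariationalFlow φ K Φ) (h : IsCompactInvariant φ K) {L : NNReal}
    (hL : ∀ x ∈ K, ‖fderiv ℝ φ x‖ ≤ L) {a : Euc n} (ha : a ∈ K) {t : ℝ} (ht : 0 ≤ t)
    (v : Euc n) : ‖Φ t a v‖ ≤ Real.exp (L * t) * ‖v‖ := by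
  have h1 := norm_le_gronwallBound_of_norm_deriv_right_le (f := fun s => Φ s a v) (a := 0) (b := t)
    (f' := fun s => fderiv ℝ φ (odeFlow φ s a) (Φ s a v)) (δ := ‖v‖) (K := L) (ε := 0)
    (fun s hs => ((hΦ.hasDeriv_apply ha hs.1 v).continuousWithinAt).mono Icc_subset_Ici_self)
    (fun s hs => (hΦ.hasDeriv_apply ha hs.1 v).mono (Ici_subset_Ici.2 hs.1))
    (by simp [hΦ.zero a ha]) (fun s hs => by
      rw [add_zero]
      exact (ContinuousLinearMap.le_opNorm _ _).trans
        (mul_le_mul_of_nonneg_right (hL _ (h.odeFlow_mem ha hs.1)) (norm_nonneg _)))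
    t (right_mem_Icc.2 ht)
  rwa [gronwallBound_ε0, sub_zero, mul_comm] at h1

/-- The lower bound that corresponds to `norm_apply_le`: `exp (2 L s) |Φ(s, a) v|²` increases with
`s`. -/
theorem le_norm_apply (hΦ : IsVariationalFlow φ K Φ) (h : IsCompactInvariant φ K) {L : NNReal}
    (hL : ∀ x ∈ K, ‖fderiv ℝ φ x‖ ≤ L) {a : Euc n} (ha : a ∈ K) {t : ℝ} (ht : 0 ≤ t)
    (v : Euc n) : Real.exp (-(2 * L * t)) * ‖v‖ ^ 2 ≤ ‖Φ t a v‖ ^ 2 := by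
  set g : ℝ → ℝ := fun s => Real.exp (2 * L * s) * ‖Φ s a v‖ ^ 2 with hg
  have hd : ∀ s, 0 ≤ s → HasDerivWithinAt g (2 * L * Real.exp (2 * L * s) * ‖Φ s a v‖ ^ 2
      + Real.exp (2 * L * s)
        * (2 * inner ℝ (Φ s a v) (fderiv ℝ φ (odeFlow φ s a) (Φ s a v)))) (Ici 0) s := by
    intro s hs
    have h1 : HasDerivAt (fun s : ℝ => Real.exp (2 * L * s)) (2 * L * Real.exp (2 * L * s)) s := by
      have := ((hasDerivAt_id s).const_mul (2 * (L : ℝ))).exp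
      simpa [mul_comm] using this
    exact h1.hasDerivWithinAt.mul (hΦ.hasDeriv_apply ha hs v).norm_sq
  have hmono : MonotoneOn g (Ici 0) := by
    refine monotoneOn_of_hasDerivWithinAt_nonneg (convex_Ici 0)
      (fun s hs => (hd s hs).continuousWithinAt)
      (fun s hs => (hd s (interior_subset hs)).mono interior_subset) fun s hs => ?_
    have hs0 : 0 ≤ s := interior_subset (s := Ici (0 : ℝ)) hs
    have h1 : |inner ℝ (Φ s a v) (fderiv ℝ φ (odeFlow φ s a) (Φ s a v))| ≤ L * ‖Φ s a v‖ ^ 2 := by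
      refine (abs_real_inner_le_norm _ _).trans ?_
      have := (ContinuousLinearMap.le_opNorm (fderiv ℝ φ (odeFlow φ s a)) (Φ s a v)).trans
        (mul_le_mul_of_nonneg_right (hL _ (h.odeFlow_mem ha hs0)) (norm_nonneg _))
      have := mul_le_mul_of_nonneg_left this (norm_nonneg (Φ s a v))
      linarith
    have h2 := (abs_le.1 h1).1
    have := Real.exp_pos (2 * L * s)
    nlinarith
  have h1 := hmono (mem_Ici.2 le_rfl) (mem_Ici.2 ht) ht
  simp only [hg, hΦ.zero a ha, mul_zero, Real.exp_zero, one_mul,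
    one_apply_eq_self] at h1
  rw [Real.exp_neg, inv_mul_le_iff₀ (Real.exp_pos _)]
  exact h1

theorem isUnit_det_toMat (hΦ : IsVariationalFlow φ K Φ) (h : IsCompactInvariant φ K) {a : Euc n}
    (ha : a ∈ K) {t : ℝ} (ht : 0 ≤ t) : IsUnit (toMat (Φ t a)).det := by
  obtain ⟨L, -, hL⟩ := h.exists_lipschitz
  rw [← isUnit_iff_isUnit_det, ← mulVec_injective_iff_isUnit]
  intro v w hvw
  have h0 : toMat (Φ t a) *ᵥ (v - w) = 0 := by
    rw [mulVec_sub, sub_eq_zero]; exact hvw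
  rw [toMat_mulVec] at h0
  have h1 : Φ t a (WithLp.toLp 2 (v - w)) = 0 := (WithLp.equiv 2 (Fin n → ℝ)).injective h0
  have h2 := hΦ.le_norm_apply h hL ha ht (WithLp.toLp 2 (v - w))
  rw [h1, norm_zero] at h2
  have h3 : ‖WithLp.toLp 2 (v - w)‖ = 0 := by
    have := Real.exp_pos (-(2 * L * t))
    by_contra hne
    have : 0 < ‖WithLp.toLp 2 (v - w)‖ := lt_of_le_of_ne (norm_nonneg _) (Ne.symm hne)
    have : 0 < Real.exp (-(2 * L * t)) * ‖WithLp.toLp 2 (v - w)‖ ^ 2 := by positivity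
    rw [zero_pow two_ne_zero] at h2
    linarith
  have h4 : WithLp.toLp 2 (v - w) = (0 : Euc n) := norm_eq_zero.1 h3
  exact sub_eq_zero.1 (congrArg WithLp.ofLp h4)

/-- The cocycle property. -/
theorem add (hΦ : IsVariationalFlow φ K Φ) (h : IsCompactInvariant φ K) {a : Euc n}
    (ha : a ∈ K) {t s : ℝ} (ht : 0 ≤ t) (hs : 0 ≤ s) :
    Φ (t + s) a = Φ t (odeFlow φ s a) * Φ s a := by
  obtain ⟨L, -, hL⟩ := h.exists_lipschitz
  have hsa := h.odeFlow_mem ha hs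
  have hd : ∀ r, 0 ≤ r → HasDerivWithinAt
      (fun r => Φ (r + s) a - Φ r (odeFlow φ s a) * Φ s a)
      (fderiv ℝ φ (odeFlow φ r (odeFlow φ s a)) *
        (Φ (r + s) a - Φ r (odeFlow φ s a) * Φ s a)) (Ici 0) r := by
    intro r hr
    have h1 := hΦ.hasDeriv a ha (r + s) (add_nonneg hr hs)
    have h2 : HasDerivWithinAt (fun r : ℝ => r + s) 1 (Ici 0) r :=
      ((hasDerivAt_id r).add_const s).hasDerivWithinAt
    have h3 := h1.scomp r h2 (fun q hq => add_nonneg hq hs)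
    rw [one_smul, h.odeFlow_add ha hr hs] at h3
    have h4 := (hΦ.hasDeriv _ hsa r hr).mul_const (Φ s a)
    have := h3.sub h4
    rw [mul_assoc, ← mul_sub] at this
    exact this
  have h0 := eq_zero_of_abs_deriv_le_mul_abs_self_of_eq_zero_right (K := L) (a := 0) (b := t)
    (f := fun r => Φ (r + s) a - Φ r (odeFlow φ s a) * Φ s a)
    (fun r hr => ((hd r hr.1).continuousWithinAt).mono Icc_subset_Ici_self)
    (fun r hr => (hd r hr.1).mono (Ici_subset_Ici.2 hr.1))
    (by simp [hΦ.zero _ hsa]) (fun r hr => (norm_mul_le _ _).trans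
      (mul_le_mul_of_nonneg_right (hL _ (h.odeFlow_mem hsa hr.1)) (norm_nonneg _)))
    t (right_mem_Icc.2 ht)
  exact sub_eq_zero.1 h0

end IsVariationalFlow

/-- First order Taylor expansion of `φ`, uniform on `K`. -/
theorem IsCompactInvariant.exists_uniform_taylor (h : IsCompactInvariant φ K) {η : ℝ}
    (hη : 0 < η) : ∃ δ > 0, ∀ x ∈ K, ∀ y ∈ K, ‖y - x‖ < δ →
      ‖φ y - φ x - fderiv ℝ φ x (y - x)‖ ≤ η * ‖y - x‖ := by
  obtain ⟨R, hR⟩ := h.isCompact.isBounded.subset_closedBall 0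
  have huc := (isCompact_closedBall (0 : Euc n) R).uniformContinuousOn_of_continuous
    (h.contDiff.continuous_fderiv one_ne_zero).continuousOn
  obtain ⟨δ, hδ, hd⟩ := Metric.uniformContinuousOn_iff.1 huc η hη
  refine ⟨δ, hδ, fun x hx y hy hxy => ?_⟩
  refine Convex.norm_image_sub_le_of_norm_fderiv_le' (𝕜 := ℝ)
    (s := Metric.ball x δ ∩ Metric.closedBall 0 R)
    (fun z _ => h.contDiff.differentiable one_ne_zero z) (fun z hz => ?_)
    ((convex_ball x δ).inter (convex_closedBall 0 R)) ⟨Metric.mem_ball_self hδ, hR hx⟩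
    ⟨by rwa [Metric.mem_ball, dist_eq_norm], hR hy⟩
  rw [← dist_eq_norm]
  exact (hd z hz.2 x (hR hx) hz.1).le

/-- The time-`T` map is approximated by the solutions of the variational equation, uniformly for
pairs of points of `K`. The set `K` need not be open or convex. -/
theorem IsVariationalFlow.exists_linear_approx {Φ : ℝ → Euc n → Euc n →L[ℝ] Euc n}
    (hΦ : IsVariationalFlow φ K Φ) (h : IsCompactInvariant φ K) {T : ℝ} (hT : 0 ≤ T) {η : ℝ}
    (hη : 0 < η) : ∃ δ > 0, ∀ x ∈ K, ∀ y ∈ K, ‖y - x‖ < δ →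
      ‖odeFlow φ T y - odeFlow φ T x - Φ T x (y - x)‖ ≤ η * ‖y - x‖ := by
  obtain ⟨L, hLip, hL⟩ := h.exists_lipschitz
  set c : ℝ := Real.exp (L * T) * gronwallBound 0 L 1 T + 1 with hc
  have hg0 : 0 ≤ gronwallBound 0 L 1 T := by
    have := gronwallBound_mono (δ := 0) (K := L) (ε := 1) le_rfl zero_le_one L.2 hT
    rwa [gronwallBound_x0] at this
  have hc0 : 0 < c := by positivity
  obtain ⟨δ, hδ, hd⟩ := h.exists_uniform_taylor (div_pos hη hc0)
  refine ⟨δ * Real.exp (-(L * T)), by positivity, fun x hx y hy hxy => ?_⟩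
  have hz : ∀ t ∈ Icc 0 T, ‖odeFlow φ t y - odeFlow φ t x‖ ≤ Real.exp (L * T) * ‖y - x‖ := by
    intro t ht
    have := h.dist_odeFlow_le hLip hy hx ht.1
    rw [dist_eq_norm, dist_eq_norm] at this
    refine this.trans ?_
    rw [mul_comm]
    have : Real.exp (L * t) ≤ Real.exp (L * T) :=
      Real.exp_le_exp.2 (mul_le_mul_of_nonneg_left ht.2 L.2)
    exact mul_le_mul_of_nonneg_right this (norm_nonneg _)
  -- the error `w` solves the variational equation up to the Taylor remainder of `φ`
  set w : ℝ → Euc n := fun t => odeFlow φ t y - odeFlow φ t x - Φ t x (y - x) with hw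
  have hwd : ∀ t, 0 ≤ t → HasDerivWithinAt w (φ (odeFlow φ t y) - φ (odeFlow φ t x)
      - fderiv ℝ φ (odeFlow φ t x) (Φ t x (y - x))) (Ici 0) t := fun t ht =>
    ((h.isSolution hy t ht).sub (h.isSolution hx t ht)).sub (hΦ.hasDeriv_apply hx ht _)
  have h1 := norm_le_gronwallBound_of_norm_deriv_right_le (f := w) (a := 0) (b := T) (δ := 0)
    (K := L) (ε := η / c * (Real.exp (L * T) * ‖y - x‖))
    (fun t ht => ((hwd t ht.1).continuousWithinAt).mono Icc_subset_Ici_self)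
    (fun t ht => (hwd t ht.1).mono (Ici_subset_Ici.2 ht.1))
    (by simp [hw, hΦ.zero x hx, h.odeFlow_zero hx, h.odeFlow_zero hy]) (fun t ht => by
      have hxt := h.odeFlow_mem hx ht.1
      have hyt := h.odeFlow_mem hy ht.1
      have hzt := hz t (Ico_subset_Icc_self ht)
      have hlt : ‖odeFlow φ t y - odeFlow φ t x‖ < δ := by
        refine hzt.trans_lt ?_
        have := mul_lt_mul_of_pos_left hxy (Real.exp_pos (L * T))
        rwa [mul_left_comm, ← Real.exp_add, add_neg_cancel, Real.exp_zero, mul_one] at this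
      have h2 := (hd _ hxt _ hyt hlt).trans
        (mul_le_mul_of_nonneg_left hzt (div_pos hη hc0).le)
      have e : φ (odeFlow φ t y) - φ (odeFlow φ t x)
          - fderiv ℝ φ (odeFlow φ t x) (Φ t x (y - x))
          = fderiv ℝ φ (odeFlow φ t x) (w t) + (φ (odeFlow φ t y) - φ (odeFlow φ t x)
          - fderiv ℝ φ (odeFlow φ t x) (odeFlow φ t y - odeFlow φ t x)) := by
        simp only [hw, map_sub]
        abel
      rw [e]
      refine (norm_add_le _ _).trans (add_le_add ?_ h2)
      exact (ContinuousLinearMap.le_opNorm _ _).trans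
        (mul_le_mul_of_nonneg_right (hL _ hxt) (norm_nonneg _)))
    T (right_mem_Icc.2 hT)
  have hlin : ∀ ε : ℝ, gronwallBound 0 L ε T = ε * gronwallBound 0 L 1 T := by
    intro ε
    by_cases hL0 : (L : ℝ) = 0
    · simp [hL0, gronwallBound_K0]
    · rw [gronwallBound_of_K_ne_0 hL0, gronwallBound_of_K_ne_0 hL0]
      ring
  rw [sub_zero, hlin] at h1
  refine h1.trans ?_
  have : η / c * (Real.exp (L * T) * ‖y - x‖) * gronwallBound 0 L 1 T
      = η * ‖y - x‖ * (Real.exp (L * T) * gronwallBound 0 L 1 T / c) := by ring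
  rw [this]
  refine mul_le_of_le_one_right (by positivity) ?_
  rw [div_le_one hc0, hc]
  linarith

end Flow

end RestorationEntropy

/-! ### Binary logarithms of covering numbers -/

namespace RestorationEntropy

/-- The binary logarithm of an extended natural number. -/
noncomputable def lg (N : ℕ∞) : EReal := ENNReal.log (N : ENNReal) / ((Real.log 2 : ℝ) : EReal)

theorem lg_mono {N M : ℕ∞} (h : N ≤ M) : lg N ≤ lg M :=
  EReal.div_le_div_right_of_nonneg (EReal.coe_nonneg.2 (Real.log_nonneg one_le_two))
    (ENNReal.log_monotone (ENat.toENNReal_le.2 h))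

theorem lg_natCast {k : ℕ} (hk : 1 ≤ k) : lg k = ((Real.log k / Real.log 2 : ℝ) : EReal) := by
  have hk' : (0 : ℝ) < k := by exact_mod_cast hk
  have : ((k : ℕ∞) : ENNReal) = ENNReal.ofReal k := by simp
  rw [lg, this, ENNReal.log_ofReal_of_pos hk', EReal.coe_div]

theorem lg_le_iff {N : ℕ∞} {g : ℝ} :
    lg N ≤ (g : EReal) ↔ ∃ k : ℕ, N ≤ k ∧ (k : ℝ) ≤ 2 ^ g := by
  have hl : 0 < Real.log 2 := Real.log_pos one_lt_two
  have key : ∀ m : ℕ, 1 ≤ m → (lg m ≤ (g : EReal) ↔ (m : ℝ) ≤ 2 ^ g) := fun m hm => by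
    have hm' : (0 : ℝ) < m := by exact_mod_cast hm
    rw [lg_natCast hm, EReal.coe_le_coe_iff, div_le_iff₀ hl, ← Real.log_rpow two_pos,
      Real.log_le_log_iff hm' (Real.rpow_pos_of_pos two_pos _)]
  constructor
  · intro h
    induction N using ENat.recTopCoe with
    | top =>
      rw [lg] at h
      simp only [ENat.toENNReal_top, ENNReal.log_top] at h
      rw [EReal.top_div_of_pos_ne_top (EReal.coe_pos.2 hl) (EReal.coe_ne_top _)] at h
      exact absurd (top_le_iff.1 h) (EReal.coe_ne_top _)
    | coe m =>
      refine ⟨m, le_rfl, ?_⟩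
      rcases Nat.eq_zero_or_pos m with rfl | hm
      · simpa using (Real.rpow_pos_of_pos two_pos g).le
      · exact (key m hm).1 h
  · rintro ⟨k, hk, hg⟩
    refine (lg_mono hk).trans ?_
    rcases Nat.eq_zero_or_pos k with rfl | hk0
    · rw [lg]
      simp only [Nat.cast_zero, ENat.toENNReal_zero, ENNReal.log_zero]
      rw [EReal.bot_div_of_pos_ne_top (EReal.coe_pos.2 hl) (EReal.coe_ne_top _)]
      exact bot_le
    · exact (key k hk0).2 hg

theorem lg_nonneg {N : ℕ∞} (h : 1 ≤ N) : 0 ≤ lg N := by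
  have := lg_mono h
  rw [← Nat.cast_one, lg_natCast le_rfl] at this
  simpa using this

section Counting

variable {n : ℕ}

theorem ballCoveringNumber_le_card {S : Set (Euc n)} {δ : ℝ} {c : Finset (Euc n)}
    (h : S ⊆ ⋃ y ∈ c, Metric.ball y δ) : ballCoveringNumber S δ ≤ c.card :=
  iInf₂_le c h

theorem exists_card_eq_ballCoveringNumber {S : Set (Euc n)} {δ : ℝ} {k : ℕ}
    (h : ballCoveringNumber S δ ≤ k) :
    ∃ c : Finset (Euc n), S ⊆ ⋃ y ∈ c, Metric.ball y δ ∧ c.card ≤ k := by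
  by_contra! hcon
  have : ((k + 1 : ℕ) : ℕ∞) ≤ ballCoveringNumber S δ :=
    le_iInf₂ fun c hc => by exact_mod_cast hcon c hc
  have h2 := this.trans h
  norm_cast at h2
  omega

theorem one_le_ballCoveringNumber {S : Set (Euc n)} (hS : S.Nonempty) (δ : ℝ) :
    1 ≤ ballCoveringNumber S δ := by
  refine le_iInf₂ fun c hc => ?_
  obtain ⟨x, hx⟩ := hS
  have := hc hx
  simp only [mem_iUnion, exists_prop] at this
  obtain ⟨y, hy, -⟩ := this
  exact_mod_cast Finset.card_pos.2 ⟨y, hy⟩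

/-- A `2 δ`-separated family in a set has at most as many points as a cover by `δ`-balls. -/
theorem card_le_ballCoveringNumber {ι : Type*} {S : Set (Euc n)} {δ : ℝ} (s : Finset ι)
    (f : ι → Euc n) (hf : ∀ i ∈ s, f i ∈ S)
    (hd : ∀ i ∈ s, ∀ j ∈ s, i ≠ j → 2 * δ ≤ dist (f i) (f j)) :
    (s.card : ℕ∞) ≤ ballCoveringNumber S δ := by
  refine le_iInf₂ fun c hc => ?_
  have hex : ∀ i ∈ s, ∃ y ∈ c, dist (f i) y < δ := fun i hi => by
    have := hc (hf i hi)
    simpa only [mem_iUnion, Metric.mem_ball, exists_prop] using this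
  choose! g hg hgd using hex
  have : s.card ≤ c.card := by
    refine Finset.card_le_card_of_injOn g (fun i hi => hg i hi) fun i hi j hj hij => ?_
    by_contra hne
    have h1 := hd i hi j hj hne
    have h2 := hgd i hi
    have h3 := hgd j hj
    rw [← hij] at h3
    have := dist_triangle_right (f i) (f j) (g i)
    linarith
  exact_mod_cast this

/-! ### The counting rate -/

variable {φ : Euc n → Euc n} {K : Set (Euc n)}

/-- `limsup_{δ → 0+} sup_{a ∈ K} log₂ N(τ, a, δ)`. -/
noncomputable def rate (φ : Euc n → Euc n) (K : Set (Euc n)) (τ : ℝ) : EReal :=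
  limsup (fun δ : ℝ => ⨆ a ∈ K, lg (resCount φ K τ a δ)) (𝓝[>] (0 : ℝ))

theorem resRate_eq (φ : Euc n → Euc n) (K : Set (Euc n)) (τ : ℝ) :
    resRate φ K τ = rate φ K τ / (τ : EReal) := rfl

theorem rate_le {τ : ℝ} {g : ℝ} (h : ∀ᶠ δ in 𝓝[>] (0 : ℝ), ∀ a ∈ K,
    ∃ k : ℕ, resCount φ K τ a δ ≤ k ∧ (k : ℝ) ≤ 2 ^ g) : rate φ K τ ≤ g := by
  refine limsup_le_of_le (by isBoundedDefault) (h.mono fun δ hδ => ?_)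
  exact iSup₂_le fun a ha => lg_le_iff.2 (hδ a ha)

theorem le_rate {τ : ℝ} {a : Euc n} (ha : a ∈ K) {e : EReal}
    (h : ∀ᶠ δ in 𝓝[>] (0 : ℝ), e ≤ lg (resCount φ K τ a δ)) : e ≤ rate φ K τ :=
  le_limsup_of_frequently_le ((h.mono fun _ hδ =>
    hδ.trans (le_iSup₂ (f := fun a (_ : a ∈ K) => lg (resCount φ K τ a _)) a ha)).frequently)
    (by isBoundedDefault)

theorem eventually_count_of_rate_lt {τ g : ℝ} (h : rate φ K τ < g) :
    ∀ᶠ δ in 𝓝[>] (0 : ℝ), ∀ a ∈ K, ∃ k : ℕ, resCount φ K τ a δ ≤ k ∧ (k : ℝ) ≤ 2 ^ g := by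
  filter_upwards [eventually_lt_of_limsup_lt h] with δ hδ a ha
  exact lg_le_iff.1 ((le_iSup₂ (f := fun a (_ : a ∈ K) => lg (resCount φ K τ a δ)) a ha).trans
    hδ.le)

theorem rate_nonneg (hne : K.Nonempty) (τ : ℝ) : 0 ≤ rate φ K τ := by
  obtain ⟨a, ha⟩ := hne
  refine le_rate ha ?_
  filter_upwards [self_mem_nhdsWithin] with δ hδ
  exact lg_nonneg (one_le_ballCoveringNumber (S := odeFlow φ τ '' (Metric.ball a δ ∩ K))
    ⟨_, mem_image_of_mem _ ⟨Metric.mem_ball_self hδ, ha⟩⟩ δ)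

/-- The counts are submultiplicative in time, up to the number of balls centered in `K` that cover
the trace on `K` of a ball with an arbitrary center. -/
theorem exists_resCount_add_le (h : IsCompactInvariant φ K) {s t : ℝ} (hs : 0 ≤ s) (ht : 0 ≤ t)
    {δ : ℝ} (hδ : 0 < δ) {k l : ℕ} {a : Euc n} (hk : resCount φ K s a δ ≤ k)
    (hl : ∀ b ∈ K, resCount φ K t b δ ≤ l) :
    resCount φ K (t + s) a δ ≤ ((k * (3 ^ n * l) : ℕ) : ℕ∞) := by
  classical
  obtain ⟨c, hc, hck⟩ := exists_card_eq_ballCoveringNumber hk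
  choose e he1 he2 he3 using fun y => exists_centered_cover K y hδ
  have hd : ∀ b, b ∈ K → ∃ d : Finset (Euc n),
      odeFlow φ t '' (Metric.ball b δ ∩ K) ⊆ ⋃ y ∈ d, Metric.ball y δ ∧ d.card ≤ l :=
    fun b hb => exists_card_eq_ballCoveringNumber (hl b hb)
  choose! d hd1 hd2 using hd
  have hcov : odeFlow φ (t + s) '' (Metric.ball a δ ∩ K)
      ⊆ ⋃ y ∈ c.biUnion fun y => (e y).biUnion d, Metric.ball y δ := by
    rintro _ ⟨x, hx, rfl⟩
    have h1 := hc (mem_image_of_mem _ hx)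
    simp only [mem_iUnion, exists_prop] at h1
    obtain ⟨y, hy, hxy⟩ := h1
    have hsx := h.odeFlow_mem hx.2 hs
    have h2 := he3 y ⟨hxy, hsx⟩
    simp only [mem_iUnion, exists_prop] at h2
    obtain ⟨z, hz, hxz⟩ := h2
    have h3 := hd1 z (he1 y hz).2 (mem_image_of_mem _ ⟨hxz, hsx⟩)
    simp only [mem_iUnion, exists_prop] at h3
    obtain ⟨w, hw, hxw⟩ := h3
    rw [h.odeFlow_add hx.2 ht hs]
    simp only [mem_iUnion, exists_prop, Finset.mem_biUnion]
    exact ⟨w, ⟨y, hy, z, hz, hw⟩, hxw⟩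
  refine (ballCoveringNumber_le_card hcov).trans ?_
  have : (c.biUnion fun y => (e y).biUnion d).card ≤ k * (3 ^ n * l) := by
    refine (Finset.card_biUnion_le_card_mul _ _ (3 ^ n * l) fun y hy => ?_).trans
      (Nat.mul_le_mul_right _ hck)
    exact (Finset.card_biUnion_le_card_mul _ _ l fun z hz => hd2 z (he1 y hz).2).trans
      (Nat.mul_le_mul_right _ (he2 y))
  exact_mod_cast this

theorem rate_add_le (h : IsCompactInvariant φ K) {s t : ℝ} (hs : 0 ≤ s) (ht : 0 ≤ t) {g g' : ℝ}
    (hg : rate φ K s < g) (hg' : rate φ K t < g') :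
    rate φ K (t + s) ≤ ((g + g' + n * Real.logb 2 3 : ℝ) : EReal) := by
  refine rate_le ?_
  filter_upwards [eventually_count_of_rate_lt hg, eventually_count_of_rate_lt hg',
    self_mem_nhdsWithin] with δ h1 h2 hδ a ha
  obtain ⟨k, hk, hk2⟩ := h1 a ha
  have hl : ∀ b ∈ K, resCount φ K t b δ ≤ (⌊(2 : ℝ) ^ g'⌋₊ : ℕ∞) := fun b hb => by
    obtain ⟨l, hl1, hl2⟩ := h2 b hb
    refine hl1.trans ?_
    exact_mod_cast Nat.le_floor hl2
  refine ⟨_, exists_resCount_add_le h hs ht hδ hk hl, ?_⟩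
  have hp : (0 : ℝ) < 2 ^ g' := Real.rpow_pos_of_pos two_pos _
  have e : (2 : ℝ) ^ (g + g' + n * Real.logb 2 3) = 2 ^ g * (3 ^ n * 2 ^ g') := by
    rw [Real.rpow_add two_pos, Real.rpow_add two_pos, mul_comm (n : ℝ), Real.rpow_mul two_pos.le,
      Real.rpow_logb two_pos (by norm_num) three_pos, Real.rpow_natCast]
    ring
  rw [e]
  push_cast
  gcongr
  exact Nat.floor_le hp.le

theorem resCount_le_of_linear_approx {Φ : ℝ → Euc n → Euc n →L[ℝ] Euc n}
    (hΦ : IsVariationalFlow φ K Φ) (h : IsCompactInvariant φ K) {τ : ℝ} (hτ : 0 ≤ τ) :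
    ∀ᶠ δ in 𝓝[>] (0 : ℝ), ∀ a ∈ K, ∃ k : ℕ, resCount φ K τ a δ ≤ k ∧
      (k : ℝ) ≤ 8 ^ n * √(expansion (Φ τ a)) := by
  obtain ⟨δ₀, hδ₀, hd⟩ := hΦ.exists_linear_approx h hτ one_pos
  filter_upwards [Ioo_mem_nhdsGT hδ₀] with δ hδ a ha
  obtain ⟨c, hc, hcard⟩ := exists_cover_card_le (Φ τ a) (odeFlow φ τ a) hδ.1
    (S := odeFlow φ τ '' (Metric.ball a δ ∩ K)) (by
      rintro _ ⟨x, ⟨hxa, hxK⟩, rfl⟩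
      rw [Metric.mem_ball, dist_eq_norm] at hxa
      refine ⟨x - a, odeFlow φ τ x - odeFlow φ τ a - Φ τ a (x - a), hxa, ?_, by abel⟩
      have := hd a ha x hxK (hxa.trans hδ.2)
      rw [one_mul] at this
      exact this.trans_lt hxa)
  exact ⟨c.card, ballCoveringNumber_le_card hc, hcard⟩

/-- Upper bound of the rate through the solutions of the variational equation. -/
theorem rate_le_of_expansion_le {Φ : ℝ → Euc n → Euc n →L[ℝ] Euc n}
    (hΦ : IsVariationalFlow φ K Φ) (h : IsCompactInvariant φ K) {τ : ℝ} (hτ : 0 ≤ τ) {b : ℝ}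
    (hb : ∀ a ∈ K, Real.log (expansion (Φ τ a)) ≤ b) :
    rate φ K τ ≤ ((n * Real.logb 2 8 + b / (2 * Real.log 2) : ℝ) : EReal) := by
  have hl : 0 < Real.log 2 := Real.log_pos one_lt_two
  refine rate_le ?_
  filter_upwards [resCount_le_of_linear_approx hΦ h hτ] with δ hδ a ha
  obtain ⟨k, hk, hk2⟩ := hδ a ha
  refine ⟨k, hk, hk2.trans ?_⟩
  have e : (2 : ℝ) ^ (n * Real.logb 2 8 + b / (2 * Real.log 2)) = 8 ^ n * Real.exp (b / 2) := by
    rw [Real.rpow_add two_pos, mul_comm (n : ℝ), Real.rpow_mul two_pos.le,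
      Real.rpow_logb two_pos (by norm_num) (by norm_num), Real.rpow_natCast,
      Real.rpow_def_of_pos two_pos (b / _)]
    congr 2
    field_simp
  rw [e]
  refine mul_le_mul_of_nonneg_left ?_ (by positivity)
  have hp : 0 < expansion (Φ τ a) := one_pos.trans_le (one_le_expansion _)
  rw [Real.sqrt_le_left (Real.exp_pos _).le, ← Real.exp_nat_mul, ← Real.log_le_iff_le_exp hp]
  have := hb a ha
  push_cast
  linarith

/-- Lower bound of the rate through the solutions of the variational equation at an interior
point. -/
theorem le_rate_of_mem_interior {Φ : ℝ → Euc n → Euc n →L[ℝ] Euc n}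
    (hΦ : IsVariationalFlow φ K Φ) (h : IsCompactInvariant φ K) {τ : ℝ} (hτ : 0 ≤ τ) {a : Euc n}
    (ha : a ∈ interior K) {g : ℝ} (hg : rate φ K τ ≤ g) :
    Real.log (expansion (Φ τ a)) ≤ 2 * (n * Real.log 4 + g * Real.log 2) := by
  have hl : 0 < Real.log 2 := Real.log_pos one_lt_two
  have haK : a ∈ K := interior_subset ha
  obtain ⟨c, hc, hsep, hcard⟩ := exists_sep_card_ge (Φ τ a)
  have hpre : ∀ p ∈ c, ∃ x ∈ Metric.ball (0 : Euc n) 1, Φ τ a x = p := fun p hp => hc hp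
  choose! f hf hfp using hpre
  obtain ⟨ρ, hρ, hball⟩ := Metric.isOpen_iff.1 isOpen_interior a ha
  obtain ⟨δ₀, hδ₀, hd⟩ := hΦ.exists_linear_approx h hτ (η := 1 / 4) (by norm_num)
  have hD : 1 ≤ √(expansion (Φ τ a)) := Real.one_le_sqrt.2 (one_le_expansion _)
  have hc1 : 1 ≤ c.card := by
    by_contra hcon
    have : c.card = 0 := by omega
    rw [this] at hcard
    norm_num at hcard
    linarith
  have hev : ∀ᶠ δ in 𝓝[>] (0 : ℝ), lg c.card ≤ lg (resCount φ K τ a δ) := by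
    filter_upwards [Ioo_mem_nhdsGT (lt_min hρ hδ₀)] with δ hδ
    have hδ0 : 0 < δ := hδ.1
    refine lg_mono ?_
    have hnorm : ∀ p ∈ c, ‖δ • f p‖ < δ := fun p hp => by
      have := hf p hp
      rw [mem_ball_zero_iff] at this
      rw [norm_smul, Real.norm_of_nonneg hδ0.le]
      exact mul_lt_of_lt_one_right hδ0 this
    have hmem : ∀ p ∈ c, a + δ • f p ∈ Metric.ball a δ ∩ K := fun p hp => by
      have h1 : a + δ • f p ∈ Metric.ball a δ := by
        rw [Metric.mem_ball, dist_eq_norm, add_sub_cancel_left]; exact hnorm p hp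
      exact ⟨h1, interior_subset (hball (Metric.ball_subset_ball
        (hδ.2.le.trans (min_le_left _ _)) h1))⟩
    -- the images of the points `a + δ f(p)` are `δ p` up to a translation and an error `δ / 4`;
    -- since the `δ p` have distances at least `3 δ`, the images have distances at least `2 δ`
    have happ : ∀ p ∈ c, ‖odeFlow φ τ (a + δ • f p) - odeFlow φ τ a - δ • p‖ ≤ 1 / 4 * δ := by
      intro p hp
      have hn := hnorm p hp
      have := hd a haK _ (hmem p hp).2 (by
        rw [add_sub_cancel_left]
        exact hn.trans (hδ.2.trans_le (min_le_right _ _)))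
      rw [add_sub_cancel_left, map_smul, hfp p hp] at this
      linarith
    refine card_le_ballCoveringNumber c (fun p => odeFlow φ τ (a + δ • f p))
      (fun p hp => mem_image_of_mem _ (hmem p hp)) fun p hp q hq hpq => ?_
    have h1 := hsep p hp q hq hpq
    have h2 := happ p hp
    have h3 := happ q hq
    have h4 : ‖δ • p - δ • q‖ = δ * dist p q := by
      rw [← smul_sub, norm_smul, Real.norm_of_nonneg hδ0.le, dist_eq_norm]
    have h5 : δ • p - δ • q = (odeFlow φ τ (a + δ • f p) - odeFlow φ τ (a + δ • f q))
        - (odeFlow φ τ (a + δ • f p) - odeFlow φ τ a - δ • p)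
        + (odeFlow φ τ (a + δ • f q) - odeFlow φ τ a - δ • q) := by abel
    have h6 := norm_add_le ((odeFlow φ τ (a + δ • f p) - odeFlow φ τ (a + δ • f q))
        - (odeFlow φ τ (a + δ • f p) - odeFlow φ τ a - δ • p))
        (odeFlow φ τ (a + δ • f q) - odeFlow φ τ a - δ • q)
    rw [← h5, h4] at h6
    have h7 := norm_sub_le (odeFlow φ τ (a + δ • f p) - odeFlow φ τ (a + δ • f q))
        (odeFlow φ τ (a + δ • f p) - odeFlow φ τ a - δ • p)
    rw [dist_eq_norm]
    nlinarith
  have h1 := (le_rate haK hev).trans hg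
  rw [lg_natCast hc1, EReal.coe_le_coe_iff, div_le_iff₀ hl] at h1
  have hc0 : (0 : ℝ) < c.card := by exact_mod_cast hc1
  have h2 := Real.log_le_log (one_pos.trans_le hD) hcard
  rw [Real.log_sqrt (one_pos.le.trans (one_le_expansion _)), Real.log_mul (by positivity) hc0.ne',
    Real.log_pow] at h2
  linarith

end Counting

/-! ### Existence of the limit -/

/-- Fekete's lemma in continuous time, for functions that are subadditive up to a constant. -/
theorem exists_tendsto_div_of_almost_subadditive {u : ℝ → ℝ} {c B : ℝ} (hc : 0 ≤ c)
    (hadd : ∀ s t, 0 ≤ s → 0 ≤ t → u (t + s) ≤ u s + u t + c) (h0 : ∀ t, 0 ≤ u t)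
    (hB : ∀ t ∈ Icc (0 : ℝ) 1, u t ≤ B) : ∃ l : ℝ, Tendsto (fun t => u t / t) atTop (𝓝 l) := by
  have hsub : Subadditive fun k : ℕ => u k + c := fun k m => by
    have := hadd m k (Nat.cast_nonneg _) (Nat.cast_nonneg _)
    push_cast
    linarith
  have hbdd : BddBelow (range fun k : ℕ => (u k + c) / k) :=
    ⟨0, by rintro _ ⟨k, rfl⟩; exact div_nonneg (add_nonneg (h0 _) hc) (Nat.cast_nonneg _)⟩
  have h1 := hsub.tendsto_lim hbdd
  set l := hsub.lim
  have hfl : Tendsto (fun t : ℝ => ⌊t⌋₊) atTop atTop := tendsto_nat_floor_atTop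
  have hdiv : Tendsto (fun t : ℝ => (⌊t⌋₊ : ℝ) / t) atTop (𝓝 1) := tendsto_nat_floor_div_atTop
  have hinv : Tendsto (fun t : ℝ => t⁻¹) atTop (𝓝 0) := tendsto_inv_atTop_zero
  -- compare `u t` with the values at the integers `⌊t⌋` and `⌊t⌋ + 1`
  have hup : Tendsto (fun t : ℝ => (u ⌊t⌋₊ + c) / ⌊t⌋₊ * (⌊t⌋₊ / t) + B * t⁻¹) atTop (𝓝 l) := by
    simpa using ((h1.comp hfl).mul hdiv).add (hinv.const_mul B)
  have hlow : Tendsto (fun t : ℝ => (u (⌊t⌋₊ + 1 : ℕ) + c) / (⌊t⌋₊ + 1 : ℕ)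
      * (⌊t⌋₊ / t + t⁻¹) - (B + 2 * c) * t⁻¹) atTop (𝓝 l) := by
    simpa using (((h1.comp (tendsto_add_atTop_nat 1)).comp hfl).mul (hdiv.add hinv)).sub
      (hinv.const_mul (B + 2 * c))
  refine ⟨l, tendsto_of_tendsto_of_tendsto_of_le_of_le' hlow hup ?_ ?_⟩
  · filter_upwards [eventually_ge_atTop 1] with t ht
    have ht0 : 0 < t := by linarith
    have hf1 := Nat.floor_le ht0.le
    have hf2 := Nat.lt_floor_add_one t
    have h2 := hadd t ((⌊t⌋₊ + 1 : ℕ) - t) ht0.le (by push_cast; linarith)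
    rw [sub_add_cancel] at h2
    have h3 := hB ((⌊t⌋₊ + 1 : ℕ) - t) ⟨by push_cast; linarith, by push_cast; linarith⟩
    have e : (u (⌊t⌋₊ + 1 : ℕ) + c) / (⌊t⌋₊ + 1 : ℕ) * (⌊t⌋₊ / t + t⁻¹)
        = (u (⌊t⌋₊ + 1 : ℕ) + c) * t⁻¹ := by
      push_cast
      have : (⌊t⌋₊ : ℝ) + 1 ≠ 0 := by positivity
      field_simp
    rw [e, ← sub_mul, div_eq_mul_inv]
    exact mul_le_mul_of_nonneg_right (by linarith) (inv_pos.2 ht0).le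
  · filter_upwards [eventually_ge_atTop 1] with t ht
    have ht0 : 0 < t := by linarith
    have hf1 := Nat.floor_le ht0.le
    have hf2 := Nat.lt_floor_add_one t
    have h2 := hadd (t - ⌊t⌋₊) ⌊t⌋₊ (by linarith) (Nat.cast_nonneg _)
    rw [add_sub_cancel] at h2
    have h3 := hB (t - ⌊t⌋₊) ⟨by linarith, by linarith⟩
    have hfp : (0 : ℝ) < ⌊t⌋₊ := by exact_mod_cast Nat.floor_pos.2 ht
    have e : (u ⌊t⌋₊ + c) / ⌊t⌋₊ * (⌊t⌋₊ / t) = (u ⌊t⌋₊ + c) * t⁻¹ := by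
      field_simp
    rw [e, ← add_mul, div_eq_mul_inv]
    exact mul_le_mul_of_nonneg_right (by linarith) (inv_pos.2 ht0).le

section Limit

variable {n : ℕ} {φ : Euc n → Euc n} {K : Set (Euc n)}

theorem IsVariationalFlow.exists_expansion_le {Φ : ℝ → Euc n → Euc n →L[ℝ] Euc n}
    (hΦ : IsVariationalFlow φ K Φ) (h : IsCompactInvariant φ K) (T : ℝ) :
    ∃ B, ∀ t ∈ Icc 0 T, ∀ a ∈ K, Real.log (expansion (Φ t a)) ≤ B := by
  have hc : ContinuousOn (fun p : ℝ × Euc n => Real.log (expansion (Φ p.1 p.2)))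
      (Icc 0 T ×ˢ K) := by
    refine ContinuousOn.log (continuous_expansion.comp_continuousOn
      (hΦ.continuousOn.mono (prod_mono Icc_subset_Ici_self le_rfl))) fun p _ => ?_
    exact (one_pos.trans_le (one_le_expansion _)).ne'
  obtain ⟨B, hB⟩ := (isCompact_Icc.prod h.isCompact).exists_bound_of_continuousOn hc
  exact ⟨B, fun t ht a ha => (le_abs_self _).trans (hB (t, a) ⟨ht, ha⟩)⟩

/-- The rates are real numbers, and their quotients by the time converge. -/
theorem exists_rate_limit (h : IsCompactInvariant φ K) (hne : K.Nonempty) :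
    ∃ (u : ℝ → ℝ) (l : ℝ), (∀ t, 0 ≤ t → rate φ K t = u t) ∧ (∀ t, 0 ≤ u t) ∧
      Tendsto (fun t => u t / t) atTop (𝓝 l) := by
  obtain ⟨Φ, hΦ⟩ := h.exists_isVariationalFlow
  have hfin : ∀ T, ∃ C : ℝ, ∀ t ∈ Icc 0 T, rate φ K t ≤ C := fun T => by
    obtain ⟨B, hB⟩ := hΦ.exists_expansion_le h T
    exact ⟨_, fun t ht => rate_le_of_expansion_le hΦ h ht.1 (hB t ht)⟩
  have hcoe : ∀ t, 0 ≤ t → rate φ K t = (rate φ K t).toReal := fun t ht => by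
    obtain ⟨C, hC⟩ := hfin t
    refine (EReal.coe_toReal ?_ ?_).symm
    · exact ((hC t ⟨ht, le_rfl⟩).trans_lt (EReal.coe_lt_top C)).ne
    · exact (EReal.bot_lt_zero.trans_le (rate_nonneg hne t)).ne'
  have h0 : ∀ t, 0 ≤ (rate φ K t).toReal := fun t => EReal.toReal_nonneg (rate_nonneg hne t)
  obtain ⟨B, hB⟩ := hfin 1
  obtain ⟨l, hl⟩ := exists_tendsto_div_of_almost_subadditive (u := fun t => (rate φ K t).toReal)
    (c := n * Real.logb 2 3) (B := B)
    (mul_nonneg (Nat.cast_nonneg _) (Real.logb_nonneg one_lt_two (by norm_num)))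
    (fun s t hs ht => by
      refine le_of_forall_pos_le_add fun ε hε => ?_
      have := rate_add_le h hs ht (g := (rate φ K s).toReal + ε / 2)
        (g' := (rate φ K t).toReal + ε / 2)
        (by rw [hcoe s hs, EReal.coe_lt_coe_iff, EReal.toReal_coe]; linarith)
        (by rw [hcoe t ht, EReal.coe_lt_coe_iff, EReal.toReal_coe]; linarith)
      rw [hcoe _ (add_nonneg ht hs), EReal.coe_le_coe_iff] at this
      linarith)
    h0 (fun t ht => by
      have := hB t ht
      rwa [hcoe t ht.1, EReal.coe_le_coe_iff] at this)
  exact ⟨_, l, hcoe, h0, hl⟩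

theorem tendsto_resRate {u : ℝ → ℝ} {l : ℝ} (hu : ∀ t, 0 ≤ t → rate φ K t = u t)
    (hl : Tendsto (fun t => u t / t) atTop (𝓝 l)) :
    Tendsto (resRate φ K) atTop (𝓝 (l : EReal)) := by
  have h1 : Tendsto (fun t => ((u t / t : ℝ) : EReal)) atTop (𝓝 (l : EReal)) :=
    (continuous_coe_real_ereal.tendsto l).comp hl
  refine h1.congr' ?_
  filter_upwards [eventually_ge_atTop 0] with t ht
  rw [resRate_eq, hu t ht, EReal.coe_div]

theorem restorationEntropy_eq {u : ℝ → ℝ} {l : ℝ} (hu : ∀ t, 0 ≤ t → rate φ K t = u t)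
    (hl : Tendsto (fun t => u t / t) atTop (𝓝 l)) : restorationEntropy φ K = l :=
  (tendsto_resRate hu hl).limsup_eq

/-- An exponential bound for `expansion` bounds the limit of the rates. -/
theorem limit_le_of_expansion_le {Φ : ℝ → Euc n → Euc n →L[ℝ] Euc n}
    (hΦ : IsVariationalFlow φ K Φ) (h : IsCompactInvariant φ K) {u : ℝ → ℝ} {l : ℝ}
    (hu : ∀ t, 0 ≤ t → rate φ K t = u t) (hl : Tendsto (fun t => u t / t) atTop (𝓝 l))
    {m C : ℝ} (hm : ∀ t, 0 ≤ t → ∀ a ∈ K, Real.log (expansion (Φ t a)) ≤ C + m * t) :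
    l ≤ m / (2 * Real.log 2) := by
  have hinv : Tendsto (fun t : ℝ => t⁻¹) atTop (𝓝 0) := tendsto_inv_atTop_zero
  have h1 : Tendsto (fun t : ℝ => (n * Real.logb 2 8 + C / (2 * Real.log 2)) * t⁻¹
      + m / (2 * Real.log 2)) atTop (𝓝 (m / (2 * Real.log 2))) := by
    simpa using (hinv.const_mul (n * Real.logb 2 8 + C / (2 * Real.log 2))).add_const
      (m / (2 * Real.log 2))
  refine le_of_tendsto_of_tendsto hl h1 ?_
  filter_upwards [eventually_gt_atTop 0] with t ht
  have h2 := rate_le_of_expansion_le hΦ h ht.le (hm t ht.le)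
  rw [hu t ht.le, EReal.coe_le_coe_iff] at h2
  rw [div_le_iff₀ ht]
  refine h2.trans_eq ?_
  field_simp
  ring

/-- If `K` is the closure of its interior, `expansion` grows at most with an exponential rate
arbitrarily close to the one given by the limit of the rates. -/
theorem exists_expansion_growth {Φ : ℝ → Euc n → Euc n →L[ℝ] Euc n}
    (hΦ : IsVariationalFlow φ K Φ) (h : IsCompactInvariant φ K) (hK : closure (interior K) = K)
    {u : ℝ → ℝ} {l : ℝ} (hu : ∀ t, 0 ≤ t → rate φ K t = u t)
    (hl : Tendsto (fun t => u t / t) atTop (𝓝 l)) {l' : ℝ} (hl' : l < l') (hl0 : 0 ≤ l) :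
    ∃ C, 0 ≤ C ∧ ∀ t, 0 ≤ t → ∀ a ∈ K,
      Real.log (expansion (Φ t a)) ≤ 2 * Real.log 2 * l' * t + C := by
  have hlog : 0 < Real.log 2 := Real.log_pos one_lt_two
  obtain ⟨T, hT⟩ := eventually_atTop.1 ((hl.eventually_lt_const hl').and (eventually_gt_atTop 0))
  obtain ⟨B, hB⟩ := hΦ.exists_expansion_le h T
  have h4 : 0 ≤ 2 * (n * Real.log 4) := by
    have : 0 ≤ Real.log 4 := Real.log_nonneg (by norm_num)
    positivity
  refine ⟨max B (2 * (n * Real.log 4)), h4.trans (le_max_right _ _), fun t ht a ha => ?_⟩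
  rcases le_total t T with hle | hge
  · have h1 := hB t ⟨ht, hle⟩ a ha
    have h2 : 0 ≤ 2 * Real.log 2 * l' * t := by
      have : 0 ≤ l' := hl0.trans hl'.le
      positivity
    have := le_max_left B (2 * (n * Real.log 4))
    linarith
  · obtain ⟨h1, h2⟩ := hT t hge
    rw [div_lt_iff₀ h2] at h1
    have hcont : ContinuousOn (fun a => Real.log (expansion (Φ t a))) K :=
      ContinuousOn.log (continuous_expansion.comp_continuousOn (hΦ.continuousOn_space ht))
        fun a _ => (one_pos.trans_le (one_le_expansion _)).ne'
    have key : ∀ b ∈ closure (interior K), Real.log (expansion (Φ t b))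
        ≤ 2 * Real.log 2 * l' * t + max B (2 * (n * Real.log 4)) := by
      intro b hb
      refine ContinuousWithinAt.closure_le (f := fun a => Real.log (expansion (Φ t a)))
        (s := interior K) hb ((hcont b (hK ▸ hb)).mono interior_subset)
        continuousWithinAt_const fun c hc => ?_
      have h3 := le_rate_of_mem_interior hΦ h ht hc (hu t ht).le
      have h5 := le_max_right B (2 * (n * Real.log 4))
      have h6 := mul_lt_mul_of_pos_right h1 hlog
      linarith
    exact key a (hK.symm ▸ ha)

end Limit

end RestorationEntropy

/-! ### Metrics along trajectories and the upper bound -/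

namespace RestorationEntropy

section Metric

variable {n : ℕ} {φ : Euc n → Euc n} {K : Set (Euc n)}
  {Φ : ℝ → Euc n → Euc n →L[ℝ] Euc n} {P Pdot : Euc n → Matrix (Fin n) (Fin n) ℝ}

theorem toMat_smul (c : ℝ) (L : Euc n →L[ℝ] Euc n) : toMat (c • L) = c • toMat L :=
  map_smul (toEuclideanCLM (n := Fin n) (𝕜 := ℝ)).symm c L

theorem toMat_sub (L M : Euc n →L[ℝ] Euc n) : toMat (L - M) = toMat L - toMat M :=
  map_sub (toEuclideanCLM (n := Fin n) (𝕜 := ℝ)).symm L M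

/-- The product rule for `Mᵀ Q M`, in terms of difference quotients. -/
theorem tendsto_slope_congr {M Q : ℝ → Matrix (Fin n) (Fin n) ℝ}
    {M' Q' : Matrix (Fin n) (Fin n) ℝ} {t : ℝ}
    (hM : Tendsto (fun z => (z - t)⁻¹ • (M z - M t)) (𝓝[>] t) (𝓝 M'))
    (hMc : Tendsto M (𝓝[>] t) (𝓝 (M t)))
    (hQ : Tendsto (fun z => (z - t)⁻¹ • (Q z - Q t)) (𝓝[>] t) (𝓝 Q'))
    (hQc : Tendsto Q (𝓝[>] t) (𝓝 (Q t))) :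
    Tendsto (fun z => (z - t)⁻¹ • ((M z)ᵀ * Q z * M z - (M t)ᵀ * Q t * M t)) (𝓝[>] t)
      (𝓝 (M'ᵀ * Q t * M t + (M t)ᵀ * Q' * M t + (M t)ᵀ * Q t * M')) := by
  have hT : Tendsto (fun z => ((z - t)⁻¹ • (M z - M t))ᵀ) (𝓝[>] t) (𝓝 M'ᵀ) :=
    (continuous_id.matrix_transpose.tendsto M').comp hM
  have h1 := (hT.mul hQc).mul hMc
  have h2 := ((tendsto_const_nhds (x := (M t)ᵀ)).mul hQ).mul hMc
  have h3 := (tendsto_const_nhds (x := (M t)ᵀ * Q t)).mul hM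
  refine ((h1.add h2).add h3).congr fun z => ?_
  simp only [transpose_smul, transpose_sub, Matrix.smul_mul, Matrix.mul_smul, ← smul_add]
  congr 1
  simp only [Matrix.sub_mul, Matrix.mul_sub]
  abel

/-- The pullback of the metric `P` under the flow: `Φ(t, a)ᵀ P(x(t, a)) Φ(t, a)`. -/
noncomputable def pullback (φ : Euc n → Euc n) (Φ : ℝ → Euc n → Euc n →L[ℝ] Euc n)
    (P : Euc n → Matrix (Fin n) (Fin n) ℝ) (t : ℝ) (a : Euc n) : Matrix (Fin n) (Fin n) ℝ :=
  (toMat (Φ t a))ᵀ * P (odeFlow φ t a) * toMat (Φ t a)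

theorem pullback_zero (hΦ : IsVariationalFlow φ K Φ) (h : IsCompactInvariant φ K) {a : Euc n}
    (ha : a ∈ K) : pullback φ Φ P 0 a = P a := by
  rw [pullback, hΦ.zero a ha, toMat_one, h.odeFlow_zero ha]
  simp

theorem pullback_add (hΦ : IsVariationalFlow φ K Φ) (h : IsCompactInvariant φ K) {a : Euc n}
    (ha : a ∈ K) {t s : ℝ} (ht : 0 ≤ t) (hs : 0 ≤ s) :
    pullback φ Φ P (t + s) a
      = (toMat (Φ s a))ᵀ * pullback φ Φ P t (odeFlow φ s a) * toMat (Φ s a) := by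
  rw [pullback, pullback, hΦ.add h ha ht hs, h.odeFlow_add ha ht hs, toMat_mul, transpose_mul]
  simp only [Matrix.mul_assoc]

theorem posDef_pullback (hΦ : IsVariationalFlow φ K Φ) (h : IsCompactInvariant φ K)
    (hP : ∀ a ∈ K, (P a).PosDef) {a : Euc n} (ha : a ∈ K) {t : ℝ} (ht : 0 ≤ t) :
    (pullback φ Φ P t a).PosDef :=
  posDef_congr (hP _ (h.odeFlow_mem ha ht)) (hΦ.isUnit_det_toMat h ha ht)

theorem continuousOn_pullback (hΦ : IsVariationalFlow φ K Φ) (h : IsCompactInvariant φ K)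
    (hP : ContinuousOn P K) :
    ContinuousOn (fun p : ℝ × Euc n => pullback φ Φ P p.1 p.2) (Ici 0 ×ˢ K) := by
  have h1 := continuous_toMat.comp_continuousOn hΦ.continuousOn
  have h2 : ContinuousOn (fun p : ℝ × Euc n => P (odeFlow φ p.1 p.2)) (Ici 0 ×ˢ K) :=
    hP.comp h.continuousOn_odeFlow fun p hp => h.odeFlow_mem hp.2 hp.1
  exact ((continuous_id.matrix_transpose.comp_continuousOn h1).mul h2).mul h1

theorem continuousOn_pullback_time (hΦ : IsVariationalFlow φ K Φ) (h : IsCompactInvariant φ K)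
    (hP : ContinuousOn P K) {a : Euc n} (ha : a ∈ K) :
    ContinuousOn (fun t => pullback φ Φ P t a) (Ici 0) :=
  (continuousOn_pullback hΦ h hP).comp (f := fun t => (t, a)) (by fun_prop) fun _ ht => ⟨ht, ha⟩

theorem continuousOn_pullback_space (hΦ : IsVariationalFlow φ K Φ) (h : IsCompactInvariant φ K)
    (hP : ContinuousOn P K) {t : ℝ} (ht : 0 ≤ t) :
    ContinuousOn (fun a => pullback φ Φ P t a) K :=
  (continuousOn_pullback hΦ h hP).comp (f := fun a => (t, a)) (by fun_prop) fun _ ha => ⟨ht, ha⟩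

theorem tendsto_slope_toMat (hΦ : IsVariationalFlow φ K Φ) {a : Euc n} (ha : a ∈ K) {t : ℝ}
    (ht : 0 ≤ t) :
    Tendsto (fun z => (z - t)⁻¹ • (toMat (Φ z a) - toMat (Φ t a))) (𝓝[>] t)
      (𝓝 (jacobianMatrix φ (odeFlow φ t a) * toMat (Φ t a))) := by
  have h1 := ((hΦ.hasDeriv a ha t ht).mono (Ioi_subset_Ici ht))
  rw [hasDerivWithinAt_iff_tendsto_slope' self_notMem_Ioi] at h1
  have h2 := (continuous_toMat.tendsto _).comp h1
  rw [toMat_mul, ← jacobianMatrix_eq] at h2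
  refine h2.congr fun z => ?_
  rw [Function.comp_apply, slope_def_module, toMat_smul, toMat_sub]

/-- The symmetric matrix `P Dφ + Dφᵀ P + Ṗ` of the pencil. -/
noncomputable def orbitalForm (φ : Euc n → Euc n) (P Pdot : Euc n → Matrix (Fin n) (Fin n) ℝ)
    (x : Euc n) : Matrix (Fin n) (Fin n) ℝ :=
  (2 : ℝ) • symPart (P x * jacobianMatrix φ x) + Pdot x

theorem posRootSum_eq (φ : Euc n → Euc n) (P Pdot : Euc n → Matrix (Fin n) (Fin n) ℝ)
    (x : Euc n) : posRootSum φ P Pdot x = pencilSum (orbitalForm φ P Pdot x) (P x) := rfl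

theorem orbitalForm_eq {x : Euc n} (hP : (P x).IsSymm) : orbitalForm φ P Pdot x
    = P x * jacobianMatrix φ x + (jacobianMatrix φ x)ᵀ * P x + Pdot x := by
  rw [orbitalForm, symPart, smul_smul, transpose_mul, hP.eq]
  norm_num

theorem isSymm_of_tendsto {X : Type*} {l : Filter X} [l.NeBot] {f : X → Matrix (Fin n) (Fin n) ℝ}
    {A : Matrix (Fin n) (Fin n) ℝ} (hf : ∀ᶠ x in l, (f x).IsSymm) (h : Tendsto f l (𝓝 A)) :
    A.IsSymm := by
  have h1 : Tendsto (fun x => (f x)ᵀ) l (𝓝 Aᵀ) :=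
    (continuous_id.matrix_transpose.tendsto A).comp h
  exact tendsto_nhds_unique (h1.congr' (hf.mono fun x hx => hx.eq)) h

theorem isSymm_orbitalForm (h : IsCompactInvariant φ K)
    (hP : IsMetricWithOrbitalDeriv φ K P Pdot) {x : Euc n} (hx : x ∈ K) :
    (orbitalForm φ P Pdot x).IsSymm := by
  have hs : ∀ y ∈ K, (P y).IsSymm := fun y hy => (posDef_iff_quad.1 (hP.posDef y hy)).1
  have hd : (Pdot x).IsSymm := by
    refine isSymm_of_tendsto ?_ (hP.hasOrbitalDeriv x hx)
    filter_upwards [self_mem_nhdsWithin] with τ hτ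
    exact ((hs _ (h.odeFlow_mem hx (le_of_lt hτ))).sub (hs x hx)).smul _
  rw [orbitalForm_eq (hs x hx)]
  refine IsSymm.add ?_ hd
  rw [IsSymm, transpose_add, transpose_mul, transpose_mul, transpose_transpose, (hs x hx).eq,
    add_comm]

/-- The difference quotient of the pulled back metric along a trajectory. -/
theorem tendsto_slope_pullback (hΦ : IsVariationalFlow φ K Φ) (h : IsCompactInvariant φ K)
    (hP : IsMetricWithOrbitalDeriv φ K P Pdot) {a : Euc n} (ha : a ∈ K) {t : ℝ} (ht : 0 ≤ t) :
    Tendsto (fun z => (z - t)⁻¹ • (pullback φ Φ P z a - pullback φ Φ P t a)) (𝓝[>] t)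
      (𝓝 ((toMat (Φ t a))ᵀ * orbitalForm φ P Pdot (odeFlow φ t a) * toMat (Φ t a))) := by
  have hsub : 𝓝[>] t ≤ 𝓝[Ici 0] t := nhdsWithin_mono t (Ioi_subset_Ici ht)
  have hat := h.odeFlow_mem ha ht
  have hQ : Tendsto (fun z => (z - t)⁻¹ • (P (odeFlow φ z a) - P (odeFlow φ t a))) (𝓝[>] t)
      (𝓝 (Pdot (odeFlow φ t a))) := by
    have h1 : Tendsto (fun z => z - t) (𝓝[>] t) (𝓝[>] 0) := by
      refine tendsto_nhdsWithin_of_tendsto_nhds_of_eventually_within _ ?_ ?_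
      · have : Continuous fun z : ℝ => z - t := by fun_prop
        simpa using (this.tendsto t).mono_left nhdsWithin_le_nhds
      · filter_upwards [self_mem_nhdsWithin] with z hz
        exact mem_Ioi.2 (sub_pos.2 (mem_Ioi.1 hz))
    refine ((hP.hasOrbitalDeriv _ hat).comp h1).congr' ?_
    filter_upwards [self_mem_nhdsWithin] with z hz
    have hz' : 0 ≤ z - t := (sub_pos.2 (mem_Ioi.1 hz)).le
    rw [Function.comp_apply, ← h.odeFlow_add ha hz' ht, sub_add_cancel]
  have hQc : Tendsto (fun z => P (odeFlow φ z a)) (𝓝[>] t) (𝓝 (P (odeFlow φ t a))) :=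
    ((hP.continuousOn.comp (h.continuousOn_odeFlow_time ha)
      fun s hs => h.odeFlow_mem ha hs) t ht).tendsto.mono_left hsub
  have hMc : Tendsto (fun z => toMat (Φ z a)) (𝓝[>] t) (𝓝 (toMat (Φ t a))) :=
    ((continuous_toMat.comp_continuousOn (hΦ.continuousOn_time ha)) t ht).tendsto.mono_left hsub
  have := tendsto_slope_congr (tendsto_slope_toMat hΦ ha ht) hMc hQ hQc
  rw [orbitalForm_eq (posDef_iff_quad.1 (hP.posDef _ hat)).1]
  convert! this using 2
  rw [transpose_mul]
  simp only [Matrix.mul_add, Matrix.add_mul, Matrix.mul_assoc]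
  abel

/-- The determinant of `P(a) + Φᵀ P Φ` grows along trajectories at most with the exponential rate
given by the sum of the positive parts of the roots of the pencil. -/
theorem log_det_add_pullback_le (hΦ : IsVariationalFlow φ K Φ) (h : IsCompactInvariant φ K)
    (hP : IsMetricWithOrbitalDeriv φ K P Pdot) {m : ℝ}
    (hm : ∀ x ∈ K, posRootSum φ P Pdot x ≤ m) {a : Euc n} (ha : a ∈ K) {T : ℝ} (hT : 0 ≤ T) :
    Real.log (P a + pullback φ Φ P T a).det
      ≤ Real.log (P a + pullback φ Φ P 0 a).det + m * T := by
  set N : ℝ → Matrix (Fin n) (Fin n) ℝ := fun t => P a + pullback φ Φ P t a with hN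
  have hNpd : ∀ t, 0 ≤ t → (N t).PosDef := fun t ht =>
    (hP.posDef a ha).add (posDef_pullback hΦ h hP.posDef ha ht)
  have hNc : ContinuousOn N (Ici 0) :=
    continuousOn_const.add (continuousOn_pullback_time hΦ h hP.continuousOn ha)
  have hgc : ContinuousOn (fun t => Real.log (N t).det) (Icc 0 T) :=
    ((continuous_id.matrix_det.comp_continuousOn hNc).mono Icc_subset_Ici_self).log
      fun t ht => (hNpd t ht.1).det_pos.ne'
  have hmain := le_gronwallBound_of_liminf_deriv_right_le (f := fun t => Real.log (N t).det)
    (f' := fun _ => m) (δ := Real.log (N 0).det) (K := 0) (ε := m) (a := 0) (b := T) hgc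
    (fun t ht r hr => by
      have ht0 : 0 ≤ t := ht.1
      have hat := h.odeFlow_mem ha ht0
      -- the trace of the relative derivative is at most `m`
      have htr : ((N t)⁻¹ * ((toMat (Φ t a))ᵀ * orbitalForm φ P Pdot (odeFlow φ t a)
          * toMat (Φ t a))).trace ≤ m := by
        obtain ⟨Z, hZ1, hZ2, hZ3⟩ := exists_posSemidef_trace_eq_pencilSum (hP.posDef _ hat)
          (isSymm_orbitalForm h hP hat)
        have h1 := trace_inv_add_congr_le (hP.posDef a ha) (hP.posDef _ hat) hZ1
          (Φ := toMat (Φ t a))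
        rw [hZ3] at h1
        have h2 : ((N t)⁻¹ * ((toMat (Φ t a))ᵀ * orbitalForm φ P Pdot (odeFlow φ t a)
            * toMat (Φ t a))).trace ≤ ((N t)⁻¹ * ((toMat (Φ t a))ᵀ * Z * toMat (Φ t a))).trace := by
          obtain ⟨B, hB, hNB⟩ := exists_factor (hNpd t ht0).inv
          have key : ∀ Y : Matrix (Fin n) (Fin n) ℝ,
              ((N t)⁻¹ * ((toMat (Φ t a))ᵀ * Y * toMat (Φ t a))).trace
              = ∑ i, ((toMat (Φ t a) * Bᵀ) *ᵥ Pi.single i 1) ⬝ᵥ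
                Y *ᵥ ((toMat (Φ t a) * Bᵀ) *ᵥ Pi.single i 1) := by
            intro Y
            rw [hNB, Matrix.mul_assoc Bᵀ, trace_mul_comm, trace]
            refine Finset.sum_congr rfl fun i _ => ?_
            rw [← quad_congr, quad_single, diag_apply, transpose_mul, transpose_transpose]
            simp only [Matrix.mul_assoc]
          rw [key, key]
          exact Finset.sum_le_sum fun i _ => hZ2 _
        have h3 := hm _ hat
        rw [posRootSum_eq] at h3
        exact h2.trans (h1.trans h3)
      have hsl : Tendsto (fun z => ((N t)⁻¹ * ((z - t)⁻¹ • (N z - N t))).trace) (𝓝[>] t)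
          (𝓝 ((N t)⁻¹ * ((toMat (Φ t a))ᵀ * orbitalForm φ P Pdot (odeFlow φ t a)
          * toMat (Φ t a))).trace) := by
        have h1 := tendsto_slope_pullback hΦ h hP ha ht0
        have h2 : Continuous fun Y : Matrix (Fin n) (Fin n) ℝ => ((N t)⁻¹ * Y).trace :=
          (continuous_const.matrix_mul continuous_id).matrix_trace
        refine ((h2.tendsto _).comp h1).congr fun z => ?_
        simp only [Function.comp_apply, hN, add_sub_add_left_eq_sub]
      refine Eventually.frequently ?_
      filter_upwards [hsl.eventually_lt_const (htr.trans_lt hr), self_mem_nhdsWithin] with z hz hzt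
      have hzt' : 0 < z - t := sub_pos.2 hzt
      refine lt_of_le_of_lt ?_ hz
      rw [Matrix.mul_smul, trace_smul, smul_eq_mul]
      refine mul_le_mul_of_nonneg_left ?_ (inv_pos.2 hzt').le
      have := log_det_le_add_trace (hNpd t ht0) (hNpd z (ht0.trans (le_of_lt hzt)))
      linarith)
    le_rfl (fun t _ => by simp) T (right_mem_Icc.2 hT)
  rwa [gronwallBound_K0, sub_zero] at hmain

/-- A continuous metric is bounded below by a multiple of the identity on a compact set. -/
theorem exists_pos_quadLe (hK : IsCompact K) (hP : ContinuousOn P K)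
    (hPd : ∀ a ∈ K, (P a).PosDef) : ∃ c : ℝ, 0 < c ∧ ∀ a ∈ K, QuadLe (c • 1) (P a) := by
  have hcont : ContinuousOn (fun p : Euc n × Euc n => p.2.ofLp ⬝ᵥ P p.1 *ᵥ p.2.ofLp)
      (K ×ˢ Metric.sphere 0 1) := by
    have h1 : Continuous fun p : Euc n × Euc n => p.2.ofLp := by fun_prop
    have h2 : ContinuousOn (fun p : Euc n × Euc n => P p.1) (K ×ˢ Metric.sphere 0 1) :=
      hP.comp continuousOn_fst fun p hp => hp.1
    have h3 : Continuous fun q : Matrix (Fin n) (Fin n) ℝ × (Fin n → ℝ) => q.2 ⬝ᵥ q.1 *ᵥ q.2 :=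
      continuous_snd.dotProduct (continuous_fst.matrix_mulVec continuous_snd)
    exact h3.comp_continuousOn (h2.prodMk h1.continuousOn)
  obtain ⟨c, hc, hmin⟩ := (hK.prod (isCompact_sphere (0 : Euc n) 1)).exists_forall_le' hcont
    (a := 0) (fun p hp => (posDef_iff_quad.1 (hPd p.1 hp.1)).2 _ fun h0 => by
      have h1 : ‖p.2‖ = 1 := mem_sphere_zero_iff_norm.1 hp.2
      have h2 := norm_sq_eq_dotProduct p.2
      rw [h0, h1] at h2
      simp at h2)
  refine ⟨c, hc, fun a ha v => ?_⟩
  rw [quad_smul, quad_one]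
  set w : Euc n := WithLp.toLp 2 v
  rcases eq_or_ne w 0 with hw | hw
  · have : v = 0 := congrArg WithLp.ofLp hw
    simp [this]
  · have hw0 : 0 < ‖w‖ := norm_pos_iff.2 hw
    have h1 := hmin (a, ‖w‖⁻¹ • w) ⟨ha, by
      rw [mem_sphere_zero_iff_norm, norm_smul, norm_inv, norm_norm, inv_mul_cancel₀ hw0.ne']⟩
    have h2 : (‖w‖⁻¹ • w).ofLp = ‖w‖⁻¹ • v := rfl
    simp only [h2, mulVec_smul, dotProduct_smul, smul_dotProduct, smul_eq_mul] at h1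
    have h3 := norm_sq_eq_dotProduct w
    have h4 : w.ofLp = v := rfl
    rw [h4] at h3
    rw [← h3]
    have h5 : ‖w‖⁻¹ * (‖w‖⁻¹ * (v ⬝ᵥ P a *ᵥ v)) = (v ⬝ᵥ P a *ᵥ v) / ‖w‖ ^ 2 := by
      field_simp
    rw [h5, le_div_iff₀ (by positivity)] at h1
    exact h1

/-- A bound for the roots of the pencil bounds the growth of `expansion`. -/
theorem exists_expansion_le_of_posRootSum_le (hΦ : IsVariationalFlow φ K Φ)
    (h : IsCompactInvariant φ K) (hP : IsMetricWithOrbitalDeriv φ K P Pdot) {m : ℝ}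
    (hm : ∀ x ∈ K, posRootSum φ P Pdot x ≤ m) :
    ∃ C, ∀ t, 0 ≤ t → ∀ a ∈ K, Real.log (expansion (Φ t a)) ≤ C + m * t := by
  obtain ⟨c, hc, hcP⟩ := exists_pos_quadLe h.isCompact hP.continuousOn hP.posDef
  have hcont : ContinuousOn (fun a => Real.log (P a + P a).det) K :=
    (continuous_id.matrix_det.comp_continuousOn (hP.continuousOn.add hP.continuousOn)).log
      fun a ha => ((hP.posDef a ha).add (hP.posDef a ha)).det_pos.ne'
  obtain ⟨B, hB⟩ := h.isCompact.exists_bound_of_continuousOn hcont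
  refine ⟨B - n * Real.log c, fun t ht a ha => ?_⟩
  have h1 := log_det_add_pullback_le hΦ h hP hm ha ht
  rw [pullback_zero hΦ h ha] at h1
  have h2 := (le_abs_self _).trans (hB a ha)
  have hpd := posDef_one_add_transpose_mul_self (toMat (Φ t a))
  have h3 : QuadLe (c • (1 + (toMat (Φ t a))ᵀ * toMat (Φ t a))) (P a + pullback φ Φ P t a) := by
    intro v
    have h4 := hcP a ha v
    have h5 := hcP _ (h.odeFlow_mem ha ht) (toMat (Φ t a) *ᵥ v)
    rw [quad_smul, quad_one] at h4 h5
    rw [quad_smul, quad_add, quad_add, quad_one, quad_transpose_mul_self, pullback, quad_congr]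
    linarith
  have h6 := det_le_det_of_quadLe (hpd.smul hc) (posDef_iff_quad.1
    ((hP.posDef a ha).add (posDef_pullback hΦ h hP.posDef ha ht))).1 h3
  have hE : 0 < (1 + (toMat (Φ t a))ᵀ * toMat (Φ t a)).det := hpd.det_pos
  rw [det_smul, Fintype.card_fin] at h6
  have h7 := Real.log_le_log (by positivity) h6
  rw [Real.log_mul (by positivity) hE.ne', Real.log_pow] at h7
  have h8 : Real.log (expansion (Φ t a))
      = Real.log (1 + (toMat (Φ t a))ᵀ * toMat (Φ t a)).det := rfl
  linarith

end Metric

end RestorationEntropy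

/-! ### Iterated geometric means of pulled back metrics -/

namespace RestorationEntropy

section Iterates

variable {n : ℕ} {φ : Euc n → Euc n} {K : Set (Euc n)}
  {Φ : ℝ → Euc n → Euc n →L[ℝ] Euc n} {θ h : ℝ}

/-- The metrics `P₀ = 1`, `Pₖ₊₁ = (Φ(h)ᵀ Pₖ Φ(h)) ^ θ`. Their pullbacks
are controlled by the growth of `expansion`, uniformly in `k`, and for large `k` the iterate `Pₖ₊₁`
is at most slightly larger than `Pₖ`. -/
noncomputable def iterMetric (φ : Euc n → Euc n) (Φ : ℝ → Euc n → Euc n →L[ℝ] Euc n) (θ h : ℝ) :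
    ℕ → Euc n → Matrix (Fin n) (Fin n) ℝ
  | 0, _ => 1
  | k + 1, a => matPow θ (pullback φ Φ (iterMetric φ Φ θ h k) h a)

theorem pullback_iterMetric_zero (t : ℝ) (a : Euc n) :
    pullback φ Φ (iterMetric φ Φ θ h 0) t a = (toMat (Φ t a))ᵀ * toMat (Φ t a) := by
  simp [pullback, iterMetric]

theorem posDef_iterMetric (hΦ : IsVariationalFlow φ K Φ) (hK : IsCompactInvariant φ K)
    (hh : 0 ≤ h) (k : ℕ) : ∀ a ∈ K, (iterMetric φ Φ θ h k a).PosDef := by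
  induction k with
  | zero => exact fun _ _ => PosDef.one
  | succ k ih =>
    exact fun a ha => (isGeomMean_matPow θ (posDef_pullback hΦ hK ih ha hh)).posDef

theorem isGeomMean_iterMetric (hΦ : IsVariationalFlow φ K Φ) (hK : IsCompactInvariant φ K)
    (hh : 0 ≤ h) (k : ℕ) {a : Euc n} (ha : a ∈ K) :
    IsGeomMean θ 1 (pullback φ Φ (iterMetric φ Φ θ h k) h a) (iterMetric φ Φ θ h (k + 1) a) :=
  isGeomMean_matPow θ (posDef_pullback hΦ hK (posDef_iterMetric hΦ hK hh k) ha hh)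

theorem continuousOn_iterMetric (hΦ : IsVariationalFlow φ K Φ) (hK : IsCompactInvariant φ K)
    (hh : 0 ≤ h) (h0 : 0 < θ) (h1 : θ < 1) (k : ℕ) :
    ContinuousOn (iterMetric φ Φ θ h k) K := by
  induction k with
  | zero => exact continuousOn_const
  | succ k ih =>
    have hpd : ∀ a ∈ K, (pullback φ Φ (iterMetric φ Φ θ h k) h a).PosDef := fun a ha =>
      posDef_pullback hΦ hK (posDef_iterMetric hΦ hK hh k) ha hh
    exact ContinuousOn.comp (t := {A | A.PosDef}) (g := matPow θ)
      (fun Q hQ => continuousAt_matPow h0 h1 hQ) (continuousOn_pullback_space hΦ hK ih hh) hpd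

theorem isGeomMean_pullback_iterMetric (hΦ : IsVariationalFlow φ K Φ)
    (hK : IsCompactInvariant φ K) (hh : 0 ≤ h) (k : ℕ) {a : Euc n} (ha : a ∈ K) {t : ℝ}
    (ht : 0 ≤ t) :
    IsGeomMean θ ((toMat (Φ t a))ᵀ * toMat (Φ t a)) (pullback φ Φ (iterMetric φ Φ θ h k) (h + t) a)
      (pullback φ Φ (iterMetric φ Φ θ h (k + 1)) t a) := by
  have h1 := (isGeomMean_iterMetric (θ := θ) hΦ hK hh k (hK.odeFlow_mem ha ht)).congr
    (hΦ.isUnit_det_toMat hK ha ht)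
  rwa [Matrix.mul_one, ← pullback_add hΦ hK ha hh ht] at h1

/-- The growth of `expansion` bounds all iterates; `θ (M h + D) ≤ D` says that the error `D`
survives one more step. -/
theorem log_det_one_add_pullback_iterMetric_le (hΦ : IsVariationalFlow φ K Φ)
    (hK : IsCompactInvariant φ K) (hh : 0 ≤ h) (h0 : 0 < θ) (h1 : θ < 1) {M C D : ℝ}
    (hMC : ∀ t, 0 ≤ t → ∀ a ∈ K, Real.log (expansion (Φ t a)) ≤ M * t + C)
    (hD : 0 ≤ D) (hθD : θ * (M * h + D) ≤ D) (k : ℕ) :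
    ∀ t, 0 ≤ t → ∀ a ∈ K, Real.log (1 + pullback φ Φ (iterMetric φ Φ θ h k) t a).det
      ≤ M * t + C + D := by
  induction k with
  | zero =>
    intro t ht a ha
    rw [pullback_iterMetric_zero]
    have h2 : Real.log (1 + (toMat (Φ t a))ᵀ * toMat (Φ t a)).det ≤ M * t + C := hMC t ht a ha
    linarith
  | succ k ih =>
    intro t ht a ha
    have hgm := isGeomMean_pullback_iterMetric (θ := θ) hΦ hK hh k ha ht
    have hA : 0 < (1 + (toMat (Φ t a))ᵀ * toMat (Φ t a)).det :=
      (posDef_one_add_transpose_mul_self _).det_pos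
    have hB := (PosDef.one.add hgm.posDef_right).det_pos
    have hC := (PosDef.one.add hgm.posDef).det_pos
    have h2 := Real.log_le_log hC (hgm.det_one_add_le h0 h1)
    rw [Real.log_mul (Real.rpow_pos_of_pos hA _).ne' (Real.rpow_pos_of_pos hB _).ne',
      Real.log_rpow hA, Real.log_rpow hB] at h2
    have h3 : Real.log (1 + (toMat (Φ t a))ᵀ * toMat (Φ t a)).det ≤ M * t + C := hMC t ht a ha
    have h4 := ih (h + t) (add_nonneg hh ht) a ha
    have h5 := mul_le_mul_of_nonneg_left h3 (sub_pos.2 h1).le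
    have h6 := mul_le_mul_of_nonneg_left h4 h0.le
    linarith

/-- The factor by which `Pₖ₊₁` can exceed `Pₖ` tends to `1`: one step of the iteration takes its
logarithm to the `θ`-fold. -/
theorem quadLe_iterMetric_succ (hΦ : IsVariationalFlow φ K Φ) (hK : IsCompactInvariant φ K)
    (hh : 0 ≤ h) (h0 : 0 < θ) (h1 : θ < 1) {L : NNReal} (hL : ∀ x ∈ K, ‖fderiv ℝ φ x‖ ≤ L)
    (k : ℕ) : ∀ a ∈ K, QuadLe (Real.exp (-(2 * L * h * θ ^ (k + 1))) • iterMetric φ Φ θ h (k + 1) a)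
      (iterMetric φ Φ θ h k a) := by
  have hexp : ∀ x : ℝ, (1 : ℝ) ^ (1 - θ) * Real.exp (-x) ^ θ = Real.exp (-(x * θ)) := fun x => by
    rw [Real.one_rpow, one_mul, ← Real.exp_mul, neg_mul]
  have hone : QuadLe ((1 : ℝ) • (1 : Matrix (Fin n) (Fin n) ℝ)) 1 := by
    rw [one_smul]; exact quadLe_refl _
  induction k with
  | zero =>
    intro a ha
    have hgm : IsGeomMean θ (1 : Matrix (Fin n) (Fin n) ℝ) 1 1 :=
      ⟨1, fun _ => 1, by simp, fun _ => one_pos, by simp, by simp, by simp⟩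
    have h2 := IsGeomMean.quadLe h0 h1 (isGeomMean_iterMetric hΦ hK hh 0 ha) hgm one_pos
      (Real.exp_pos (-(2 * L * h))) hone (fun v => by
        rw [pullback_iterMetric_zero, quad_smul, quad_one, quad_transpose_mul_self, toMat_mulVec,
          ← norm_sq_eq_dotProduct]
        have h3 := hΦ.norm_apply_le hK hL ha hh (WithLp.toLp 2 v)
        have h4 := pow_le_pow_left₀ (norm_nonneg _) h3 2
        have h5 : ‖WithLp.toLp 2 v‖ ^ 2 = v ⬝ᵥ v := norm_sq_eq_dotProduct (WithLp.toLp 2 v)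
        rw [mul_pow, h5, ← Real.exp_nat_mul] at h4
        calc Real.exp (-(2 * L * h)) * ‖Φ h a (WithLp.toLp 2 v)‖ ^ 2
            ≤ Real.exp (-(2 * L * h)) * (Real.exp ((2 : ℕ) * (L * h)) * (v ⬝ᵥ v)) :=
              mul_le_mul_of_nonneg_left h4 (Real.exp_pos _).le
          _ = v ⬝ᵥ v := by
              rw [← mul_assoc, ← Real.exp_add]
              have : -(2 * L * h) + (2 : ℕ) * (L * h) = 0 := by push_cast; ring
              rw [this, Real.exp_zero, one_mul])
    rw [hexp] at h2
    rwa [zero_add, pow_one]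
  | succ k ih =>
    intro a ha
    have h2 := IsGeomMean.quadLe h0 h1 (isGeomMean_iterMetric hΦ hK hh (k + 1) ha)
      (isGeomMean_iterMetric hΦ hK hh k ha) one_pos
      (Real.exp_pos (-(2 * L * h * θ ^ (k + 1)))) hone (by
        have h3 := (ih _ (hK.odeFlow_mem ha hh)).congr_left (toMat (Φ h a))
        rwa [Matrix.mul_smul, Matrix.smul_mul] at h3)
    rw [hexp] at h2
    rwa [pow_succ θ (k + 1), ← mul_assoc]

/-- The pullback of an iterate decreases at most at the exponential rate `2 L`. -/
theorem quadLe_pullback_iterMetric (hΦ : IsVariationalFlow φ K Φ) (hK : IsCompactInvariant φ K)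
    (hh : 0 ≤ h) (h0 : 0 < θ) (h1 : θ < 1) {L : NNReal} (hL : ∀ x ∈ K, ‖fderiv ℝ φ x‖ ≤ L)
    {s : ℝ} (hs : 0 ≤ s) (k : ℕ) :
    ∀ a ∈ K, QuadLe (Real.exp (-(2 * L * s)) • iterMetric φ Φ θ h k a)
      (pullback φ Φ (iterMetric φ Φ θ h k) s a) := by
  have hbase : ∀ a ∈ K, QuadLe (Real.exp (-(2 * L * s)) • 1)
      ((toMat (Φ s a))ᵀ * toMat (Φ s a)) := fun a ha v => by
    rw [quad_smul, quad_one, quad_transpose_mul_self, toMat_mulVec, ← norm_sq_eq_dotProduct,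
      ← norm_sq_eq_dotProduct]
    exact hΦ.le_norm_apply hK hL ha hs _
  induction k with
  | zero =>
    intro a ha
    rw [pullback_iterMetric_zero]
    exact hbase a ha
  | succ k ih =>
    intro a ha
    have h2 := IsGeomMean.quadLe h0 h1 (isGeomMean_iterMetric hΦ hK hh k ha)
      (isGeomMean_pullback_iterMetric hΦ hK hh k ha hs) (Real.exp_pos (-(2 * L * s)))
      (Real.exp_pos (-(2 * L * s))) (hbase a ha) (by
        have h3 := (ih _ (hK.odeFlow_mem ha hh)).congr_left (toMat (Φ h a))
        rwa [Matrix.mul_smul, Matrix.smul_mul, ← pullback_add hΦ hK ha hs hh, add_comm s] at h3)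
    rwa [← Real.rpow_add (Real.exp_pos _), sub_add_cancel, Real.rpow_one] at h2

end Iterates

/-! ### The pencil of the averaged metric -/

section Pencil

variable {n : ℕ}

theorem trace_inv_congr_diagonal {H : Matrix (Fin n) (Fin n) ℝ} (hH : IsUnit H.det)
    {d : Fin n → ℝ} (hd : ∀ i, 0 < d i) (Y : Matrix (Fin n) (Fin n) ℝ) :
    ((Hᵀ * diagonal d * H)⁻¹ * (Hᵀ * Y * H)).trace = ∑ i, Y i i / d i := by
  have hT : IsUnit Hᵀ.det := by rwa [det_transpose]
  have hD : (diagonal d)⁻¹ = diagonal fun i => (d i)⁻¹ := by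
    refine inv_eq_right_inv ?_
    rw [diagonal_mul_diagonal, ← diagonal_one]
    congr 1
    funext i
    exact mul_inv_cancel₀ (hd i).ne'
  have e : (Hᵀ * diagonal d * H)⁻¹ * (Hᵀ * Y * H) = H⁻¹ * ((diagonal d)⁻¹ * Y * H) := by
    rw [Matrix.mul_inv_rev, Matrix.mul_inv_rev]
    calc H⁻¹ * ((diagonal d)⁻¹ * Hᵀ⁻¹) * (Hᵀ * Y * H)
        = H⁻¹ * ((diagonal d)⁻¹ * (Hᵀ⁻¹ * Hᵀ) * Y * H) := by simp only [Matrix.mul_assoc]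
      _ = _ := by rw [nonsing_inv_mul _ hT, Matrix.mul_one]
  rw [e, trace_mul_comm, Matrix.mul_assoc, mul_nonsing_inv _ hH, Matrix.mul_one, hD, trace]
  refine Finset.sum_congr rfl fun i _ => ?_
  rw [diag_apply, diagonal_mul, div_eq_inv_mul]

theorem trace_inv_mul_le_of_quadLe {P R Z : Matrix (Fin n) (Fin n) ℝ} (hP : P.PosDef)
    (hR : R.IsSymm) (hZ : Z.PosSemidef) {c : ℝ} (hc : 0 < c) (h : QuadLe (c • P) R) :
    (R⁻¹ * Z).trace ≤ c⁻¹ * (P⁻¹ * Z).trace := by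
  obtain ⟨H, d, hH, rfl, rfl⟩ := exists_simultaneous_diag hP hR
  have hH1 : H⁻¹ * H = 1 := nonsing_inv_mul _ hH
  have hd : ∀ i, c ≤ d i := fun i => by
    have h2 := h (H⁻¹ *ᵥ Pi.single i 1)
    have h3 := quad_at_inv_single hH 1 i
    rw [Matrix.mul_one] at h3
    rw [quad_at_inv_single hH, quad_smul, h3, one_apply_eq, diagonal_apply_eq, mul_one] at h2
    exact h2
  have e : Z = Hᵀ * (H⁻¹ᵀ * Z * H⁻¹) * H := by
    calc Z = (H⁻¹ * H)ᵀ * Z * (H⁻¹ * H) := by rw [hH1]; simp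
      _ = _ := by rw [transpose_mul]; simp only [Matrix.mul_assoc]
  have hY := posSemidef_congr hZ H⁻¹
  rw [e, trace_inv_congr_diagonal hH fun i => hc.trans_le (hd i), trace_inv_mul_congr hH, trace,
    Finset.mul_sum]
  refine Finset.sum_le_sum fun i _ => ?_
  rw [div_eq_inv_mul]
  exact mul_le_mul_of_nonneg_right (inv_anti₀ hc (hd i)) hY.diag_nonneg

/-- The growth bound of one step of the iteration. If `P = Q ^ θ` with `θ = 1 - κ h`, then
`(e ^ (κ h²) Q - P) / h` has, relative to `P`, the eigenvalues
`(exp (κ h² + κ h log d) - 1) / h` with the eigenvalues `d` of `Q`, and the sum of their positive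
parts is, up to a factor and a summand that become negligible for small `h`, at most
`κ log det (1 + Q)`. -/
theorem pencilSum_le_of_isGeomMean {P Q R S : Matrix (Fin n) (Fin n) ℝ} {κ h B c : ℝ}
    (hκ : 0 < κ) (hh : 0 < h) (hgm : IsGeomMean (1 - κ * h) 1 Q P)
    (hQ : Real.log (1 + Q).det ≤ B) (hc : 0 < c) (hR : R.IsSymm) (hPR : QuadLe (c • P) R)
    (hS : S.IsSymm) (hSQ : QuadLe S (h⁻¹ • (Real.exp (κ * h ^ 2) • Q - P))) :
    pencilSum S R ≤ c⁻¹ * (Real.exp (κ * h ^ 2 + κ * h * B) * (n * (κ * h) + κ * B)) := by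
  have hP := hgm.posDef
  have hRd : R.PosDef := QuadLe.posDef (hP.smul hc) hPR hR
  obtain ⟨H, d, hH, hd, hone, rfl, rfl⟩ := hgm
  set θ := 1 - κ * h with hθ
  set z : Fin n → ℝ := fun i => max 0 (h⁻¹ * (Real.exp (κ * h ^ 2) * d i - d i ^ θ)) with hz
  have hZ : (Hᵀ * diagonal z * H).PosSemidef :=
    posSemidef_congr (PosSemidef.diagonal fun i => le_max_left _ _) H
  have hSZ : QuadLe S (Hᵀ * diagonal z * H) := hSQ.trans fun v => by
    rw [quad_smul, quad_sub, quad_smul, quad_congr, quad_congr, quad_congr, quad_diagonal,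
      quad_diagonal, quad_diagonal, Finset.mul_sum, ← Finset.sum_sub_distrib, Finset.mul_sum]
    refine Finset.sum_le_sum fun i _ => ?_
    have := mul_le_mul_of_nonneg_right
      (le_max_right 0 (h⁻¹ * (Real.exp (κ * h ^ 2) * d i - d i ^ θ))) (sq_nonneg ((H *ᵥ v) i))
    simp only [hz]
    linarith
  refine (pencilSum_le_trace hRd hS hZ hSZ).trans
    ((trace_inv_mul_le_of_quadLe hP hR hZ hc hPR).trans
      (mul_le_mul_of_nonneg_left ?_ (inv_pos.2 hc).le))
  rw [trace_inv_congr_diagonal hH fun i => Real.rpow_pos_of_pos (hd i) _]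
  simp only [diagonal_apply_eq]
  have hl : ∀ i, 0 ≤ Real.log (1 + d i) := fun i => Real.log_nonneg (by linarith [hd i])
  have hsum : ∑ i, Real.log (1 + d i) ≤ B := by
    have e1 : 1 + Hᵀ * diagonal d * H = Hᵀ * diagonal (fun i => 1 + d i) * H := by
      have : diagonal (fun i => 1 + d i) = 1 + diagonal d := by
        rw [← diagonal_one, diagonal_add]
      rw [this, Matrix.mul_add, Matrix.add_mul, Matrix.mul_one, ← hone]
    have e2 : (Hᵀ).det * H.det = 1 := by rw [← det_mul, ← hone, det_one]
    have e3 : (1 + Hᵀ * diagonal d * H).det = ∏ i, (1 + d i) := by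
      rw [e1, det_mul, det_mul, mul_right_comm, e2, one_mul, det_diagonal]
    rwa [e3, Real.log_prod fun i _ => by linarith [hd i]] at hQ
  have hlB : ∀ i, Real.log (1 + d i) ≤ B := fun i =>
    (Finset.single_le_sum (f := fun i => Real.log (1 + d i)) (fun j _ => hl j)
      (Finset.mem_univ i)).trans hsum
  have hterm : ∀ i, z i / d i ^ θ
      ≤ Real.exp (κ * h ^ 2 + κ * h * B) * (κ * h + κ * Real.log (1 + d i)) := fun i => by
    have hp := Real.rpow_pos_of_pos (hd i) θ
    have hx0 : 0 ≤ κ * h + κ * Real.log (1 + d i) := by have := hl i; positivity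
    rw [div_le_iff₀ hp]
    simp only [hz]
    refine max_le (by positivity) ?_
    have e1 : Real.exp (κ * h ^ 2) * d i - d i ^ θ
        = (Real.exp (κ * h ^ 2 + κ * h * Real.log (d i)) - 1) * d i ^ θ := by
      have : d i = Real.exp (κ * h * Real.log (d i)) * d i ^ θ := by
        rw [mul_comm (κ * h), ← Real.rpow_def_of_pos (hd i), ← Real.rpow_add (hd i), hθ,
          add_sub_cancel, Real.rpow_one]
      rw [Real.exp_add, sub_mul, one_mul, mul_assoc, ← this]
    rw [e1, ← mul_assoc]
    refine mul_le_mul_of_nonneg_right ?_ hp.le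
    set y := κ * h ^ 2 + κ * h * Real.log (1 + d i) with hy
    have hκh : 0 < κ * h := mul_pos hκ hh
    have hy0 : 0 ≤ y := by have := hl i; positivity
    have h1 : κ * h ^ 2 + κ * h * Real.log (d i) ≤ y := by
      have : Real.log (d i) ≤ Real.log (1 + d i) := Real.log_le_log (hd i) (by linarith)
      have := mul_le_mul_of_nonneg_left this hκh.le
      linarith
    have h2 : y ≤ κ * h ^ 2 + κ * h * B := by
      have := mul_le_mul_of_nonneg_left (hlB i) hκh.le
      linarith
    -- `e ^ y - 1 ≤ y e ^ y`
    have h3 : Real.exp y - 1 ≤ Real.exp y * y := by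
      have h4 := Real.add_one_le_exp (-y)
      have h5 := mul_le_mul_of_nonneg_left h4 (Real.exp_pos y).le
      rw [← Real.exp_add, add_neg_cancel, Real.exp_zero] at h5
      linarith
    have h6 : h⁻¹ * y = κ * h + κ * Real.log (1 + d i) := by
      rw [hy]; field_simp
    rw [← h6]
    calc h⁻¹ * (Real.exp (κ * h ^ 2 + κ * h * Real.log (d i)) - 1)
        ≤ h⁻¹ * (Real.exp y * y) := by
          refine mul_le_mul_of_nonneg_left ?_ (inv_pos.2 hh).le
          linarith [Real.exp_le_exp.2 h1]
      _ ≤ h⁻¹ * (Real.exp (κ * h ^ 2 + κ * h * B) * y) := by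
          refine mul_le_mul_of_nonneg_left ?_ (inv_pos.2 hh).le
          exact mul_le_mul_of_nonneg_right (Real.exp_le_exp.2 h2) hy0
      _ = _ := by ring
  refine (Finset.sum_le_sum fun i _ => hterm i).trans ?_
  rw [← Finset.mul_sum, Finset.sum_add_distrib, ← Finset.mul_sum, ← Finset.mul_sum,
    Finset.sum_const, Finset.card_univ, Fintype.card_fin, nsmul_eq_mul]
  have := mul_le_mul_of_nonneg_left hsum hκ.le
  exact mul_le_mul_of_nonneg_left (by linarith) (Real.exp_pos _).le

theorem continuousAt_inv_of_isUnit_det {A : Matrix (Fin n) (Fin n) ℝ} (hA : IsUnit A.det) :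
    ContinuousAt (fun B : Matrix (Fin n) (Fin n) ℝ => B⁻¹) A := by
  simp only [inv_def, Ring.inverse_eq_inv']
  exact ((continuous_id.matrix_det.continuousAt (x := A)).inv₀ hA.ne_zero).smul
    continuous_id.matrix_adjugate.continuousAt

theorem upperSemicontinuousOn_pencilSum {X : Type*} [TopologicalSpace X] {K : Set X}
    {S P : X → Matrix (Fin n) (Fin n) ℝ} (hSc : ContinuousOn S K) (hPc : ContinuousOn P K)
    (hS : ∀ x ∈ K, (S x).IsSymm) (hP : ∀ x ∈ K, (P x).PosDef) :
    UpperSemicontinuousOn (fun x => pencilSum (S x) (P x)) K := by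
  intro x₀ hx₀ y hy
  obtain ⟨Z, hZ1, hZ2, hZ3⟩ := exists_posSemidef_trace_eq_pencilSum (hP x₀ hx₀) (hS x₀ hx₀)
  -- `Z` plus a small multiple of the identity is a majorant of `S x` for `x` near `x₀`
  have hc : ContinuousWithinAt (fun x => ((P x)⁻¹ * (Z + absSum (S x - S x₀) • 1)).trace) K x₀ := by
    have h1 : ContinuousWithinAt (fun x => (P x)⁻¹) K x₀ :=
      (continuousAt_inv_of_isUnit_det (hP x₀ hx₀).det_pos.ne'.isUnit).comp_continuousWithinAt
        (hPc x₀ hx₀)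
    have h2 : ContinuousWithinAt (fun x => Z + absSum (S x - S x₀) • (1 : Matrix (Fin n) (Fin n) ℝ))
        K x₀ :=
      continuousWithinAt_const.add ((continuous_absSum.continuousAt.comp_continuousWithinAt
        ((hSc x₀ hx₀).sub continuousWithinAt_const)).smul continuousWithinAt_const)
    exact (continuous_id.matrix_trace.continuousAt).comp_continuousWithinAt (h1.mul h2)
  have h0 : ((P x₀)⁻¹ * (Z + absSum (S x₀ - S x₀) • 1)).trace < y := by
    have : absSum (S x₀ - S x₀) = 0 := by simp [absSum]
    rwa [this, zero_smul, add_zero, hZ3]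
  filter_upwards [hc.tendsto.eventually_lt_const h0, self_mem_nhdsWithin] with x hx hxK
  refine lt_of_le_of_lt (pencilSum_le_trace (hP x hxK) (hS x hxK) ?_ fun v => ?_) hx
  · exact hZ1.add (PosSemidef.one.smul (absSum_nonneg _))
  · have h1 := (abs_le.1 (abs_quad_le (S x - S x₀) v)).2
    have h2 := hZ2 v
    rw [quad_sub] at h1
    rw [quad_add, quad_smul, quad_one]
    linarith

end Pencil

end RestorationEntropy

/-! ### Averaging a metric along the flow -/

namespace RestorationEntropy

section Average

open scoped Matrix.Norms.Elementwise

variable {n : ℕ} {φ : Euc n → Euc n} {K : Set (Euc n)}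
  {Φ : ℝ → Euc n → Euc n →L[ℝ] Euc n} {P : Euc n → Matrix (Fin n) (Fin n) ℝ} {h : ℝ}

theorem linearMap_intervalIntegral {E : Type*} [NormedAddCommGroup E] [NormedSpace ℝ E]
    [CompleteSpace E] (f : Matrix (Fin n) (Fin n) ℝ →ₗ[ℝ] E) {F : ℝ → Matrix (Fin n) (Fin n) ℝ}
    {a b : ℝ} (hF : ContinuousOn F (uIcc a b)) :
    f (∫ s in a..b, F s) = ∫ s in a..b, f (F s) :=
  ((LinearMap.toContinuousLinearMap f).intervalIntegral_comp_comm hF.intervalIntegrable).symm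

/-- The congruence `A ↦ Gᵀ A G` as a linear map. -/
def congrLinearMap (G : Matrix (Fin n) (Fin n) ℝ) :
    Matrix (Fin n) (Fin n) ℝ →ₗ[ℝ] Matrix (Fin n) (Fin n) ℝ where
  toFun A := Gᵀ * A * G
  map_add' A B := by rw [Matrix.mul_add, Matrix.add_mul]
  map_smul' c A := by rw [Matrix.mul_smul, Matrix.smul_mul, RingHom.id_apply]

/-- The value of a quadratic form at `v`, as a linear map. -/
def quadLinearMap (v : Fin n → ℝ) : Matrix (Fin n) (Fin n) ℝ →ₗ[ℝ] ℝ where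
  toFun A := v ⬝ᵥ A *ᵥ v
  map_add' A B := quad_add A B v
  map_smul' c A := quad_smul c A v

/-- The mean over `s ∈ [0, h]` of the pulled back metrics `Φ(s)ᵀ P Φ(s)`. -/
noncomputable def averageMetric (φ : Euc n → Euc n) (Φ : ℝ → Euc n → Euc n →L[ℝ] Euc n)
    (P : Euc n → Matrix (Fin n) (Fin n) ℝ) (h : ℝ) (a : Euc n) : Matrix (Fin n) (Fin n) ℝ :=
  h⁻¹ • ∫ s in (0 : ℝ)..h, pullback φ Φ P s a

/-- The orbital derivative of `averageMetric`. -/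
noncomputable def averageDeriv (φ : Euc n → Euc n) (Φ : ℝ → Euc n → Euc n →L[ℝ] Euc n)
    (P : Euc n → Matrix (Fin n) (Fin n) ℝ) (h : ℝ) (a : Euc n) : Matrix (Fin n) (Fin n) ℝ :=
  h⁻¹ • (pullback φ Φ P h a - P a) - (averageMetric φ Φ P h a * jacobianMatrix φ a
    + (jacobianMatrix φ a)ᵀ * averageMetric φ Φ P h a)

theorem continuousOn_pullback_uIcc (hΦ : IsVariationalFlow φ K Φ) (hK : IsCompactInvariant φ K)
    (hP : ContinuousOn P K) (hh : 0 ≤ h) {a : Euc n} (ha : a ∈ K) :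
    ContinuousOn (fun s => pullback φ Φ P s a) (uIcc 0 h) := by
  rw [uIcc_of_le hh]
  exact (continuousOn_pullback_time hΦ hK hP ha).mono Icc_subset_Ici_self

theorem isSymm_averageMetric (hΦ : IsVariationalFlow φ K Φ) (hK : IsCompactInvariant φ K)
    (hP : ContinuousOn P K) (hPd : ∀ a ∈ K, (P a).PosDef) (hh : 0 ≤ h) {a : Euc n} (ha : a ∈ K) :
    (averageMetric φ Φ P h a).IsSymm := by
  have h1 := linearMap_intervalIntegral
    (transposeLinearEquiv (Fin n) (Fin n) ℝ ℝ).toLinearMap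
    (continuousOn_pullback_uIcc hΦ hK hP hh ha)
  have h2 : (∫ s in (0 : ℝ)..h, pullback φ Φ P s a)ᵀ = ∫ s in (0 : ℝ)..h, pullback φ Φ P s a := by
    refine h1.trans (intervalIntegral.integral_congr fun s hs => ?_)
    rw [uIcc_of_le hh] at hs
    exact (posDef_iff_quad.1 (posDef_pullback hΦ hK hPd ha hs.1)).1
  rw [IsSymm, averageMetric, transpose_smul, h2]

/-- A lower bound for the pulled back metrics passes to their mean. -/
theorem quadLe_averageMetric (hΦ : IsVariationalFlow φ K Φ) (hK : IsCompactInvariant φ K)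
    (hP : ContinuousOn P K) (hh : 0 < h) {a : Euc n} (ha : a ∈ K) {A : Matrix (Fin n) (Fin n) ℝ}
    (hA : ∀ s ∈ Icc 0 h, QuadLe A (pullback φ Φ P s a)) : QuadLe A (averageMetric φ Φ P h a) := by
  intro v
  have hc := continuousOn_pullback_uIcc hΦ hK hP hh.le ha
  have h1 : v ⬝ᵥ (∫ s in (0 : ℝ)..h, pullback φ Φ P s a) *ᵥ v
      = ∫ s in (0 : ℝ)..h, v ⬝ᵥ pullback φ Φ P s a *ᵥ v :=
    linearMap_intervalIntegral (quadLinearMap v) hc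
  have h2 : ContinuousOn (fun s => v ⬝ᵥ pullback φ Φ P s a *ᵥ v) (uIcc 0 h) :=
    (quadLinearMap v).continuous_of_finiteDimensional.comp_continuousOn hc
  have h3 : ∫ s in (0 : ℝ)..h, v ⬝ᵥ A *ᵥ v ≤ ∫ s in (0 : ℝ)..h, v ⬝ᵥ pullback φ Φ P s a *ᵥ v :=
    intervalIntegral.integral_mono_on hh.le intervalIntegrable_const h2.intervalIntegrable
      fun s hs => hA s hs v
  rw [intervalIntegral.integral_const, sub_zero, smul_eq_mul] at h3
  rw [averageMetric, quad_smul, h1, inv_mul_eq_div, le_div_iff₀ hh, mul_comm]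
  exact h3

theorem continuousOn_averageMetric (hΦ : IsVariationalFlow φ K Φ) (hK : IsCompactInvariant φ K)
    (hP : ContinuousOn P K) (hh : 0 ≤ h) : ContinuousOn (averageMetric φ Φ P h) K := by
  rw [continuousOn_iff_continuous_domRestrict]
  have h1 : Continuous (Function.uncurry fun (a : K) (s : ℝ) => pullback φ Φ P (max s 0) a) :=
    (continuousOn_pullback hΦ hK hP).comp_continuous
      (f := fun p : K × ℝ => (max p.2 0, (p.1 : Euc n))) (by fun_prop)
      fun p => ⟨mem_Ici.2 (le_max_right _ _), p.1.2⟩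
  refine ((intervalIntegral.continuous_parametric_intervalIntegral_of_continuous'
    (μ := MeasureTheory.volume) h1 0 h).const_smul h⁻¹).congr fun a => ?_
  rw [Pi.smul_apply, domRestrict_apply, averageMetric]
  congr 1
  refine intervalIntegral.integral_congr fun s hs => ?_
  rw [uIcc_of_le hh] at hs
  simp only [max_eq_left hs.1]

theorem continuousOn_averageDeriv (hΦ : IsVariationalFlow φ K Φ) (hK : IsCompactInvariant φ K)
    (hP : ContinuousOn P K) (hh : 0 ≤ h) : ContinuousOn (averageDeriv φ Φ P h) K := by
  have hJ : Continuous (jacobianMatrix φ) := by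
    simp only [funext (jacobianMatrix_eq φ)]
    exact continuous_toMat.comp (hK.contDiff.continuous_fderiv one_ne_zero)
  have hA := continuousOn_averageMetric hΦ hK hP hh
  exact (((continuousOn_pullback_space hΦ hK hP hh).sub hP).const_smul h⁻¹).sub
    ((hA.mul hJ.continuousOn).add (hJ.matrix_transpose.continuousOn.mul hA))

/-- Along a trajectory the averaged metric is, up to a congruence, a mean over a moving window of
the pullbacks to the initial point. The maximum extends the integrand to negative times. -/
theorem averageMetric_odeFlow (hΦ : IsVariationalFlow φ K Φ) (hK : IsCompactInvariant φ K)
    (hP : ContinuousOn P K) (hh : 0 ≤ h) {a : Euc n} (ha : a ∈ K) {t : ℝ} (ht : 0 ≤ t) :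
    averageMetric φ Φ P h (odeFlow φ t a) = ((toMat (Φ t a))⁻¹)ᵀ
      * (h⁻¹ • ∫ s in t..t + h, pullback φ Φ P (max s 0) a) * (toMat (Φ t a))⁻¹ := by
  have hat := hK.odeFlow_mem ha ht
  have hu := mul_nonsing_inv _ (hΦ.isUnit_det_toMat hK ha ht)
  have h1 : (toMat (Φ t a))ᵀ * (∫ s in (0 : ℝ)..h, pullback φ Φ P s (odeFlow φ t a))
      * toMat (Φ t a) = ∫ s in t..t + h, pullback φ Φ P (max s 0) a := by
    refine (linearMap_intervalIntegral (congrLinearMap (toMat (Φ t a)))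
      (continuousOn_pullback_uIcc hΦ hK hP hh hat)).trans ?_
    have h2 := intervalIntegral.integral_comp_add_right (a := 0) (b := h)
      (fun s => pullback φ Φ P (max s 0) a) t
    rw [zero_add, add_comm h] at h2
    rw [← h2]
    refine intervalIntegral.integral_congr fun s hs => ?_
    rw [uIcc_of_le hh] at hs
    simp only [max_eq_left (add_nonneg hs.1 ht), pullback_add hΦ hK ha hs.1 ht]
    rfl
  rw [← h1, averageMetric, Matrix.mul_smul, Matrix.smul_mul]
  congr 1
  calc _ = (toMat (Φ t a) * (toMat (Φ t a))⁻¹)ᵀ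
        * (∫ s in (0 : ℝ)..h, pullback φ Φ P s (odeFlow φ t a))
        * (toMat (Φ t a) * (toMat (Φ t a))⁻¹) := by rw [hu]; simp
    _ = _ := by rw [transpose_mul]; simp only [Matrix.mul_assoc]

theorem tendsto_slope_averageMetric (hΦ : IsVariationalFlow φ K Φ) (hK : IsCompactInvariant φ K)
    (hP : ContinuousOn P K) (hh : 0 ≤ h) {a : Euc n} (ha : a ∈ K) :
    Tendsto (fun τ : ℝ => τ⁻¹ • (averageMetric φ Φ P h (odeFlow φ τ a) - averageMetric φ Φ P h a))
      (𝓝[>] 0) (𝓝 (averageDeriv φ Φ P h a)) := by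
  set F : ℝ → Matrix (Fin n) (Fin n) ℝ := fun s => pullback φ Φ P (max s 0) a with hF
  have hFc : Continuous F := (continuousOn_pullback_time hΦ hK hP ha).comp_continuous
    (f := fun s : ℝ => max s 0) (by fun_prop) fun s => le_max_right s 0
  set I : ℝ → Matrix (Fin n) (Fin n) ℝ := fun t => h⁻¹ • ∫ s in t..t + h, F s with hI
  set G : ℝ → Matrix (Fin n) (Fin n) ℝ := fun t => (toMat (Φ t a))⁻¹ with hG
  have hM0 : toMat (Φ 0 a) = 1 := by rw [hΦ.zero a ha, toMat_one]
  have hG0 : G 0 = 1 := by simp only [hG, hM0, inv_one]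
  have hI0 : I 0 = averageMetric φ Φ P h a := by
    have := averageMetric_odeFlow hΦ hK hP hh ha le_rfl
    rw [hK.odeFlow_zero ha, hM0] at this
    simpa [hI, hF] using this.symm
  have hId : HasDerivAt I (h⁻¹ • (F h - F 0)) 0 := by
    have h1 : ∀ b, HasDerivAt (fun t => ∫ s in (0 : ℝ)..t, F s) (F b) b := fun b =>
      (hFc.integral_hasStrictDerivAt 0 b).hasDerivAt
    have h2 := (HasDerivAt.comp_add_const 0 h (h1 (0 + h))).sub (h1 0)
    rw [zero_add] at h2
    refine (h2.const_smul h⁻¹).congr_of_eventuallyEq (Eventually.of_forall fun t => ?_)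
    simp only [hI]
    congr 1
    exact (intervalIntegral.integral_interval_sub_left (hFc.intervalIntegrable _ _)
      (hFc.intervalIntegrable _ _)).symm
  have hIs : Tendsto (fun z => (z - 0)⁻¹ • (I z - I 0)) (𝓝[>] 0) (𝓝 (h⁻¹ • (F h - F 0))) := by
    refine (hasDerivAt_iff_tendsto_slope.1 hId |>.mono_left
      (nhdsWithin_mono 0 fun z hz => ne_of_gt hz)).congr fun z => ?_
    rw [slope_def_module]
  have hMc : Tendsto (fun z => toMat (Φ z a)) (𝓝[>] 0) (𝓝 1) := by
    have := (continuous_toMat.comp_continuousOn (hΦ.continuousOn_time ha)) 0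
      (mem_Ici.2 le_rfl)
    have h2 := this.tendsto.mono_left (nhdsWithin_mono 0 Ioi_subset_Ici_self)
    simpa [hM0, Function.comp_def] using h2
  have hGc : Tendsto G (𝓝[>] 0) (𝓝 (G 0)) := by
    rw [hG0]
    have h1 := (continuousAt_inv_of_isUnit_det (A := (1 : Matrix (Fin n) (Fin n) ℝ))
      (by simp)).tendsto.comp hMc
    rwa [inv_one] at h1
  -- the derivative of the inverse: `M⁻¹ - 1 = - M⁻¹ (M - 1)`
  have hGs : Tendsto (fun z => (z - 0)⁻¹ • (G z - G 0)) (𝓝[>] 0) (𝓝 (-jacobianMatrix φ a)) := by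
    have h1 := tendsto_slope_toMat hΦ ha le_rfl
    rw [hM0, hK.odeFlow_zero ha, Matrix.mul_one] at h1
    have h2 := (hGc.mul h1).neg
    rw [hG0, Matrix.one_mul] at h2
    refine h2.congr' ?_
    filter_upwards [self_mem_nhdsWithin] with z hz
    have hu := nonsing_inv_mul _ (hΦ.isUnit_det_toMat hK ha (le_of_lt (mem_Ioi.1 hz)))
    rw [hG0, Matrix.mul_smul, Matrix.mul_sub, Matrix.mul_one, ← smul_neg, neg_sub]
    simp only [hG, hu]
  have hmain := tendsto_slope_congr hGs hGc hIs
    (hId.continuousAt.tendsto.mono_left nhdsWithin_le_nhds)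
  rw [hG0, hI0] at hmain
  have hF0 : F 0 = P a := by simp only [hF, max_self, pullback_zero hΦ hK ha]
  have hFh : F h = pullback φ Φ P h a := by simp only [hF, max_eq_left hh]
  have hd : averageDeriv φ Φ P h a = (-jacobianMatrix φ a)ᵀ * averageMetric φ Φ P h a * 1
      + 1ᵀ * (h⁻¹ • (F h - F 0)) * 1 + 1ᵀ * averageMetric φ Φ P h a * -jacobianMatrix φ a := by
    rw [averageDeriv, hF0, hFh, transpose_one, Matrix.one_mul, Matrix.one_mul, Matrix.mul_one,
      Matrix.mul_one, transpose_neg, Matrix.neg_mul, Matrix.mul_neg]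
    abel
  rw [hd]
  refine hmain.congr' ?_
  filter_upwards [self_mem_nhdsWithin] with z hz
  rw [averageMetric_odeFlow hΦ hK hP hh ha (le_of_lt (mem_Ioi.1 hz)), sub_zero]
  simp only [transpose_one, Matrix.one_mul, Matrix.mul_one, hG, hI, hF]

theorem isMetric_averageMetric (hΦ : IsVariationalFlow φ K Φ) (hK : IsCompactInvariant φ K)
    (hP : ContinuousOn P K) (hh : 0 ≤ h) (hd : ∀ a ∈ K, (averageMetric φ Φ P h a).PosDef) :
    IsMetricWithOrbitalDeriv φ K (averageMetric φ Φ P h) (averageDeriv φ Φ P h) where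
  posDef := hd
  continuousOn := continuousOn_averageMetric hΦ hK hP hh
  hasOrbitalDeriv _ ha := tendsto_slope_averageMetric hΦ hK hP hh ha
  orbitallyContinuous _ ha := (continuousOn_averageDeriv hΦ hK hP hh).comp
    (hK.continuousOn_odeFlow_time ha) fun _ ht => hK.odeFlow_mem ha ht

theorem orbitalForm_averageMetric {a : Euc n} (hs : (averageMetric φ Φ P h a).IsSymm) :
    orbitalForm φ (averageMetric φ Φ P h) (averageDeriv φ Φ P h) a
      = h⁻¹ • (pullback φ Φ P h a - P a) := by
  rw [orbitalForm_eq hs, averageDeriv, add_sub_cancel]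

end Average

/-! ### Almost optimal metrics -/

section Optimal

variable {n : ℕ} {φ : Euc n → Euc n} {K : Set (Euc n)} {Φ : ℝ → Euc n → Euc n →L[ℝ] Euc n}

/-- If `expansion` grows at most with the exponential rate `M`, then for every `m > M` there is a
metric for which the positive parts of the roots of the pencil add up to at most `m`. -/
theorem exists_metric_posRootSum_le (hΦ : IsVariationalFlow φ K Φ) (hK : IsCompactInvariant φ K)
    (hne : K.Nonempty) {M C m : ℝ} (hM0 : 0 ≤ M) (hC0 : 0 ≤ C) (hm : M < m)
    (hMC : ∀ t, 0 ≤ t → ∀ a ∈ K, Real.log (expansion (Φ t a)) ≤ M * t + C) :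
    ∃ P Pdot, IsMetricWithOrbitalDeriv φ K P Pdot ∧
      ∃ m', IsGreatest (posRootSum φ P Pdot '' K) m' ∧ m' ≤ m := by
  obtain ⟨L, -, hL⟩ := hK.exists_lipschitz
  -- `κ` is so small that `M + κ C < m`
  obtain ⟨κ, hκ, hκC⟩ : ∃ κ : ℝ, 0 < κ ∧ M + κ * C < m := by
    refine ⟨(m - M) / (C + 1), div_pos (sub_pos.2 hm) (by linarith), ?_⟩
    have : (m - M) / (C + 1) * C < m - M := by
      rw [div_mul_eq_mul_div, div_lt_iff₀ (by linarith)]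
      linarith
    linarith
  -- the bound for `log det (1 + Q)` that the iteration preserves
  set B := M / κ + C with hB
  have hκB : κ * B = M + κ * C := by rw [hB]; field_simp
  obtain ⟨h, hh, hκh, hbound⟩ : ∃ h : ℝ, 0 < h ∧ κ * h < 1 ∧ (Real.exp (-(2 * L * h)))⁻¹
      * (Real.exp (κ * h ^ 2 + κ * h * B) * (n * (κ * h) + κ * B)) < m := by
    have h1 : Continuous fun h : ℝ => (Real.exp (-(2 * L * h)))⁻¹
        * (Real.exp (κ * h ^ 2 + κ * h * B) * (n * (κ * h) + κ * B)) :=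
      Continuous.mul (Continuous.inv₀ (by fun_prop) fun _ => (Real.exp_pos _).ne') (by fun_prop)
    have h2 : Continuous fun h : ℝ => κ * h := by fun_prop
    have e1 := (h1.tendsto 0).eventually_lt_const (u := m) (by simpa [hκB] using hκC)
    have e2 := (h2.tendsto 0).eventually_lt_const (u := 1) (by simp)
    obtain ⟨h, ⟨h3, h4⟩, h5⟩ := (((e1.and e2).filter_mono nhdsWithin_le_nhds).and
      (self_mem_nhdsWithin (s := Ioi (0 : ℝ)))).exists
    exact ⟨h, h5, h4, h3⟩
  set θ := 1 - κ * h with hθ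
  have h0 : 0 < θ := sub_pos.2 hκh
  have h1 : θ < 1 := by have := mul_pos hκ hh; linarith
  -- an iterate that hardly exceeds its predecessor
  obtain ⟨k, hk⟩ : ∃ k : ℕ, 2 * L * h * θ ^ (k + 1) ≤ κ * h ^ 2 := by
    have h2 : Tendsto (fun k : ℕ => 2 * L * h * θ ^ (k + 1)) atTop (𝓝 (2 * L * h * 0)) :=
      ((tendsto_pow_atTop_nhds_zero_of_lt_one h0.le h1).comp (tendsto_add_atTop_nat 1)).const_mul _
    rw [mul_zero] at h2
    obtain ⟨k, hk⟩ := (h2.eventually_lt_const (u := κ * h ^ 2) (by positivity)).exists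
    exact ⟨k, hk.le⟩
  set P := iterMetric φ Φ θ h (k + 1) with hP
  have hPd := posDef_iterMetric (θ := θ) hΦ hK hh.le (k + 1)
  have hPc := continuousOn_iterMetric hΦ hK hh.le h0 h1 (k + 1)
  have hRs : ∀ a ∈ K, (averageMetric φ Φ P h a).IsSymm := fun a ha =>
    isSymm_averageMetric hΦ hK hPc hPd hh.le ha
  have hPR : ∀ a ∈ K, QuadLe (Real.exp (-(2 * L * h)) • P a) (averageMetric φ Φ P h a) :=
    fun a ha => by
    refine quadLe_averageMetric hΦ hK hPc hh ha fun s hs => QuadLe.trans (fun v => ?_)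
      (quadLe_pullback_iterMetric hΦ hK hh.le h0 h1 hL hs.1 (k + 1) a ha)
    have h2 : 0 ≤ v ⬝ᵥ P a *ᵥ v := (posSemidef_iff_quad.1 (hPd a ha).posSemidef).2 v
    rw [quad_smul, quad_smul]
    refine mul_le_mul_of_nonneg_right (Real.exp_le_exp.2 ?_) h2
    have := mul_le_mul_of_nonneg_left hs.2 (by positivity : (0 : ℝ) ≤ 2 * L)
    linarith
  have hRd : ∀ a ∈ K, (averageMetric φ Φ P h a).PosDef := fun a ha =>
    QuadLe.posDef ((hPd a ha).smul (Real.exp_pos _)) (hPR a ha) (hRs a ha)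
  have hmet := isMetric_averageMetric hΦ hK hPc hh.le hRd
  have hform : ∀ a ∈ K, posRootSum φ (averageMetric φ Φ P h) (averageDeriv φ Φ P h) a
      = pencilSum (h⁻¹ • (pullback φ Φ P h a - P a)) (averageMetric φ Φ P h a) := fun a ha => by
    rw [posRootSum_eq, orbitalForm_averageMetric (hRs a ha)]
  have hSs : ∀ a ∈ K, (h⁻¹ • (pullback φ Φ P h a - P a)).IsSymm := fun a ha =>
    ((posDef_iff_quad.1 (posDef_pullback hΦ hK hPd ha hh.le)).1.sub
      (posDef_iff_quad.1 (hPd a ha)).1).smul _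
  refine ⟨_, _, hmet, ?_⟩
  obtain ⟨a, ha, hmax⟩ := (upperSemicontinuousOn_pencilSum
    (((continuousOn_pullback_space hΦ hK hPc hh.le).sub hPc).const_smul h⁻¹)
    hmet.continuousOn hSs hRd).exists_isMaxOn hne hK.isCompact
  refine ⟨_, ⟨mem_image_of_mem _ ha, ?_⟩, ?_⟩
  · rintro _ ⟨b, hb, rfl⟩
    rw [hform b hb, hform a ha]
    exact hmax hb
  · rw [hform a ha]
    refine le_trans ?_ hbound.le
    refine pencilSum_le_of_isGeomMean hκ hh (isGeomMean_iterMetric hΦ hK hh.le k ha) ?_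
      (Real.exp_pos _) (hRs a ha) (hPR a ha) (hSs a ha) ?_
    · have hD : M / κ - M * h = M * (1 - κ * h) / κ := by field_simp
      have h2 := log_det_one_add_pullback_iterMetric_le (D := M / κ - M * h) hΦ hK hh.le h0 h1 hMC
        (by rw [hD]; exact div_nonneg (mul_nonneg hM0 h0.le) hκ.le)
        (by rw [add_sub_cancel, hD, hθ]; exact le_of_eq (by ring)) k h hh.le a ha
      rw [hB]
      linarith
    · refine QuadLe.smul (fun v => ?_) (inv_pos.2 hh).le
      rw [quad_sub, quad_sub, quad_smul]
      refine sub_le_sub_right ?_ _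
      have h2 := (quadLe_iterMetric_succ hΦ hK hh.le h0 h1 hL k _
        (hK.odeFlow_mem ha hh.le)).congr_left (toMat (Φ h a)) v
      rw [Matrix.mul_smul, Matrix.smul_mul, quad_smul] at h2
      have h3 : 0 ≤ v ⬝ᵥ pullback φ Φ P h a *ᵥ v :=
        (posSemidef_iff_quad.1 (posDef_pullback hΦ hK hPd ha hh.le).posSemidef).2 v
      have h4 : Real.exp (-(κ * h ^ 2)) * (v ⬝ᵥ pullback φ Φ P h a *ᵥ v)
          ≤ v ⬝ᵥ pullback φ Φ (iterMetric φ Φ θ h k) h a *ᵥ v :=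
        (mul_le_mul_of_nonneg_right (Real.exp_le_exp.2 (by linarith)) h3).trans h2
      have h5 := mul_le_mul_of_nonneg_left h4 (Real.exp_pos (κ * h ^ 2)).le
      rwa [← mul_assoc, ← Real.exp_add, add_neg_cancel, Real.exp_zero, one_mul] at h5

end Optimal

end RestorationEntropy

/-! ### The variational formula -/

theorem theorem2 {n : ℕ} (φ : EuclideanSpace ℝ (Fin n) → EuclideanSpace ℝ (Fin n))
    (K : Set (EuclideanSpace ℝ (Fin n))) (hφ : ContDiff ℝ 1 φ) (hK : IsCompact K)
    (hKne : K.Nonempty) (hinv : IsForwardInvariantSet φ K) :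
    Tendsto (resRate φ K) atTop (𝓝 (restorationEntropy φ K)) ∧
    (∀ P Pdot : EuclideanSpace ℝ (Fin n) → Matrix (Fin n) (Fin n) ℝ,
      IsMetricWithOrbitalDeriv φ K P Pdot →
      restorationEntropy φ K ≤
        ⨆ x ∈ K, ((1 / (2 * Real.log 2) * posRootSum φ P Pdot x : ℝ) : EReal)) ∧
    (closure (interior K) = K → ∀ ε : ℝ, 0 < ε →
      ∃ P Pdot : EuclideanSpace ℝ (Fin n) → Matrix (Fin n) (Fin n) ℝ,
        IsMetricWithOrbitalDeriv φ K P Pdot ∧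
        ∃ M : ℝ, IsGreatest (posRootSum φ P Pdot '' K) M ∧
          ((1 / (2 * Real.log 2) * M - ε : ℝ) : EReal) ≤ restorationEntropy φ K) := by
  have h : RestorationEntropy.IsCompactInvariant φ K := ⟨hφ, hK, hinv⟩
  have hlog : 0 < 2 * Real.log 2 := mul_pos two_pos (Real.log_pos one_lt_two)
  obtain ⟨u, l, hu, hu0, hl⟩ := RestorationEntropy.exists_rate_limit h hKne
  obtain ⟨Φ, hΦ⟩ := h.exists_isVariationalFlow
  have hent := RestorationEntropy.restorationEntropy_eq hu hl
  rw [hent]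
  refine ⟨RestorationEntropy.tendsto_resRate hu hl, fun P Pdot hP => ?_, fun hint ε hε => ?_⟩
  · obtain ⟨a, ha⟩ := hKne
    -- only a finite supremum needs a proof
    induction hs : ⨆ x ∈ K, ((1 / (2 * Real.log 2) * posRootSum φ P Pdot x : ℝ) : EReal) with
    | bot =>
      have h1 := le_iSup₂ (f := fun x (_ : x ∈ K) =>
        ((1 / (2 * Real.log 2) * posRootSum φ P Pdot x : ℝ) : EReal)) a ha
      rw [hs] at h1
      exact absurd (le_bot_iff.1 h1) (EReal.coe_ne_bot _)
    | top => exact le_top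
    | coe s =>
      have hm : ∀ x ∈ K, posRootSum φ P Pdot x ≤ s * (2 * Real.log 2) := fun x hx => by
        have h1 := le_iSup₂ (f := fun x (_ : x ∈ K) =>
          ((1 / (2 * Real.log 2) * posRootSum φ P Pdot x : ℝ) : EReal)) x hx
        rw [hs, EReal.coe_le_coe_iff, one_div_mul_eq_div, div_le_iff₀ hlog] at h1
        exact h1
      obtain ⟨C, hC⟩ := RestorationEntropy.exists_expansion_le_of_posRootSum_le hΦ h hP hm
      have h1 := RestorationEntropy.limit_le_of_expansion_le hΦ h hu hl hC
      rw [mul_div_cancel_right₀ _ hlog.ne'] at h1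
      exact EReal.coe_le_coe_iff.2 h1
  · have hl0 : 0 ≤ l := ge_of_tendsto hl (by
      filter_upwards [eventually_ge_atTop 0] with t ht
      exact div_nonneg (hu0 t) ht)
    obtain ⟨C, hC0, hC⟩ := RestorationEntropy.exists_expansion_growth hΦ h hint hu hl
      (l' := l + ε / 2) (by linarith) hl0
    obtain ⟨P, Pdot, hP, m, hm, hm'⟩ := RestorationEntropy.exists_metric_posRootSum_le hΦ h hKne
      (M := 2 * Real.log 2 * (l + ε / 2)) (m := 2 * Real.log 2 * (l + ε)) (by positivity) hC0
      (mul_lt_mul_of_pos_left (by linarith) hlog) hC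
    refine ⟨P, Pdot, hP, m, hm, EReal.coe_le_coe_iff.2 ?_⟩
    rw [one_div_mul_eq_div, sub_le_iff_le_add, div_le_iff₀ hlog]
    linarith
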